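/- Let $\mathbb N=\{0,1,2,\dots\}$, $\mathbb N^*=\{1,2,\dots\}$, $m\in\mathbb N^*$, $I_m=\{(j,\alpha)\in\mathbb N^2 : j+\alpha\le m,\ j<m\}$, $N=\#I_m$, and let $F(t,x,z)$, $z=(z_{j,\alpha})_{(j,\alpha)\in I_m}$, be a function on an open polydisk $\Delta$ centered at the origin of $\mathbb C_t\times\mathbb C_x\times\mathbb C_z^N$ such that A$_1$) $F$ is holomorphic in $\Delta$; A$_2$) $F(0,x,0)\equiv0$ on $\Delta\cap\{t=0,z=0\}$. Write $F(t,x,z)=a(x)t+\sum_{(j,\alpha)\in I_m}b_{j,\alpha}(x)z_{j,\alpha}+R_2(t,x,z)$, where $R_2$ contains exactly the terms of order at least $2$ in $(t,z)$ of the Taylor expansion of $F$. Assume moreover A$_3$) $b_{j,\alpha}(x)=O(x^\alpha)$ as $x\to0$ for all $(j,\alpha)\in I_m$ with $\alpha>0$, and put $b_{j,\alpha}(x)=x^\alpha c_{j,\alpha}(x)$ for $(j,\alpha)\in I_m$, $c_{m,0}(x)=-1$, and $$L(\lambda,\rho)=\lambda^m-\sum_{(j,\alpha)\in I_m}c_{j,\alpha}(0)\lambda^j\rho(\rho-1)\cdots(\rho-\alpha+1).$$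 Let $\Lambda_0=\{(m,0)\}\cup\{(j,\alpha)\in I_m : c_{j,\alpha}(0)\ne0\}$, and let the Newton polygon $\mathcal N_0$ be the convex hull of $\bigcup_{(j,\alpha)\in\Lambda_0}\{(x,y)\in\mathbb R^2 : x\le j,\ y\le\alpha\}$, with vertices $(m_1,n_1)=(m,0),\dots,(m_p,n_p)$ listed by decreasing first coordinate. For $1\le i\le p-1$ let $\Gamma_i$ be the segment from $(m_i,n_i)$ to $(m_{i+1},n_{i+1})$, let $\Gamma_p=\{(x,n_p) : x\le m_p\}$, and set $P_i(X)=\sum_{(j,\alpha)\in\Lambda_0\cap\Gamma_i}c_{j,\alpha}(0)X^{j-m_{i+1}}$ for $1\le i\le p-1$, $P_p(X)=1$ if $m_p=0$, and $P_p(X)=\sum_{(j,\alpha)\in\Lambda_0\cap\Gamma_p}c_{j,\alpha}(0)X^{j}$ if $m_p\ge1$. Assume (N) $L(k,l)\ne0$ for all $(k,l)\in\mathbb N^*\times\mathbb N$; (GP) for $1\le i\le p-1$ no root of $P_i$ lies in $[0,\infty)$, and no root of $P_p$ lies in $\mathbb N^*$. Let $\Lambda_1=\{(j,\alpha)\in I_m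 : c_{j,\alpha}(0)=0,\ c_{j,\alpha}\not\equiv0\}$; for $(j,\alpha)\in\Lambda_1$ let $p_{j,\alpha}$ be the order of the zero of $c_{j,\alpha}$ at $x=0$ and $d_{j,\alpha}=\min\{y\in\mathbb R : (j,\alpha-y)\in\mathcal N_0\}$. The irregularity at $x=0$ is $$\sigma_0=\max\Bigl[1,\ \max_{(j,\alpha)\in\Lambda_1}\frac{p_{j,\alpha}+d_{j,\alpha}}{p_{j,\alpha}}\Bigr].$$ For $\mu\in\mathbb N$ and $(j,\alpha)\in I_m$ let $L_{\mu,j,\alpha}\in\mathbb N\cup\{\infty\}$ be the valuation (lowest total degree in $(t,z)$ of a nonzero Taylor term, $\infty$ for the zero series) of $(\partial_{z_{j,\alpha}}\partial_x^\mu R_2)(t,0,z)$, and let $$s_0=1+\max\Bigl[0,\ \max_{0\le\mu<m}\ \max_{(j,\alpha)\in I_m}\frac{j+\mu+\sigma_0(\alpha-\mu)-m}{L_{\mu,j,\alpha}}\Bigr],$$ where a quotient with denominator $\infty$ is $0$. For real $s,\sigma\ge1$ let $G\{t,x\}_{(s,\sigma)}$ be the set of all $\sum_{k,l\ge0}a_{k,l}t^kx^l\in\mathbb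 C[[t,x]]$ such that $\sum_{k,l\ge0}\frac{a_{k,l}}{k!^{s-1}l!^{\sigma-1}}t^kx^l$ converges in a neighborhood of $(0,0)\in\mathbb C_t\times\mathbb C_x$. Then the equation $$(t\partial_t)^mu=F\bigl(t,x,\{(t\partial_t)^j\partial_x^\alpha u\}_{(j,\alpha)\in I_m}\bigr)$$ has a unique formal solution $u(t,x)\in\mathbb C[[t,x]]$ with $u(0,x)\equiv0$, and: (i) if $\sigma_0=1$, then $u(t,x)$ converges in a neighborhood of $(0,0)\in\mathbb C_t\times\mathbb C_x$; (ii) if $\sigma_0>1$, then $u(t,x)\in G\{t,x\}_{(s,\sigma)}$ for all $s\ge s_0$ and $\sigma\ge\sigma_0$. -/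

import Mathlib

open scoped Nat Topology

noncomputable section

namespace Maillet

/-- The index set `I_m = {(j, α) : j + α ≤ m, j < m}`. -/
def idxSet (m : ℕ) : Finset (ℕ × ℕ) :=
  (Finset.range m ×ˢ Finset.range (m + 1)).filter fun q => q.1 + q.2 ≤ m ∧ q.1 < m

/-- `I_m` as a type. -/
abbrev Idx (m : ℕ) : Type := ↥(idxSet m)

/-- The variables `t`, `x` and `z_{j,α}`, `(j, α) ∈ I_m`, of `F(t, x, z)`. -/
abbrev Var (m : ℕ) : Type := Fin 2 ⊕ Idx m

/-- The variable `t`. -/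
abbrev vt (m : ℕ) : Var m := Sum.inl 0

/-- The variable `x`. -/
abbrev vx (m : ℕ) : Var m := Sum.inl 1

/-- The variable `z_{j,α}`. -/
abbrev vz {m : ℕ} (q : Idx m) : Var m := Sum.inr q

/-- The open polydisk of polyradius `r` centered at the origin. -/
def polydisk (m : ℕ) (r : Var m → ℝ) : Set (Var m → ℂ) := {w | ∀ v, ‖w v‖ < r v}

/-- The Taylor coefficient `(∂^d F)(0) / d!` of `F` at the origin. The mixed derivative `∂^d F` is
the iterated Fréchet derivative evaluated at the list of basis vectors in which the one of the
variable `v` occurs `d v` times. -/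
def taylorCoeff {m : ℕ} (F : (Var m → ℂ) → ℂ) (d : Var m →₀ ℕ) : ℂ :=
  iteratedFDeriv ℂ (Finsupp.toMultiset d).toList.length F 0
      (fun i => Pi.single ((Finsupp.toMultiset d).toList.get i) 1)
    / ∏ v, ((d v)! : ℂ)

/-- The Taylor series of `F` at the origin, in `ℂ[[t, x, z]]`. -/
def taylor {m : ℕ} (F : (Var m → ℂ) → ℂ) : MvPowerSeries (Var m) ℂ := fun d => taylorCoeff F d

/-! ### Formal solutions and Gevrey classes -/

/-- `ℂ[[t, x]]`; the variable `0` is `t` and the variable `1` is `x`. -/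
abbrev FPS : Type := MvPowerSeries (Fin 2) ℂ

/-- The operator `t ∂_t`. -/
def tDt (u : FPS) : FPS := MvPowerSeries.X 0 * MvPowerSeries.pderiv ℂ 0 u

/-- The operator `∂_x`. -/
def Dx (u : FPS) : FPS := MvPowerSeries.pderiv ℂ 1 u

/-- What is substituted for the variables of `F`: `t`, `x` and `(t ∂_t)^j ∂_x^α u`. -/
def jet (m : ℕ) (u : FPS) : Var m → FPS
  | Sum.inl i => MvPowerSeries.X i
  | Sum.inr q => tDt^[q.1.1] (Dx^[q.1.2] u)

/-- `u ∈ ℂ[[t, x]]` satisfies `u(0, x) ≡ 0` and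
`(t ∂_t)^m u = F(t, x, {(t ∂_t)^j ∂_x^α u})`. As `u(0, x) ≡ 0`, all components of `jet m u` have
constant coefficient zero, so that the Taylor series of `F` can be composed with them. -/
def IsFormalSolution {m : ℕ} (F : (Var m → ℂ) → ℂ) (u : FPS) : Prop :=
  (∀ l : ℕ, MvPowerSeries.coeff (Finsupp.single 1 l) u = 0) ∧
    tDt^[m] u = MvPowerSeries.subst (jet m u) (taylor F)

/-- Convergence of a power series in a neighborhood of `(0, 0) ∈ ℂ × ℂ`. -/
def IsConvergent (f : FPS) : Prop :=
  ∀ᶠ w : ℂ × ℂ in 𝓝 0,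
    Summable fun d : Fin 2 →₀ ℕ => MvPowerSeries.coeff d f * w.1 ^ d 0 * w.2 ^ d 1

/-- The series `∑ a_{k,l} / (k!^{s-1} l!^{σ-1}) t^k x^l`. -/
def borel (s σ : ℝ) (f : FPS) : FPS := fun d =>
  MvPowerSeries.coeff d f / ((((d 0)! : ℝ) ^ (s - 1) * ((d 1)! : ℝ) ^ (σ - 1) : ℝ) : ℂ)

/-- The formal Gevrey class `G{t, x}_{(s, σ)}`. -/
def Gevrey (s σ : ℝ) : Set FPS := {f | IsConvergent (borel s σ f)}

/-! ### The linear part of the equation -/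

/-- The exponent of the monomial `x^l z_q`. -/
def linExp {m : ℕ} (q : Idx m) (l : ℕ) : Var m →₀ ℕ :=
  Finsupp.single (vx m) l + Finsupp.single (vz q) 1

/-- The expansion at `x = 0` of `b_{j,α}(x) = (∂F/∂z_{j,α})(0, x, 0)`. -/
def b {m : ℕ} (F : (Var m → ℂ) → ℂ) (q : Idx m) : PowerSeries ℂ :=
  PowerSeries.mk fun l => MvPowerSeries.coeff (linExp q l) (taylor F)

/-- The expansion at `x = 0` of `c_{j,α}(x) = x^{-α} b_{j,α}(x)` for `(j, α) ∈ I_m`; moreover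
`c_{m,0} = -1`, and `c_{j,α} = 0` for all other pairs. -/
def c {m : ℕ} (F : (Var m → ℂ) → ℂ) (q : ℕ × ℕ) : PowerSeries ℂ :=
  if q = (m, 0) then -1
  else if h : q ∈ idxSet m then
    PowerSeries.mk fun l => PowerSeries.coeff (l + q.2) (b F ⟨q, h⟩)
  else 0

/-- The value `c_{j,α}(0)`. -/
def c0 {m : ℕ} (F : (Var m → ℂ) → ℂ) (q : ℕ × ℕ) : ℂ := PowerSeries.constantCoeff (c F q)

/-- `L(λ, ρ) = λ^m - ∑_{(j,α) ∈ I_m} c_{j,α}(0) λ^j ρ (ρ - 1) ⋯ (ρ - α + 1)`. -/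
def L {m : ℕ} (F : (Var m → ℂ) → ℂ) (lam ρ : ℂ) : ℂ :=
  lam ^ m - ∑ q ∈ idxSet m, c0 F q * lam ^ q.1 * ∏ i ∈ Finset.range q.2, (ρ - (i : ℂ))

/-- `A₁)` for the polydisk of polyradius `r`: `F` is holomorphic. -/
def A1 {m : ℕ} (F : (Var m → ℂ) → ℂ) (r : Var m → ℝ) : Prop :=
  AnalyticOnNhd ℂ F (polydisk m r)

/-- `A₂)` for the polydisk of polyradius `r`: `F(0, x, 0) ≡ 0`. -/
def A2 {m : ℕ} (F : (Var m → ℂ) → ℂ) (r : Var m → ℝ) : Prop :=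
  ∀ w ∈ polydisk m r, (∀ v, v ≠ vx m → w v = 0) → F w = 0

/-- `A₃)`: `b_{j,α}(x) = O(x^α)` for all `(j, α) ∈ I_m` with `α > 0`. -/
def A3 {m : ℕ} (F : (Var m → ℂ) → ℂ) : Prop :=
  ∀ q : Idx m, 0 < q.1.2 → (PowerSeries.X : PowerSeries ℂ) ^ q.1.2 ∣ b F q

/-- The non-resonance condition (N). -/
def NonResonance {m : ℕ} (F : (Var m → ℂ) → ℂ) : Prop :=
  ∀ k l : ℕ, 1 ≤ k → L F k l ≠ 0

/-! ### The Newton polygon and the generalized Poincaré condition -/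

open scoped Classical in
/-- `Λ₀ = {(m, 0)} ∪ {(j, α) ∈ I_m : c_{j,α}(0) ≠ 0}`. -/
def Λ₀ {m : ℕ} (F : (Var m → ℂ) → ℂ) : Finset (ℕ × ℕ) :=
  insert (m, 0) ((idxSet m).filter fun q => c0 F q ≠ 0)

/-- A pair of natural numbers as a point of the plane. -/
def pt (q : ℕ × ℕ) : ℝ × ℝ := ((q.1 : ℝ), (q.2 : ℝ))

/-- The Newton polygon: the convex hull of the union of the quadrants
`{(x, y) : x ≤ j, y ≤ α}`, `(j, α) ∈ Λ₀`. -/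
def newtonPolygon {m : ℕ} (F : (Var m → ℂ) → ℂ) : Set (ℝ × ℝ) :=
  convexHull ℝ (⋃ q ∈ Λ₀ F, {y : ℝ × ℝ | y.1 ≤ (pt q).1 ∧ y.2 ≤ (pt q).2})

/-- The vertices of the Newton polygon. -/
def IsVertex {m : ℕ} (F : (Var m → ℂ) → ℂ) (v : ℕ × ℕ) : Prop :=
  pt v ∈ (newtonPolygon F).extremePoints ℝ

/-- `v = (m_i, n_i)` and `w = (m_{i+1}, n_{i+1})` are consecutive vertices, listed by decreasing
first coordinate; the corresponding bounded edge `Γ_i` is the segment from `v` to `w`. -/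
def IsEdge {m : ℕ} (F : (Var m → ℂ) → ℂ) (v w : ℕ × ℕ) : Prop :=
  IsVertex F v ∧ IsVertex F w ∧ w.1 < v.1 ∧ ∀ y, IsVertex F y → ¬ (w.1 < y.1 ∧ y.1 < v.1)

/-- `v` is the last vertex `(m_p, n_p)`, the one with the least first coordinate. -/
def IsLastVertex {m : ℕ} (F : (Var m → ℂ) → ℂ) (v : ℕ × ℕ) : Prop :=
  IsVertex F v ∧ ∀ y, IsVertex F y → v.1 ≤ y.1

open scoped Classical in
/-- The characteristic polynomial `∑_{(j,α) ∈ Λ₀ ∩ Γ_i} c_{j,α}(0) X^{j - m_{i+1}}` of the edge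
`Γ_i` from `v` to `w = (m_{i+1}, n_{i+1})`. -/
def edgePoly {m : ℕ} (F : (Var m → ℂ) → ℂ) (v w : ℕ × ℕ) : Polynomial ℂ :=
  ∑ q ∈ (Λ₀ F).filter (fun q => pt q ∈ segment ℝ (pt v) (pt w)),
    Polynomial.C (c0 F q) * Polynomial.X ^ (q.1 - w.1)

open scoped Classical in
/-- The characteristic polynomial of the horizontal half line `Γ_p` ending in the last vertex
`v = (m_p, n_p)`: it is `1` if `m_p = 0` and `∑_{(j,α) ∈ Λ₀ ∩ Γ_p} c_{j,α}(0) X^j` otherwise. -/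
def lastPoly {m : ℕ} (F : (Var m → ℂ) → ℂ) (v : ℕ × ℕ) : Polynomial ℂ :=
  if v.1 = 0 then 1
  else ∑ q ∈ (Λ₀ F).filter (fun q => q.1 ≤ v.1 ∧ q.2 = v.2),
    Polynomial.C (c0 F q) * Polynomial.X ^ q.1

/-- The generalized Poincaré condition (GP): no characteristic root on a bounded edge lies in
`[0, ∞)`, and no characteristic root on the horizontal half line is a positive integer. -/
def GenPoincare {m : ℕ} (F : (Var m → ℂ) → ℂ) : Prop :=
  (∀ v w, IsEdge F v w → ∀ lam : ℂ, (edgePoly F v w).IsRoot lam →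
      ∀ y : ℝ, 0 ≤ y → lam ≠ (y : ℂ)) ∧
    (∀ v, IsLastVertex F v → ∀ lam : ℂ, (lastPoly F v).IsRoot lam →
      ∀ n : ℕ, 1 ≤ n → lam ≠ (n : ℂ))

/-! ### The indices `σ₀` and `s₀` -/

open scoped Classical in
/-- `Λ₁ = {(j, α) ∈ I_m : c_{j,α}(0) = 0, c_{j,α} ≢ 0}`. -/
def Λ₁ {m : ℕ} (F : (Var m → ℂ) → ℂ) : Finset (ℕ × ℕ) :=
  (idxSet m).filter fun q => c0 F q = 0 ∧ c F q ≠ 0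

/-- The order `p_{j,α}` of the zero of `c_{j,α}` at `x = 0` (used for `c_{j,α} ≢ 0` only). -/
def p {m : ℕ} (F : (Var m → ℂ) → ℂ) (q : ℕ × ℕ) : ℕ := (c F q).order.toNat

/-- `d_{j,α} = min {y ∈ ℝ : (j, α - y) ∈ N₀}`; the minimum exists for `0 ≤ j ≤ m`. -/
def d {m : ℕ} (F : (Var m → ℂ) → ℂ) (q : ℕ × ℕ) : ℝ :=
  sInf {y : ℝ | ((q.1 : ℝ), (q.2 : ℝ) - y) ∈ newtonPolygon F}

/-- The irregularity `σ₀ = max [1, max_{(j,α) ∈ Λ₁} (p_{j,α} + d_{j,α}) / p_{j,α}]`. -/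
def σ₀ {m : ℕ} (F : (Var m → ℂ) → ℂ) : ℝ :=
  (Λ₁ F).fold max 1 fun q => ((p F q : ℝ) + d F q) / (p F q : ℝ)

/-- `R₂(t, x, z)`: the part of `F` of order at least two in `(t, z)`. -/
def R₂ {m : ℕ} (F : (Var m → ℂ) → ℂ) : MvPowerSeries (Var m) ℂ := fun e =>
  if 2 ≤ e (vt m) + ∑ q : Idx m, e (vz q) then MvPowerSeries.coeff e (taylor F) else 0

/-- `f(t, 0, z)`, as a power series that does not involve `x`. -/
def atXZero {m : ℕ} (f : MvPowerSeries (Var m) ℂ) : MvPowerSeries (Var m) ℂ := fun e =>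
  if e (vx m) = 0 then MvPowerSeries.coeff e f else 0

/-- `L_{μ,j,α}`: the valuation (order) of `(∂_{z_{j,α}} ∂_x^μ R₂)(t, 0, z)`, which is `⊤` if this
series is zero. -/
def Lval {m : ℕ} (F : (Var m → ℂ) → ℂ) (μ : ℕ) (q : Idx m) : ℕ∞ :=
  (atXZero (MvPowerSeries.pderiv ℂ (vz q)
    ((MvPowerSeries.pderiv ℂ (vx m))^[μ] (R₂ F)))).order

/-- The quotient `(j + μ + σ₀ (α - μ) - m) / L_{μ,j,α}`, which is zero if `L_{μ,j,α} = ∞`. -/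
def s₀Quot {m : ℕ} (F : (Var m → ℂ) → ℂ) (μ : ℕ) (q : Idx m) : ℝ :=
  if Lval F μ q = ⊤ then 0
  else ((q.1.1 : ℝ) + μ + σ₀ F * ((q.1.2 : ℝ) - μ) - m) / ((Lval F μ q).toNat : ℝ)

/-- `s₀ = 1 + max [0, max_{0 ≤ μ < m} max_{(j,α) ∈ I_m}
(j + μ + σ₀ (α - μ) - m) / L_{μ,j,α}]`. -/
def s₀ {m : ℕ} (F : (Var m → ℂ) → ℂ) : ℝ :=
  1 + (Finset.range m ×ˢ (Finset.univ : Finset (Idx m))).fold max 0 fun y => s₀Quot F y.1 y.2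

end Maillet

end

/-!
Comparing the coefficients of `t^k x^l`, the equation reads `L(k, l) u_{k,l} =` (an expression in
earlier coefficients), so (N) gives exactly one formal solution. Its growth rests on two facts.

First, `|L(k, l)| ≥ δ ∑_{(j,α) ∈ Λ₀} k^j (l + 1)^α` for some `δ > 0`. Otherwise, along some
ultrafilter, the shares of these monomials in the sum converge to limits carried by a face of the
Newton polygon, and the vanishing limit of the quotient exhibits a root forbidden by (GP): a
positive root of the polynomial of an edge or, where `k` stays bounded, the root `k` of the
polynomial of the half line.

Second, for `τ = σ₀ - 1` and `ς = s₀ - 1` (and for `τ = ς = 0` if `σ₀ = 1`) there is a majorant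
`A^(2k-1) (k-1)!^ς k^(-γ) w(k, l)`, in which `w(k, l)` is a Gevrey factor of order `τ` times the
coefficient of `x^l` in a power of `(1 - B x)⁻¹` with exponent linear in `k`. It is stable under the
products in `R₂`, and the loss in the derivatives is compensated by the lower bound for `L`, by the
definition of `σ₀` and by that of `s₀`. If `A` is large with respect to `B`, the induction closes.
-/

noncomputable section

namespace Maillet

open Finset.HasAntidiagonal (antidiagonal mem_antidiagonal)

/-! ### Coefficients of double power series -/

/-- The exponent of the monomial `t^k x^l`. -/
def expo (k l : ℕ) : Fin 2 →₀ ℕ := Finsupp.single 0 k + Finsupp.single 1 l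

@[simp] lemma expo_apply_zero (k l : ℕ) : expo k l 0 = k := by simp [expo]

@[simp] lemma expo_apply_one (k l : ℕ) : expo k l 1 = l := by simp [expo]

@[simp] lemma expo_eta (d : Fin 2 →₀ ℕ) : expo (d 0) (d 1) = d := by
  ext i; fin_cases i <;> simp

lemma expo_add (k l k' l' : ℕ) : expo k l + expo k' l' = expo (k + k') (l + l') := by
  ext i; fin_cases i <;> simp

/-- The exponents in two variables as pairs of natural numbers, for reindexing sums over them. -/
def expoEquiv : ℕ × ℕ ≃ (Fin 2 →₀ ℕ) where
  toFun y := expo y.1 y.2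
  invFun d := (d 0, d 1)
  left_inv y := by simp
  right_inv d := expo_eta d

lemma expo_inj {k l k' l' : ℕ} : expo k l = expo k' l' ↔ k = k' ∧ l = l' :=
  (expoEquiv.injective.eq_iff (a := (k, l)) (b := (k', l'))).trans Prod.mk_inj

lemma single_zero_le_expo {n k l : ℕ} : Finsupp.single 0 n ≤ expo k l ↔ n ≤ k := by
  rw [Finsupp.single_le_iff, expo_apply_zero]

lemma single_one_le_expo {n k l : ℕ} : Finsupp.single 1 n ≤ expo k l ↔ n ≤ l := by
  rw [Finsupp.single_le_iff, expo_apply_one]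

section Coeff₂

variable {R : Type*} [CommSemiring R]

/-- The coefficient of `t^k x^l` in a double power series. -/
def coeff₂ (f : MvPowerSeries (Fin 2) R) (k l : ℕ) : R := MvPowerSeries.coeff (expo k l) f

lemma coeff_eq_coeff₂ (f : MvPowerSeries (Fin 2) R) (d : Fin 2 →₀ ℕ) :
    MvPowerSeries.coeff d f = coeff₂ f (d 0) (d 1) := by
  rw [coeff₂, expo_eta]

lemma ext_coeff₂ {f g : MvPowerSeries (Fin 2) R} (h : ∀ k l, coeff₂ f k l = coeff₂ g k l) :
    f = g :=
  MvPowerSeries.ext fun d => by simpa only [coeff_eq_coeff₂] using h (d 0) (d 1)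

/-- The double power series with the coefficients `a k l` of `t^k x^l`. -/
def mk₂ (a : ℕ → ℕ → R) : MvPowerSeries (Fin 2) R := fun d => a (d 0) (d 1)

@[simp] lemma coeff₂_mk₂ (a : ℕ → ℕ → R) (k l : ℕ) : coeff₂ (mk₂ a) k l = a k l := by
  change a (expo k l 0) (expo k l 1) = a k l
  rw [expo_apply_zero, expo_apply_one]

lemma coeff₂_mul (f g : MvPowerSeries (Fin 2) R) (k l : ℕ) :
    coeff₂ (f * g) k l = ∑ y ∈ antidiagonal k, ∑ w ∈ antidiagonal l,
      coeff₂ f y.1 w.1 * coeff₂ g y.2 w.2 := by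
  classical
  rw [coeff₂, MvPowerSeries.coeff_mul, ← Finset.sum_product', eq_comm]
  refine Finset.sum_bij' (fun y _ => (expo y.1.1 y.2.1, expo y.1.2 y.2.2))
    (fun y _ => ((y.1 0, y.2 0), (y.1 1, y.2 1))) ?_ ?_ ?_ ?_ ?_
  · intro y hy
    simp only [Finset.mem_product, mem_antidiagonal] at hy ⊢
    rw [expo_add, hy.1, hy.2]
  · intro y hy
    simp only [Finset.mem_product, mem_antidiagonal] at hy ⊢
    exact ⟨by simpa using DFunLike.congr_fun hy 0, by simpa using DFunLike.congr_fun hy 1⟩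
  · intro y _
    simp only [expo_apply_zero, expo_apply_one]
  · intro y _
    simp only [expo_eta]
  · intro y _
    rfl

lemma coeff₂_X_zero (k l : ℕ) :
    coeff₂ (MvPowerSeries.X 0 : MvPowerSeries (Fin 2) R) k l = if k = 1 ∧ l = 0 then 1 else 0 := by
  classical
  have h : (Finsupp.single 0 1 : Fin 2 →₀ ℕ) = expo 1 0 := by simp [expo]
  rw [coeff₂, MvPowerSeries.coeff_X, h]
  simp only [expo_inj]

lemma coeff₂_X_one_pow_mul (n : ℕ) (f : MvPowerSeries (Fin 2) R) (k l : ℕ) :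
    coeff₂ (MvPowerSeries.X 1 ^ n * f) k l = if n ≤ l then coeff₂ f k (l - n) else 0 := by
  classical
  have h : expo k l - Finsupp.single 1 n = expo k (l - n) := by
    ext i; fin_cases i <;> simp
  rw [coeff₂, MvPowerSeries.X_pow_eq, MvPowerSeries.coeff_monomial_mul, h]
  simp only [single_one_le_expo, one_mul, coeff₂]

lemma X_zero_pow_dvd_iff {n : ℕ} {f : MvPowerSeries (Fin 2) R} :
    MvPowerSeries.X 0 ^ n ∣ f ↔ ∀ k l, k < n → coeff₂ f k l = 0 := by
  rw [MvPowerSeries.X_pow_dvd_iff]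
  refine ⟨fun h k l hk => h _ (by simpa using hk), fun h d hd => ?_⟩
  rw [coeff_eq_coeff₂, h _ _ hd]

end Coeff₂

lemma coeff₂_tDt (f : FPS) (k l : ℕ) : coeff₂ (tDt f) k l = k * coeff₂ f k l := by
  classical
  rw [coeff₂, tDt, MvPowerSeries.X_def, MvPowerSeries.coeff_monomial_mul]
  simp only [single_zero_le_expo]
  rcases Nat.eq_zero_or_pos k with rfl | hk
  · simp
  · have h : (((expo k l - Finsupp.single 0 1 : Fin 2 →₀ ℕ) 0 : ℕ) : ℂ) + 1 = k := by
      rw [Finsupp.tsub_apply, expo_apply_zero, Finsupp.single_eq_same]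
      exact_mod_cast Nat.sub_add_cancel hk
    rw [if_pos (show 1 ≤ k from hk), MvPowerSeries.coeff_pderiv, h,
      tsub_add_cancel_of_le (single_zero_le_expo.2 hk), coeff₂]
    ring

lemma coeff₂_Dx (f : FPS) (k l : ℕ) : coeff₂ (Dx f) k l = (l + 1) * coeff₂ f k (l + 1) := by
  have h : expo k l + Finsupp.single 1 1 = expo k (l + 1) := by
    ext i; fin_cases i <;> simp
  rw [coeff₂, Dx, MvPowerSeries.coeff_pderiv, h, expo_apply_one, mul_comm, coeff₂]

lemma coeff₂_tDt_iterate (j : ℕ) (f : FPS) (k l : ℕ) :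
    coeff₂ (tDt^[j] f) k l = (k : ℂ) ^ j * coeff₂ f k l := by
  induction j with
  | zero => simp
  | succ j ih => rw [Function.iterate_succ_apply', coeff₂_tDt, ih]; ring

lemma coeff₂_Dx_iterate (α : ℕ) (f : FPS) (k l : ℕ) :
    coeff₂ (Dx^[α] f) k l = ((l + 1).ascFactorial α : ℂ) * coeff₂ f k (l + α) := by
  induction α generalizing l with
  | zero => simp
  | succ α ih =>
    rw [Function.iterate_succ_apply', coeff₂_Dx, ih, show l + 1 + α = l + (α + 1) by ring,
      ← Nat.succ_eq_add_one (l + 1), Nat.ascFactorial, ← Nat.succ_ascFactorial]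
    push_cast
    ring

lemma coeff₂_jet {m : ℕ} (u : FPS) (q : Idx m) (k l : ℕ) :
    coeff₂ (jet m u (vz q)) k l
      = (k : ℂ) ^ q.1.1 * (((l + 1).ascFactorial q.1.2 : ℂ) * coeff₂ u k (l + q.1.2)) := by
  simp only [jet, coeff₂_tDt_iterate, coeff₂_Dx_iterate]

/-! ### Taylor coefficients of a holomorphic function -/

lemma factorial_sum_le_card_pow_mul {ι : Type*} (s : Finset ι) (d : ι → ℕ) :
    (∑ i ∈ s, d i)! ≤ s.card ^ (∑ i ∈ s, d i) * ∏ i ∈ s, (d i)! := by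
  classical
  set e : ι → ℕ := fun i => if i ∈ s then d i else 0
  have he : ∀ i ∈ s, e i = d i := fun i hi => if_pos hi
  have h := Finset.sum_pow_eq_sum_piAntidiag s (fun _ => (1 : ℕ)) (∑ i ∈ s, d i)
  simp only [Finset.sum_const, smul_eq_mul, mul_one, one_pow, Finset.prod_const_one,
    Nat.cast_id] at h
  rw [← Nat.multinomial_spec s d, mul_comm, h]
  refine Nat.mul_le_mul_right _ ?_
  rw [← Nat.multinomial_congr he]
  refine Finset.single_le_sum (f := fun k => Nat.multinomial s k) (fun _ _ => Nat.zero_le _) ?_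
  rw [Finset.mem_piAntidiag]
  exact ⟨Finset.sum_congr rfl he, fun i hi => by_contra fun h => hi (if_neg h)⟩

section Analytic

variable {𝕜 V W : Type*} [NontriviallyNormedField 𝕜] [NormedAddCommGroup V] [NormedSpace 𝕜 V]
  [NormedAddCommGroup W] [NormedSpace 𝕜 W] [CompleteSpace W] {f : V → W}

lemma exists_norm_iteratedFDeriv_apply_le {x : V} (hf : AnalyticAt 𝕜 f x) :
    ∃ C a : ℝ, 0 < C ∧ 0 < a ∧ ∀ (n : ℕ) (v : Fin n → V), (∀ i, ‖v i‖ ≤ 1) →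
      ‖iteratedFDeriv 𝕜 n f x v‖ ≤ n ! * (C * a ^ n) := by
  obtain ⟨P, r, hP⟩ := hf
  obtain ⟨C, a, hC, ha, hPa⟩ := P.le_mul_pow_of_radius_pos (hP.r_pos.trans_le hP.r_le)
  refine ⟨C, a, hC, ha, fun n v hv => ?_⟩
  have hterm (π : Equiv.Perm (Fin n)) : ‖P n fun i => v (π i)‖ ≤ C * a ^ n :=
    ((P n).le_opNorm_mul_prod_of_le fun i => hv (π i)).trans (by simpa using hPa n)
  rw [hP.iteratedFDeriv_eq_sum_of_completeSpace]
  calc ‖∑ π : Equiv.Perm (Fin n), P n fun i => v (π i)‖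
      ≤ ∑ _π : Equiv.Perm (Fin n), C * a ^ n := norm_sum_le_of_le _ fun π _ => hterm π
    _ = n ! * (C * a ^ n) := by simp [Fintype.card_perm]

lemma iteratedFDeriv_apply_const_eq_zero {v : V} (hf : AnalyticAt 𝕜 f 0)
    (h0 : ∀ᶠ y : 𝕜 in 𝓝 0, f (y • v) = 0) (n : ℕ) :
    iteratedFDeriv 𝕜 n f 0 (fun _ => v) = 0 := by
  obtain ⟨P, r, hP⟩ := hf
  let g : 𝕜 →L[𝕜] V := ContinuousLinearMap.toSpanSingleton 𝕜 v
  have hfg : HasFPowerSeriesAt (f ∘ g) (P.compContinuousLinearMap g) 0 :=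
    HasFPowerSeriesAt.compContinuousLinearMap (u := g) (by rw [map_zero]; exact ⟨r, hP⟩)
  have hzero : HasFPowerSeriesAt (0 : 𝕜 → W) (P.compContinuousLinearMap g) 0 :=
    hfg.congr (by filter_upwards [h0] with y hy using hy)
  have hPv : P n (fun _ => v) = 0 := by
    have h := hzero.apply_eq_zero n 1
    rw [FormalMultilinearSeries.compContinuousLinearMap_apply] at h
    rwa [show (fun _ => v) = g ∘ fun _ : Fin n => 1 from
      funext fun _ => (ContinuousLinearMap.toSpanSingleton_apply_one ..).symm]
  rw [hP.iteratedFDeriv_eq_sum_of_completeSpace]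
  exact Finset.sum_eq_zero fun _ _ => hPv

end Analytic

section Taylor

variable {m : ℕ} {F : (Var m → ℂ) → ℂ}

lemma exists_norm_coeff_taylor_le (hF : AnalyticAt ℂ F 0) :
    ∃ C a : ℝ, 0 < C ∧ 1 ≤ a ∧
      ∀ d : Var m →₀ ℕ, ‖MvPowerSeries.coeff d (taylor F)‖ ≤ C * a ^ (∑ v, d v) := by
  obtain ⟨C, a, hC, ha, hFa⟩ := exists_norm_iteratedFDeriv_apply_le hF
  set N : ℝ := (Fintype.card (Var m) : ℝ)
  refine ⟨C, max 1 (N * a), hC, le_max_left _ _, fun d => ?_⟩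
  have hlength : (Finsupp.toMultiset d).toList.length = ∑ v, d v := by
    rw [Multiset.length_toList, Finsupp.card_toMultiset, Finsupp.sum_fintype _ _ fun _ => rfl]
    rfl
  have hderiv : ‖iteratedFDeriv ℂ (Finsupp.toMultiset d).toList.length F 0
      (fun i => Pi.single ((Finsupp.toMultiset d).toList.get i) 1)‖
        ≤ (∑ v, d v)! * (C * a ^ (∑ v, d v)) := by
    rw [← hlength]
    exact hFa _ _ fun i => by rw [Pi.norm_single, norm_one]
  have hfact : ((∑ v, d v)! : ℝ) ≤ N ^ (∑ v, d v) * ∏ v, ((d v)! : ℝ) := by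
    simp only [N, ← Finset.card_univ]
    exact_mod_cast factorial_sum_le_card_pow_mul Finset.univ d
  have hnorm : ‖∏ v, ((d v)! : ℂ)‖ = ∏ v, ((d v)! : ℝ) := by
    rw [norm_prod]; simp only [Complex.norm_natCast]
  change ‖taylorCoeff F d‖ ≤ _
  rw [taylorCoeff, norm_div, hnorm, div_le_iff₀ (by positivity)]
  calc _ ≤ ((∑ v, d v)! : ℝ) * (C * a ^ (∑ v, d v)) := hderiv
    _ ≤ (N ^ (∑ v, d v) * ∏ v, ((d v)! : ℝ)) * (C * a ^ (∑ v, d v)) := by gcongr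
    _ = C * (N * a) ^ (∑ v, d v) * ∏ v, ((d v)! : ℝ) := by rw [mul_pow]; ring
    _ ≤ C * max 1 (N * a) ^ (∑ v, d v) * ∏ v, ((d v)! : ℝ) := by
      gcongr
      exact le_max_right _ _

lemma coeff_taylor_single_eq_zero (hF : AnalyticAt ℂ F 0) {v : Var m}
    (h0 : ∀ᶠ y : ℂ in 𝓝 0, F (Pi.single v y) = 0) (l : ℕ) :
    MvPowerSeries.coeff (Finsupp.single v l) (taylor F) = 0 := by
  have hdirection (i) : (Finsupp.toMultiset (Finsupp.single v l)).toList.get i = v := by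
    have hi := Finsupp.mem_toMultiset _ _ |>.1 (Multiset.mem_toList.1 (List.get_mem _ i))
    exact Finset.mem_singleton.1 (Finsupp.support_single_subset hi)
  change taylorCoeff F _ = 0
  simp only [taylorCoeff, hdirection]
  rw [iteratedFDeriv_apply_const_eq_zero hF, zero_div]
  filter_upwards [h0] with y hy
  simpa [← Pi.single_smul] using hy

lemma A1.analyticAt {r : Var m → ℝ} (hA1 : A1 F r) (hr : ∀ v, 0 < r v) : AnalyticAt ℂ F 0 :=
  hA1 0 fun v => by simpa using hr v

lemma A2.coeff_taylor_vx {r : Var m → ℝ} (hA2 : A2 F r) (hA1 : A1 F r) (hr : ∀ v, 0 < r v)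
    (l : ℕ) : MvPowerSeries.coeff (Finsupp.single (vx m) l) (taylor F) = 0 := by
  refine coeff_taylor_single_eq_zero (hA1.analyticAt hr) ?_ l
  filter_upwards [Metric.ball_mem_nhds (0 : ℂ) (hr (vx m))] with y hy
  refine hA2 _ (fun v => ?_) fun v hv => Pi.single_eq_of_ne hv _
  by_cases h : v = vx m
  · subst h; simpa using hy
  · simpa [Pi.single_eq_of_ne h] using hr v

end Taylor

section NewtonPolygon

variable {m : ℕ} {F : (Var m → ℂ) → ℂ}

lemma mem_idxSet {q : ℕ × ℕ} : q ∈ idxSet m ↔ q.1 + q.2 ≤ m ∧ q.1 < m := by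
  simp only [idxSet, Finset.mem_filter, Finset.mem_product, Finset.mem_range]
  omega

lemma m_zero_notMem_idxSet : (m, 0) ∉ idxSet m := by simp [mem_idxSet]

lemma c0_m_zero : c0 F (m, 0) = -1 := by simp [c0, c]

lemma m_zero_mem_Λ₀ : (m, 0) ∈ Λ₀ F := by simp [Λ₀]

lemma c0_ne_zero_of_mem_Λ₀ {q : ℕ × ℕ} (hq : q ∈ Λ₀ F) : c0 F q ≠ 0 := by
  classical
  rw [Λ₀, Finset.mem_insert, Finset.mem_filter] at hq
  rcases hq with rfl | hq
  · simp [c0_m_zero]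
  · exact hq.2

lemma fst_lt_of_mem_Λ₀ {q : ℕ × ℕ} (hq : q ∈ Λ₀ F) (hne : q ≠ (m, 0)) : q.1 < m := by
  classical
  rw [Λ₀, Finset.mem_insert, Finset.mem_filter, mem_idxSet] at hq
  exact (hq.resolve_left hne).1.2

lemma convex_newtonPolygon : Convex ℝ (newtonPolygon F) := convex_convexHull ℝ _

lemma mem_newtonPolygon_of_le {q : ℕ × ℕ} (hq : q ∈ Λ₀ F) {y : ℝ × ℝ} (hy : y ≤ pt q) :
    y ∈ newtonPolygon F :=
  subset_convexHull ℝ _ (Set.mem_biUnion hq hy)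

lemma newtonPolygon_subset {C : Set (ℝ × ℝ)} (hC : Convex ℝ C)
    (h : ∀ q ∈ Λ₀ F, ∀ y ≤ pt q, y ∈ C) : newtonPolygon F ⊆ C :=
  convexHull_min (Set.iUnion₂_subset fun q hq y hy => h q hq y hy) hC

lemma isLowerSet_newtonPolygon : IsLowerSet (newtonPolygon F) := by
  intro y z hzy hy
  have hC := (convex_newtonPolygon (F := F)).translate_preimage_right (z - y)
  have := newtonPolygon_subset hC
    (fun q hq w hw => mem_newtonPolygon_of_le hq (by simpa using add_le_add (sub_nonpos.2 hzy) hw))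
    hy
  simpa using this

lemma linear_le_of_mem_newtonPolygon {s t M : ℝ} (hs : 0 ≤ s) (ht : 0 ≤ t)
    (h : ∀ q ∈ Λ₀ F, s * q.1 + t * q.2 ≤ M) {y : ℝ × ℝ} (hy : y ∈ newtonPolygon F) :
    s * y.1 + t * y.2 ≤ M := by
  have hC : Convex ℝ {y : ℝ × ℝ | s * y.1 + t * y.2 ≤ M} :=
    convex_halfSpace_le (f := fun y : ℝ × ℝ => s * y.1 + t * y.2)
      ⟨fun _ _ => by simp; ring, fun _ _ => by simp; ring⟩ M
  refine newtonPolygon_subset hC (fun q hq z hz => le_trans ?_ (h q hq)) hy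
  have h1 : z.1 ≤ q.1 := hz.1
  have h2 : z.2 ≤ q.2 := hz.2
  gcongr

/-! ### Vertices and edges of the Newton polygon -/

lemma IsVertex.eq_of_le {v : ℕ × ℕ} (hv : IsVertex F v) {z : ℝ × ℝ} (hz : z ∈ newtonPolygon F)
    (h : pt v ≤ z) : z = pt v := by
  have hz' : pt v + (pt v - z) ∈ newtonPolygon F :=
    isLowerSet_newtonPolygon (by simpa using h) (mem_extremePoints.1 hv).1
  refine (mem_extremePoints_iff_left.1 hv).2 z hz _ hz' ⟨1 / 2, 1 / 2, by simp, by simp,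
    by norm_num, ?_⟩
  module

lemma eq_of_convexCombination_eq {a b x y M : ℝ} (ha : 0 < a) (hb : 0 < b) (hab : a + b = 1)
    (hx : x ≤ M) (hy : y ≤ M) (h : a * x + b * y = M) : x = M := by
  have hbM : b * y ≤ b * M := by gcongr
  have haM : a * M ≤ a * x := by linear_combination hbM - h + M * hab
  exact hx.antisymm (le_of_mul_le_mul_left haM ha)

/-- The points that are lexicographically at most `v` for the functionals `s x + y` and `e x`. -/
def lexHalfPlane (s e : ℝ) (v : ℝ × ℝ) : Set (ℝ × ℝ) :=
  {y | s * y.1 + y.2 ≤ s * v.1 + v.2 ∧ (s * y.1 + y.2 = s * v.1 + v.2 → e * y.1 ≤ e * v.1)}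

lemma mem_lexHalfPlane_of_combination {s e a b : ℝ} (ha : 0 < a) (hb : 0 < b) (hab : a + b = 1)
    {v y z : ℝ × ℝ} (hy : y ∈ lexHalfPlane s e v) (hz : z ∈ lexHalfPlane s e v)
    (h : s * (a • y + b • z).1 + (a • y + b • z).2 = s * v.1 + v.2) :
    s * y.1 + y.2 = s * v.1 + v.2 ∧ s * z.1 + z.2 = s * v.1 + v.2 := by
  simp only [Prod.fst_add, Prod.smul_fst, smul_eq_mul, Prod.snd_add, Prod.smul_snd] at h
  exact ⟨eq_of_convexCombination_eq ha hb hab hy.1 hz.1 (by linear_combination h),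
    eq_of_convexCombination_eq hb ha (by linarith) hz.1 hy.1 (by linear_combination h)⟩

lemma convex_lexHalfPlane (s e : ℝ) (v : ℝ × ℝ) : Convex ℝ (lexHalfPlane s e v) := by
  refine convex_iff_forall_pos.2 fun y hy z hz a b ha hb hab => ⟨?_, fun h => ?_⟩
  · have h1 := mul_le_mul_of_nonneg_left hy.1 ha.le
    have h2 := mul_le_mul_of_nonneg_left hz.1 hb.le
    simp only [Prod.fst_add, Prod.smul_fst, smul_eq_mul, Prod.snd_add, Prod.smul_snd]
    linear_combination h1 + h2 + (s * v.1 + v.2) * hab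
  · obtain ⟨hy', hz'⟩ := mem_lexHalfPlane_of_combination ha hb hab hy hz h
    have h1 := mul_le_mul_of_nonneg_left (hy.2 hy') ha.le
    have h2 := mul_le_mul_of_nonneg_left (hz.2 hz') hb.le
    simp only [Prod.fst_add, Prod.smul_fst, smul_eq_mul]
    linear_combination h1 + h2 + e * v.1 * hab

lemma mem_extremePoints_lexHalfPlane {s e : ℝ} (he : e ≠ 0) (v : ℝ × ℝ) :
    v ∈ (lexHalfPlane s e v).extremePoints ℝ := by
  refine mem_extremePoints_iff_left.2 ⟨⟨le_rfl, fun _ => le_rfl⟩, ?_⟩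
  rintro y hy z hz ⟨a, b, ha, hb, hab, hv⟩
  obtain ⟨hy', hz'⟩ := mem_lexHalfPlane_of_combination ha hb hab hy hz (by rw [hv])
  have h1 : a * y.1 + b * z.1 = v.1 := by simpa using congrArg Prod.fst hv
  have h2 : y.1 = v.1 := mul_left_cancel₀ he <|
    eq_of_convexCombination_eq ha hb hab (hy.2 hy') (hz.2 hz') (by linear_combination e * h1)
  exact Prod.ext h2 (by linear_combination hy' - s * h2)

lemma isVertex_of_maximal {s e : ℝ} (hs : 0 ≤ s) (he : e ≠ 0) (hse : 0 < s ∨ 0 < e)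
    {v : ℕ × ℕ} (hv : v ∈ Λ₀ F) (hmax : ∀ q ∈ Λ₀ F, pt q ∈ lexHalfPlane s e (pt v)) :
    IsVertex F v := by
  have hsub : newtonPolygon F ⊆ lexHalfPlane s e (pt v) := by
    refine newtonPolygon_subset (convex_lexHalfPlane _ _ _) fun q hq y hy => ?_
    obtain ⟨h1, h2⟩ := hmax q hq
    have hy1 : s * y.1 ≤ s * (pt q).1 := mul_le_mul_of_nonneg_left hy.1 hs
    have hy2 : y.2 ≤ (pt q).2 := hy.2
    refine ⟨by linarith, fun h => ?_⟩
    rcases hse with hs' | he'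
    · have : y.1 = (pt q).1 := mul_left_cancel₀ hs'.ne' (by linarith)
      rw [this]
      exact h2 (by linarith)
    · exact (mul_le_mul_of_nonneg_left hy.1 he'.le).trans (h2 (by linarith))
  exact inter_extremePoints_subset_extremePoints_of_subset hsub
    ⟨mem_newtonPolygon_of_le hv le_rfl, mem_extremePoints_lexHalfPlane he _⟩

lemma exists_isLastVertex (F : (Var m → ℂ) → ℂ) :
    ∃ v ∈ Λ₀ F, IsLastVertex F v ∧ ∀ q ∈ Λ₀ F, q.2 < v.2 ∨ (q.2 = v.2 ∧ q.1 ≤ v.1) := by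
  obtain ⟨v, hv, hlex⟩ := Finset.exists_max_image (Λ₀ F) (fun q => toLex (q.2, q.1))
    ⟨_, m_zero_mem_Λ₀⟩
  have hmax : ∀ q ∈ Λ₀ F, q.2 < v.2 ∨ (q.2 = v.2 ∧ q.1 ≤ v.1) := fun q hq => by
    simpa [Prod.Lex.toLex_le_toLex] using hlex q hq
  have hsnd : ∀ q ∈ Λ₀ F, q.2 ≤ v.2 := fun q hq => by have := hmax q hq; omega
  have hvertex : IsVertex F v := by
    refine isVertex_of_maximal (s := 0) (e := 1) le_rfl one_ne_zero (Or.inr one_pos) hv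
      fun q hq => ⟨by simpa [pt] using hsnd q hq, fun h => ?_⟩
    have h' : q.2 = v.2 := by simpa [pt] using h
    simpa [pt] using ((hmax q hq).resolve_left h'.not_lt).2
  refine ⟨v, hv, ⟨hvertex, fun y hy => le_of_not_gt fun hlt => ?_⟩, hmax⟩
  have hy2 : (y.2 : ℝ) ≤ v.2 := by
    simpa [pt] using linear_le_of_mem_newtonPolygon (s := 0) (t := 1) (M := v.2) le_rfl zero_le_one
      (by simpa using hsnd) (mem_extremePoints.1 hy).1
  have hle : pt y ≤ pt v := ⟨by simpa [pt] using hlt.le, hy2⟩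
  have := congrArg Prod.fst (hy.eq_of_le (mem_newtonPolygon_of_le hv le_rfl) hle)
  simp only [pt, Nat.cast_inj] at this
  omega

lemma mem_segment_iff_of_linear_eq {s M : ℝ} {v w y : ℝ × ℝ} (hv : s * v.1 + v.2 = M)
    (hw : s * w.1 + w.2 = M) (hwv : w.1 ≤ v.1) :
    y ∈ segment ℝ v w ↔ s * y.1 + y.2 = M ∧ w.1 ≤ y.1 ∧ y.1 ≤ v.1 := by
  constructor
  · rintro ⟨a, b, ha, hb, hab, rfl⟩
    obtain rfl : b = 1 - a := by linarith
    simp only [Prod.fst_add, Prod.smul_fst, smul_eq_mul, Prod.snd_add, Prod.smul_snd]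
    refine ⟨by linear_combination a * hv + (1 - a) * hw, ?_, ?_⟩ <;> nlinarith
  · rintro ⟨hy, hwy, hyv⟩
    have hmem : y.1 ∈ segment ℝ v.1 w.1 := by
      rw [segment_symm, segment_eq_Icc hwv]
      exact ⟨hwy, hyv⟩
    obtain ⟨a, b, ha, hb, hab, h⟩ := hmem
    simp only [smul_eq_mul] at h
    refine ⟨a, b, ha, hb, hab, Prod.ext h ?_⟩
    simp only [Prod.snd_add, Prod.smul_snd, smul_eq_mul]
    linear_combination a * hv + b * hw - hy - s * h + M * hab

lemma isEdge_of_linear_eq {s M : ℝ} (hs : 0 < s) (hle : ∀ q ∈ Λ₀ F, s * q.1 + q.2 ≤ M)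
    {v w : ℕ × ℕ} (hv : IsVertex F v) (hw : IsVertex F w) (hvM : s * v.1 + v.2 = M)
    (hwM : s * w.1 + w.2 = M) (hwv : w.1 < v.1) : IsEdge F v w := by
  refine ⟨hv, hw, hwv, fun y hy hbetween => ?_⟩
  have hwy : (w.1 : ℝ) < y.1 := by exact_mod_cast hbetween.1
  have hyv : (y.1 : ℝ) < v.1 := by exact_mod_cast hbetween.2
  have hseg : ((y.1 : ℝ), M - s * y.1) ∈ segment ℝ (pt v) (pt w) :=
    (mem_segment_iff_of_linear_eq hvM hwM (hwy.trans hyv).le).2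
      ⟨add_sub_cancel _ _, hwy.le, hyv.le⟩
  have hyM : s * y.1 + 1 * y.2 ≤ M :=
    linear_le_of_mem_newtonPolygon hs.le zero_le_one (by simpa using hle) (mem_extremePoints.1 hy).1
  have heq : ((y.1 : ℝ), M - s * y.1) = pt y :=
    hy.eq_of_le (convex_newtonPolygon.segment_subset (mem_extremePoints.1 hv).1
      (mem_extremePoints.1 hw).1 hseg) ⟨le_rfl, by simp only [pt]; linarith⟩
  rw [heq] at hseg
  have hne (u : ℕ × ℕ) (hu : (u.1 : ℝ) ≠ y.1) : pt u ≠ pt y := fun h => hu (congrArg Prod.fst h)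
  exact hne v hyv.ne' <| (mem_extremePoints_iff_left.1 hy).2 _ (mem_extremePoints.1 hv).1 _
    (mem_extremePoints.1 hw).1
    (mem_openSegment_of_ne_left_right (hne v hyv.ne') (hne w hwy.ne) hseg)

lemma exists_isEdge {s M : ℝ} (hs : 0 < s) (hle : ∀ q ∈ Λ₀ F, s * q.1 + q.2 ≤ M)
    {q₀ q₁ : ℕ × ℕ} (hq₀ : q₀ ∈ Λ₀ F) (hq₁ : q₁ ∈ Λ₀ F) (h₀ : s * q₀.1 + q₀.2 = M)
    (h₁ : s * q₁.1 + q₁.2 = M) (hlt : q₁.1 < q₀.1) :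
    ∃ v w : ℕ × ℕ, IsEdge F v w ∧ w ∈ Λ₀ F ∧ s * w.1 + w.2 = M ∧
      (∀ q ∈ Λ₀ F, pt q ∈ segment ℝ (pt v) (pt w) ↔ s * q.1 + q.2 = M) ∧
      ∀ q ∈ Λ₀ F, s * q.1 + q.2 = M → w.1 ≤ q.1 := by
  classical
  let S := (Λ₀ F).filter fun q => s * q.1 + q.2 = M
  have hS {q} (hq : q ∈ Λ₀ F) (hqM : s * q.1 + q.2 = M) : q ∈ S := Finset.mem_filter.2 ⟨hq, hqM⟩
  obtain ⟨v, hvS, hmax⟩ := S.exists_max_image Prod.fst ⟨q₀, hS hq₀ h₀⟩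
  obtain ⟨w, hwS, hmin⟩ := S.exists_min_image Prod.fst ⟨q₀, hS hq₀ h₀⟩
  obtain ⟨hv, hvM⟩ := Finset.mem_filter.1 hvS
  obtain ⟨hw, hwM⟩ := Finset.mem_filter.1 hwS
  have hwv : w.1 < v.1 := (hmin q₁ (hS hq₁ h₁)).trans_lt (hlt.trans_le (hmax q₀ (hS hq₀ h₀)))
  have hv_vertex : IsVertex F v := by
    refine isVertex_of_maximal hs.le one_ne_zero (Or.inl hs) hv fun q hq =>
      ⟨(hle q hq).trans_eq hvM.symm, fun h => ?_⟩
    simpa [pt] using hmax q (hS hq (h.trans hvM))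
  have hw_vertex : IsVertex F w := by
    refine isVertex_of_maximal (e := -1) hs.le (by norm_num) (Or.inl hs) hw fun q hq =>
      ⟨(hle q hq).trans_eq hwM.symm, fun h => ?_⟩
    simpa [pt] using hmin q (hS hq (h.trans hwM))
  refine ⟨v, w, isEdge_of_linear_eq hs hle hv_vertex hw_vertex hvM hwM hwv, hw, hwM,
    fun q hq => ?_, fun q hq hqM => hmin q (hS hq hqM)⟩
  rw [mem_segment_iff_of_linear_eq hvM hwM (by simpa [pt] using hwv.le)]
  exact ⟨fun h => h.1, fun h => ⟨h, by simpa [pt] using hmin q (hS hq h),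
    by simpa [pt] using hmax q (hS hq h)⟩⟩

end NewtonPolygon

/-! ### The lower bound for `L` -/

section LowerBound

open Filter

variable {m : ℕ} {F : (Var m → ℂ) → ℂ}

/-- The size of `L(k, l)` that the Newton polygon predicts: the sum of the monomials
`k ^ j * (l + 1) ^ α`, `(j, α) ∈ Λ₀`. -/
def polySize (F : (Var m → ℂ) → ℂ) (k l : ℕ) : ℝ :=
  ∑ q ∈ Λ₀ F, (k : ℝ) ^ q.1 * ((l : ℝ) + 1) ^ q.2

lemma term_le_polySize (k l : ℕ) {q : ℕ × ℕ} (hq : q ∈ Λ₀ F) :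
    (k : ℝ) ^ q.1 * ((l : ℝ) + 1) ^ q.2 ≤ polySize F k l :=
  Finset.single_le_sum (f := fun q : ℕ × ℕ => (k : ℝ) ^ q.1 * ((l : ℝ) + 1) ^ q.2)
    (fun _ _ => by positivity) hq

lemma pow_le_polySize (k l : ℕ) : (k : ℝ) ^ m ≤ polySize F k l := by
  simpa using term_le_polySize (F := F) k l m_zero_mem_Λ₀

lemma polySize_pos {k : ℕ} (hk : 1 ≤ k) (l : ℕ) : 0 < polySize F k l :=
  lt_of_lt_of_le (by positivity) (pow_le_polySize (F := F) k l)

lemma polySize_mono (k : ℕ) {l l' : ℕ} (h : l ≤ l') : polySize F k l ≤ polySize F k l' := by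
  refine Finset.sum_le_sum fun q _ => ?_
  gcongr

lemma rpow_le_polySize {k : ℕ} (hk : 1 ≤ k) (l : ℕ) {y : ℝ × ℝ} (hy : y ∈ newtonPolygon F) :
    (k : ℝ) ^ y.1 * ((l : ℝ) + 1) ^ y.2 ≤ polySize F k l := by
  have hlog : ∀ q ∈ Λ₀ F,
      Real.log k * q.1 + Real.log ((l : ℝ) + 1) * q.2 ≤ Real.log (polySize F k l) := fun q hq => by
    rw [mul_comm, mul_comm (Real.log ((l : ℝ) + 1)), ← Real.log_pow, ← Real.log_pow,
      ← Real.log_mul (by positivity) (by positivity)]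
    exact Real.log_le_log (by positivity) (term_le_polySize k l hq)
  have h := linear_le_of_mem_newtonPolygon (Real.log_nonneg (by exact_mod_cast hk))
    (Real.log_nonneg (by simp)) hlog hy
  rw [Real.rpow_def_of_pos (by positivity), Real.rpow_def_of_pos (by positivity), ← Real.exp_add]
  exact (Real.le_log_iff_exp_le (polySize_pos hk l)).1 h

lemma bddBelow_setOf_sub_mem_newtonPolygon (q : ℕ × ℕ) :
    BddBelow {y : ℝ | ((q.1 : ℝ), (q.2 : ℝ) - y) ∈ newtonPolygon F} := by
  obtain ⟨v, -, -, hmax⟩ := exists_isLastVertex F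
  have hsnd : ∀ q ∈ Λ₀ F, (q.2 : ℝ) ≤ v.2 := fun q hq => by
    have := hmax q hq
    exact_mod_cast (by omega : q.2 ≤ v.2)
  refine ⟨q.2 - v.2, fun y hy => ?_⟩
  have := linear_le_of_mem_newtonPolygon (s := 0) (t := 1) (M := v.2) le_rfl zero_le_one
    (by simpa using hsnd) hy
  linarith

lemma term_le_polySize_mul_rpow {k : ℕ} (hk : 1 ≤ k) (l : ℕ) {q : ℕ × ℕ} (hq : q.1 ≤ m) :
    (k : ℝ) ^ q.1 * ((l : ℝ) + 1) ^ q.2 ≤ polySize F k l * ((l : ℝ) + 1) ^ d F q := by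
  let Y := {y : ℝ | ((q.1 : ℝ), (q.2 : ℝ) - y) ∈ newtonPolygon F}
  have hY : Y.Nonempty :=
    ⟨q.2, mem_newtonPolygon_of_le m_zero_mem_Λ₀ ⟨by simpa [pt] using hq, by simp [pt]⟩⟩
  have hle : ∀ y ∈ Y, (k : ℝ) ^ q.1 * ((l : ℝ) + 1) ^ q.2
      ≤ polySize F k l * ((l : ℝ) + 1) ^ y := fun y hy => by
    have h := rpow_le_polySize hk l hy
    rwa [Real.rpow_natCast, Real.rpow_sub (by positivity), Real.rpow_natCast, ← mul_div_assoc,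
      div_le_iff₀ (by positivity)] at h
  have hcont : Continuous fun y : ℝ => polySize F k l * ((l : ℝ) + 1) ^ y :=
    continuous_const.mul (Real.continuous_const_rpow (by positivity))
  exact closure_minimal hle (isClosed_le continuous_const hcont)
    (csInf_mem_closure hY (bddBelow_setOf_sub_mem_newtonPolygon q))

lemma prod_range_natCast_sub_eq_descFactorial (l α : ℕ) :
    ∏ i ∈ Finset.range α, ((l : ℂ) - (i : ℂ)) = (l.descFactorial α : ℂ) := by
  rw [← descPochhammer_eval_eq_prod_range, descPochhammer_eval_eq_descFactorial]

lemma L_eq_neg_sum (k l : ℕ) :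
    L F k l = -∑ q ∈ Λ₀ F, c0 F q * ((k : ℂ) ^ q.1 * (l.descFactorial q.2 : ℂ)) := by
  classical
  have hfilter : ∀ q ∈ idxSet m, c0 F q * (k : ℂ) ^ q.1 * (l.descFactorial q.2 : ℂ)
      = if c0 F q ≠ 0 then c0 F q * ((k : ℂ) ^ q.1 * (l.descFactorial q.2 : ℂ)) else 0 :=
    fun q _ => by split_ifs with h <;> simp_all [mul_assoc]
  simp only [L, prod_range_natCast_sub_eq_descFactorial]
  rw [Λ₀, Finset.sum_insert (by simp [m_zero_notMem_idxSet]), c0_m_zero, Finset.sum_filter,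
    Finset.sum_congr rfl hfilter]
  simp only [Nat.descFactorial_zero, Nat.cast_one]
  ring

lemma tendsto_descFactorial_div (α : ℕ) :
    Tendsto (fun l : ℕ => (l.descFactorial α : ℝ) / ((l : ℝ) + 1) ^ α) atTop (𝓝 1) := by
  induction α with
  | zero => simp
  | succ α ih =>
    have hinv : Tendsto (fun l : ℕ => ((α : ℝ) + 1) / ((l : ℝ) + 1)) atTop (𝓝 0) :=
      tendsto_const_nhds.div_atTop
        (tendsto_atTop_add_const_right _ _ tendsto_natCast_atTop_atTop)
    have hprod := (hinv.const_sub 1).mul ih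
    rw [sub_zero, one_mul] at hprod
    refine hprod.congr' ?_
    filter_upwards [eventually_ge_atTop α] with l hl
    rw [Nat.descFactorial_succ]
    push_cast [Nat.cast_sub hl]
    field_simp
    ring

lemma eventually_eq_or_tendsto_atTop {ι : Type*} (U : Ultrafilter ι) (κ : ι → ℕ) :
    (∃ k, ∀ᶠ n in (U : Filter ι), κ n = k) ∨ Tendsto κ U atTop := by
  refine or_iff_not_imp_right.2 fun h => ?_
  simp only [tendsto_atTop, not_forall, Ultrafilter.eventually_not.symm, not_le] at h
  obtain ⟨N, hN⟩ := h
  have hunion : (⋃ i ∈ Set.Iio N, {n | κ n = i}) ∈ U := by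
    filter_upwards [hN] with n hn
    simpa using hn
  obtain ⟨i, -, hi⟩ := (Ultrafilter.finite_biUnion_mem_iff (Set.finite_Iio N)).1 hunion
  exact ⟨i, hi⟩

/-! ### Limits of normalized monomials -/

/-- The share of the monomial `k ^ j * (l + 1) ^ α` in `polySize F k l`. -/
def share (F : (Var m → ℂ) → ℂ) (k l : ℕ) (q : ℕ × ℕ) : ℝ :=
  (k : ℝ) ^ q.1 * ((l : ℝ) + 1) ^ q.2 / polySize F k l

/-- The logarithm of the quotient of the monomials `k ^ j * (l + 1) ^ α` with exponents
`q` and `q'`. -/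
def logGap (q q' : ℕ × ℕ) (k l : ℕ) : ℝ :=
  ((q.1 : ℝ) - q'.1) * Real.log k + ((q.2 : ℝ) - q'.2) * Real.log ((l : ℝ) + 1)

lemma share_nonneg {k : ℕ} (hk : 1 ≤ k) (l : ℕ) (q : ℕ × ℕ) : 0 ≤ share F k l q :=
  div_nonneg (by positivity) (polySize_pos hk l).le

lemma share_le_one {k : ℕ} (hk : 1 ≤ k) (l : ℕ) {q : ℕ × ℕ} (hq : q ∈ Λ₀ F) :
    share F k l q ≤ 1 :=
  (div_le_one (polySize_pos hk l)).2 (term_le_polySize k l hq)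

lemma sum_share {k : ℕ} (hk : 1 ≤ k) (l : ℕ) : ∑ q ∈ Λ₀ F, share F k l q = 1 := by
  simp only [share]
  rw [← Finset.sum_div]
  exact div_self (polySize_pos hk l).ne'

lemma logGap_eq (s : ℝ) (q q' : ℕ × ℕ) (k l : ℕ) :
    logGap q q' k l = ((q.1 : ℝ) - q'.1) * (Real.log k - s * Real.log ((l : ℝ) + 1))
      + (s * q.1 + q.2 - (s * q'.1 + q'.2)) * Real.log ((l : ℝ) + 1) := by
  rw [logGap]
  ring

lemma share_eq_share_mul_exp {k : ℕ} (hk : 1 ≤ k) (l : ℕ) (q q' : ℕ × ℕ) :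
    share F k l q = share F k l q' * Real.exp (logGap q q' k l) := by
  have hk0 : (0 : ℝ) < k := by exact_mod_cast hk
  have hl0 : (0 : ℝ) < (l : ℝ) + 1 := by positivity
  have hmono (q : ℕ × ℕ) : (k : ℝ) ^ q.1 * ((l : ℝ) + 1) ^ q.2
      = Real.exp (q.1 * Real.log k + q.2 * Real.log ((l : ℝ) + 1)) := by
    rw [Real.exp_add, Real.exp_nat_mul, Real.exp_nat_mul, Real.exp_log hk0, Real.exp_log hl0]
  rw [share, share, hmono, hmono, div_mul_eq_mul_div, ← Real.exp_add, logGap]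
  ring_nf

lemma L_div_polySize (k l : ℕ) :
    L F k l / (polySize F k l : ℂ) = -∑ q ∈ Λ₀ F, c0 F q *
      ((share F k l q * ((l.descFactorial q.2 : ℝ) / ((l : ℝ) + 1) ^ q.2) : ℝ) : ℂ) := by
  rw [L_eq_neg_sum, neg_div, Finset.sum_div]
  refine congrArg _ (Finset.sum_congr rfl fun q _ => ?_)
  have hl : (l : ℂ) + 1 ≠ 0 := by exact_mod_cast l.succ_ne_zero
  rw [share]
  push_cast
  field_simp

/-- `r` is the family of limits of the shares of the monomials in `Λ₀` along `(κ, lam)`. -/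
structure IsLimitShare {ι : Type*} (F : (Var m → ℂ) → ℂ) (U : Filter ι) (κ lam : ι → ℕ)
    (r : ℕ × ℕ → ℝ) : Prop where
  one_le : ∀ n, 1 ≤ κ n
  tendsto : ∀ q ∈ Λ₀ F, Tendsto (fun n => share F (κ n) (lam n) q) U (𝓝 (r q))

lemma exists_isLimitShare {ι : Type*} (U : Ultrafilter ι) {κ : ι → ℕ} (hκ : ∀ n, 1 ≤ κ n)
    (lam : ι → ℕ) : ∃ r, IsLimitShare F U κ lam r := by
  have hlim (q : ℕ × ℕ) :
      ∃ x, q ∈ Λ₀ F → Tendsto (fun n => share F (κ n) (lam n) q) U (𝓝 x) := by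
    by_cases hq : q ∈ Λ₀ F
    · obtain ⟨x, -, hx⟩ := (isCompact_Icc (a := (0 : ℝ)) (b := 1)).ultrafilter_le_nhds'
        (U.map fun n => share F (κ n) (lam n) q)
        (mem_map.2 <| univ_mem' fun n => ⟨share_nonneg (hκ n) _ _, share_le_one (hκ n) _ hq⟩)
      exact ⟨x, fun _ => hx⟩
    · exact ⟨0, fun h => absurd h hq⟩
  choose r hr using hlim
  exact ⟨r, hκ, hr⟩

section Limits

variable {ι : Type*} {U : Filter ι} {κ lam : ι → ℕ} {r : ℕ × ℕ → ℝ} {q q' : ℕ × ℕ}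
  {s ζ : ℝ}

lemma tendsto_log_natCast_add_one (hlam : Tendsto lam U atTop) :
    Tendsto (fun n => Real.log ((lam n : ℝ) + 1)) U atTop :=
  Real.tendsto_log_atTop.comp (tendsto_atTop_add_const_right _ _
    (tendsto_natCast_atTop_atTop.comp hlam))

namespace IsLimitShare

lemma tendsto_logGap (h : IsLimitShare F U κ lam r) (hq : q ∈ Λ₀ F) (hq' : q' ∈ Λ₀ F)
    (hr : 0 < r q) (hr' : 0 < r q') :
    Tendsto (fun n => logGap q q' (κ n) (lam n)) U (𝓝 (Real.log (r q / r q'))) := by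
  refine (((h.tendsto q hq).div (h.tendsto q' hq') hr'.ne').log (div_pos hr hr').ne').congr' ?_
  filter_upwards [(h.tendsto q' hq').eventually (lt_mem_nhds hr')] with n hn
  rw [Pi.div_apply, share_eq_share_mul_exp (h.one_le n) _ q q', mul_div_cancel_left₀ _ hn.ne',
    Real.log_exp]

variable [U.NeBot]

lemma nonneg (h : IsLimitShare F U κ lam r) (hq : q ∈ Λ₀ F) : 0 ≤ r q :=
  ge_of_tendsto' (h.tendsto q hq) fun n => share_nonneg (h.one_le n) _ _

lemma sum_eq_one (h : IsLimitShare F U κ lam r) : ∑ q ∈ Λ₀ F, r q = 1 :=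
  tendsto_nhds_unique (tendsto_finsetSum _ h.tendsto)
    (tendsto_const_nhds.congr fun n => (sum_share (h.one_le n) _).symm)

lemma exists_pos (h : IsLimitShare F U κ lam r) : ∃ q ∈ Λ₀ F, 0 < r q := by
  by_contra! hnonpos
  exact absurd h.sum_eq_one ((Finset.sum_nonpos hnonpos).trans_lt one_pos).ne

lemma sum_ne_zero_of_unique (h : IsLimitShare F U κ lam r) (hq : q ∈ Λ₀ F) (hr : 0 < r q)
    (huniq : ∀ q' ∈ Λ₀ F, 0 < r q' → q' = q) : ∑ q ∈ Λ₀ F, c0 F q * (r q : ℂ) ≠ 0 := by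
  rw [Finset.sum_eq_single_of_mem q hq fun q' hq' hne => ?_]
  · exact mul_ne_zero (c0_ne_zero_of_mem_Λ₀ hq) (by exact_mod_cast hr.ne')
  · have : r q' = 0 := (h.nonneg hq').antisymm' (not_lt.1 fun hpos => hne (huniq q' hq' hpos))
    simp [this]

lemma eq_mul_exp (h : IsLimitShare F U κ lam r) (hq : q ∈ Λ₀ F) (hq' : q' ∈ Λ₀ F) {e : ℝ}
    (he : Tendsto (fun n => logGap q q' (κ n) (lam n)) U (𝓝 e)) : r q = r q' * Real.exp e :=
  tendsto_nhds_unique (h.tendsto q hq) <|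
    ((h.tendsto q' hq').mul ((Real.continuous_exp.tendsto _).comp he)).congr fun n =>
      (share_eq_share_mul_exp (h.one_le n) _ _ _).symm

lemma eq_zero (h : IsLimitShare F U κ lam r) (hq : q ∈ Λ₀ F) (hq' : q' ∈ Λ₀ F)
    (he : Tendsto (fun n => logGap q q' (κ n) (lam n)) U atBot) : r q = 0 := by
  have hlim := (h.tendsto q' hq').mul (Real.tendsto_exp_atBot.comp he)
  rw [mul_zero] at hlim
  exact tendsto_nhds_unique (h.tendsto q hq) <|
    hlim.congr fun n => (share_eq_share_mul_exp (h.one_le n) _ _ _).symm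

-- If `log κ - s * log (lam + 1)` converges to `ζ`, then the limit shares live on the points of `Λ₀`
-- that maximize `s * j + α`, where they are proportional to `exp (j * ζ)`.
lemma eq_zero_of_linear_lt (h : IsLimitShare F U κ lam r) (hlam : Tendsto lam U atTop)
    (hζ : Tendsto (fun n => Real.log (κ n) - s * Real.log ((lam n : ℝ) + 1)) U (𝓝 ζ))
    (hq : q ∈ Λ₀ F) (hq' : q' ∈ Λ₀ F) (hlt : s * q.1 + q.2 < s * q'.1 + q'.2) : r q = 0 := by
  refine h.eq_zero hq hq' ?_
  simp only [logGap_eq s]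
  exact (hζ.const_mul _).add_atBot
    ((tendsto_log_natCast_add_one hlam).const_mul_atTop_of_neg (sub_neg.2 hlt))

lemma eq_mul_exp_of_linear_eq (h : IsLimitShare F U κ lam r)
    (hζ : Tendsto (fun n => Real.log (κ n) - s * Real.log ((lam n : ℝ) + 1)) U (𝓝 ζ))
    (hq : q ∈ Λ₀ F) (hq' : q' ∈ Λ₀ F) (heq : s * q.1 + q.2 = s * q'.1 + q'.2) :
    r q = r q' * Real.exp (((q.1 : ℝ) - q'.1) * ζ) := by
  refine h.eq_mul_exp hq hq' ?_
  simp only [logGap_eq s, sub_eq_zero.2 heq, zero_mul, add_zero]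
  exact hζ.const_mul _

lemma sum_face_eq_zero (h : IsLimitShare F U κ lam r) (hlam : Tendsto lam U atTop)
    (hζ : Tendsto (fun n => Real.log (κ n) - s * Real.log ((lam n : ℝ) + 1)) U (𝓝 ζ))
    (hq' : q' ∈ Λ₀ F) (hr' : 0 < r q') (hsum : ∑ q ∈ Λ₀ F, c0 F q * (r q : ℂ) = 0)
    {S : Finset (ℕ × ℕ)} (hS : ∀ q, q ∈ S ↔ q ∈ Λ₀ F ∧ s * q.1 + q.2 = s * q'.1 + q'.2) {w : ℕ}
    (hw : ∀ q ∈ S, w ≤ q.1) :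
    ∑ q ∈ S, c0 F q * ((Real.exp ζ : ℝ) : ℂ) ^ (q.1 - w) = 0 := by
  have hconst : ((r q' * Real.exp (((w : ℝ) - q'.1) * ζ) : ℝ) : ℂ) ≠ 0 := by
    exact_mod_cast (by positivity : r q' * Real.exp (((w : ℝ) - q'.1) * ζ) ≠ 0)
  refine (mul_eq_zero.1 ?_).resolve_left hconst
  have hsupp : ∀ q ∈ Λ₀ F, q ∉ S → c0 F q * (r q : ℂ) = 0 := fun q hq hqS => by
    rcases lt_trichotomy (s * q.1 + q.2) (s * q'.1 + q'.2) with hlt | heq | hgt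
    · simp [h.eq_zero_of_linear_lt hlam hζ hq hq' hlt]
    · exact absurd ((hS q).2 ⟨hq, heq⟩) hqS
    · exact absurd (h.eq_zero_of_linear_lt hlam hζ hq' hq hgt) hr'.ne'
  rw [← hsum, ← Finset.sum_subset (fun q hq => ((hS q).1 hq).1) hsupp, Finset.mul_sum]
  refine Finset.sum_congr rfl fun q hq => ?_
  have hexp : Real.exp (((q.1 : ℝ) - q'.1) * ζ)
      = Real.exp (((w : ℝ) - q'.1) * ζ) * Real.exp ζ ^ (q.1 - w) := by
    rw [← Real.exp_nat_mul, ← Real.exp_add, Nat.cast_sub (hw q hq)]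
    ring_nf
  rw [h.eq_mul_exp_of_linear_eq hζ ((hS q).1 hq).1 hq' ((hS q).1 hq).2, hexp]
  push_cast
  ring

lemma exists_slope (h : IsLimitShare F U κ lam r) (hκ : Tendsto κ U atTop)
    (hlam : Tendsto lam U atTop) (hq : q ∈ Λ₀ F) (hq' : q' ∈ Λ₀ F) (hr : 0 < r q)
    (hr' : 0 < r q') (hne : q ≠ q') :
    q.1 ≠ q'.1 ∧ ∃ s ζ : ℝ, 0 < s ∧ s * q.1 + q.2 = s * q'.1 + q'.2 ∧
      Tendsto (fun n => Real.log (κ n) - s * Real.log ((lam n : ℝ) + 1)) U (𝓝 ζ) := by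
  have hlog := tendsto_log_natCast_add_one hlam
  have hgap := h.tendsto_logGap hq hq' hr hr'
  have hfst : q.1 ≠ q'.1 := fun heq => by
    have hsnd : (q.2 : ℝ) - q'.2 ≠ 0 := sub_ne_zero.2 fun h' =>
      hne (Prod.ext heq (by exact_mod_cast h'))
    refine not_tendsto_nhds_of_tendsto_atTop hlog _
      ((hgap.const_mul ((q.2 : ℝ) - q'.2)⁻¹).congr fun n => ?_)
    rw [logGap, heq]
    field_simp
    ring
  have hden : (q.1 : ℝ) - q'.1 ≠ 0 := sub_ne_zero.2 fun h' => hfst (by exact_mod_cast h')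
  let s : ℝ := ((q'.2 : ℝ) - q.2) / ((q.1 : ℝ) - q'.1)
  have hline : s * q.1 + q.2 = s * q'.1 + q'.2 := by
    simp only [s]
    field_simp
    ring
  have hζ : Tendsto (fun n => Real.log (κ n) - s * Real.log ((lam n : ℝ) + 1)) U
      (𝓝 (((q.1 : ℝ) - q'.1)⁻¹ * Real.log (r q / r q'))) := by
    refine (hgap.const_mul ((q.1 : ℝ) - q'.1)⁻¹).congr fun n => ?_
    rw [logGap_eq s, sub_eq_zero.2 hline, zero_mul, add_zero, inv_mul_cancel_left₀ hden]
  refine ⟨hfst, s, _, lt_of_not_ge fun hs => ?_, hline, hζ⟩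
  refine not_tendsto_nhds_of_tendsto_atTop (tendsto_atTop_mono' _ ?_
    (Real.tendsto_log_atTop.comp (tendsto_natCast_atTop_atTop.comp hκ))) _ hζ
  filter_upwards [hlog.eventually_ge_atTop 0] with n hn
  simpa using mul_nonpos_of_nonpos_of_nonneg hs hn

lemma sum_ne_zero_of_tendsto_tendsto (h : IsLimitShare F U κ lam r) (hκ : Tendsto κ U atTop)
    (hlam : Tendsto lam U atTop) (hGP : GenPoincare F) :
    ∑ q ∈ Λ₀ F, c0 F q * (r q : ℂ) ≠ 0 := by
  classical
  intro hsum
  obtain ⟨q₀, hq₀, hr₀⟩ := h.exists_pos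
  obtain ⟨q₁, hq₁, hr₁, hne⟩ : ∃ q₁ ∈ Λ₀ F, 0 < r q₁ ∧ q₁ ≠ q₀ := by
    by_contra! huniq
    exact h.sum_ne_zero_of_unique hq₀ hr₀ huniq hsum
  obtain ⟨hfst, s, ζ, hs, hline, hζ⟩ := h.exists_slope hκ hlam hq₁ hq₀ hr₁ hr₀ hne
  have hle : ∀ q ∈ Λ₀ F, s * q.1 + q.2 ≤ s * q₀.1 + q₀.2 := fun q hq => le_of_not_gt fun hgt =>
    hr₀.ne' (h.eq_zero_of_linear_lt hlam hζ hq₀ hq hgt)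
  obtain ⟨v, w, hedge, -, -, hseg, hmin⟩ := hfst.lt_or_gt.elim
    (exists_isEdge hs hle hq₀ hq₁ rfl hline) (exists_isEdge hs hle hq₁ hq₀ hline rfl)
  refine hGP.1 v w hedge (Real.exp ζ : ℝ) ?_ _ (Real.exp_pos ζ).le rfl
  rw [Polynomial.IsRoot, edgePoly, Polynomial.eval_finsetSum]
  simp only [Polynomial.eval_mul, Polynomial.eval_C, Polynomial.eval_pow, Polynomial.eval_X]
  refine h.sum_face_eq_zero hlam hζ hq₀ hr₀ hsum (fun q => ?_) fun q hq => ?_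
  · rw [Finset.mem_filter]
    exact and_congr_right fun hq => hseg q hq
  · obtain ⟨hq, hqseg⟩ := Finset.mem_filter.1 hq
    exact hmin q hq ((hseg q hq).1 hqseg)

lemma sum_ne_zero_of_const_tendsto (h : IsLimitShare F U κ lam r) {k : ℕ}
    (hκ : ∀ᶠ n in U, κ n = k) (hlam : Tendsto lam U atTop) (hGP : GenPoincare F) :
    ∑ q ∈ Λ₀ F, c0 F q * (r q : ℂ) ≠ 0 := by
  classical
  intro hsum
  obtain ⟨n, hn⟩ := hκ.exists
  have hk : 1 ≤ k := hn ▸ h.one_le n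
  have hζ : Tendsto (fun n => Real.log (κ n) - 0 * Real.log ((lam n : ℝ) + 1)) U
      (𝓝 (Real.log k)) := tendsto_const_nhds.congr' (hκ.mono fun n hn => by simp [hn])
  obtain ⟨q₀, hq₀, hr₀⟩ := h.exists_pos
  obtain ⟨v, hv, hlast, hmax⟩ := exists_isLastVertex F
  have hq₀v : q₀.2 = v.2 := (hmax q₀ hq₀).elim (fun hlt => absurd
    (h.eq_zero_of_linear_lt hlam hζ hq₀ hv (by simpa using hlt)) hr₀.ne') And.left
  have hzero : ∑ q ∈ (Λ₀ F).filter (fun q => q.1 ≤ v.1 ∧ q.2 = v.2),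
      c0 F q * (k : ℂ) ^ q.1 = 0 := by
    have hface := h.sum_face_eq_zero (w := 0) hlam hζ hq₀ hr₀ hsum
      (S := (Λ₀ F).filter fun q => q.1 ≤ v.1 ∧ q.2 = v.2) (fun q => ?_) (by simp)
    · simpa [Real.exp_log (by exact_mod_cast hk : (0 : ℝ) < k)] using hface
    · simp only [Finset.mem_filter, zero_mul, zero_add, hq₀v, Nat.cast_inj]
      refine and_congr_right fun hq => ⟨And.right, fun heq => ⟨?_, heq⟩⟩
      exact ((hmax q hq).resolve_left heq.not_lt).2
  by_cases hv0 : v.1 = 0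
  · rw [Finset.sum_eq_single_of_mem v (by simp [hv]) fun q hq hne => ?_] at hzero
    · exact mul_ne_zero (c0_ne_zero_of_mem_Λ₀ hv)
        (pow_ne_zero _ (by exact_mod_cast (by omega : k ≠ 0))) hzero
    · obtain ⟨-, hq1, hq2⟩ := Finset.mem_filter.1 hq
      exact absurd (Prod.ext (by omega) hq2) hne
  · refine hGP.2 v hlast (k : ℂ) ?_ k hk rfl
    rw [Polynomial.IsRoot, lastPoly, if_neg hv0, Polynomial.eval_finsetSum, ← hzero]
    exact Finset.sum_congr rfl fun q _ => by simp

lemma eq_zero_of_tendsto_const (h : IsLimitShare F U κ lam r) (hκ : Tendsto κ U atTop) {l : ℕ}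
    (hlam : ∀ᶠ n in U, lam n = l) (hq : q ∈ Λ₀ F) (hne : q ≠ (m, 0)) : r q = 0 := by
  have hneg : (q.1 : ℝ) - (m : ℝ) < 0 := sub_neg.2 (by exact_mod_cast fst_lt_of_mem_Λ₀ hq hne)
  refine h.eq_zero hq m_zero_mem_Λ₀ (Tendsto.atBot_add ?_ (C := ((q.2 : ℝ) - (0 : ℕ)) *
    Real.log ((l : ℝ) + 1)) (tendsto_const_nhds.congr' (hlam.mono fun n hn => by simp [hn])))
  exact (Real.tendsto_log_atTop.comp (tendsto_natCast_atTop_atTop.comp hκ)).const_mul_atTop_of_neg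
    hneg

lemma sum_mul_eq_zero (h : IsLimitShare F U κ lam r)
    (hL : Tendsto (fun n => L F (κ n) (lam n) / (polySize F (κ n) (lam n) : ℂ)) U (𝓝 0))
    {D : ℕ → ℝ} (hD : ∀ α, Tendsto
      (fun n => ((lam n).descFactorial α : ℝ) / ((lam n : ℝ) + 1) ^ α) U (𝓝 (D α))) :
    ∑ q ∈ Λ₀ F, c0 F q * ((r q * D q.2 : ℝ) : ℂ) = 0 := by
  have hsum := tendsto_finsetSum (Λ₀ F) fun q hq => Tendsto.const_mul (c0 F q)
    ((Complex.continuous_ofReal.tendsto _).comp ((h.tendsto q hq).mul (hD q.2)))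
  refine neg_eq_zero.1 (tendsto_nhds_unique (hsum.neg.congr fun n => ?_) hL)
  exact (L_div_polySize _ _).symm

end IsLimitShare

end Limits

lemma not_tendsto_L_div_polySize {ι : Type*} {U : Ultrafilter ι} {κ : ι → ℕ} (hκ : ∀ n, 1 ≤ κ n)
    (lam : ι → ℕ) (hN : NonResonance F) (hGP : GenPoincare F) :
    ¬ Tendsto (fun n => L F (κ n) (lam n) / (polySize F (κ n) (lam n) : ℂ)) U (𝓝 0) := by
  intro hL
  obtain ⟨r, h⟩ := exists_isLimitShare (F := F) U hκ lam
  have hdesc (hlam : Tendsto lam U atTop) : ∑ q ∈ Λ₀ F, c0 F q * (r q : ℂ) = 0 := by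
    simpa using h.sum_mul_eq_zero hL (D := fun _ => 1) fun α =>
      (tendsto_descFactorial_div α).comp hlam
  rcases eventually_eq_or_tendsto_atTop U κ with ⟨k, hk⟩ | hκT <;>
    rcases eventually_eq_or_tendsto_atTop U lam with ⟨l, hl⟩ | hlamT
  · obtain ⟨n, rfl, rfl⟩ := (hk.and hl).exists
    have hconst := tendsto_nhds_unique (tendsto_const_nhds.congr' <|
      (hk.and hl).mono fun i hi => by rw [hi.1, hi.2]) hL
    exact div_ne_zero (hN _ _ (hκ n)) (by exact_mod_cast (polySize_pos (hκ n) _).ne') hconst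
  · exact h.sum_ne_zero_of_const_tendsto hk hlamT hGP (hdesc hlamT)
  · have hr : ∀ q ∈ Λ₀ F, q ≠ (m, 0) → r q = 0 := fun q => h.eq_zero_of_tendsto_const hκT hl
    have hr1 : r (m, 0) = 1 := by
      rw [← h.sum_eq_one, Finset.sum_eq_single_of_mem _ m_zero_mem_Λ₀ hr]
    have hsum := h.sum_mul_eq_zero hL
      (D := fun α => (l.descFactorial α : ℝ) / ((l : ℝ) + 1) ^ α) fun α =>
        tendsto_const_nhds.congr' (hl.mono fun n hn => by simp [hn])
    rw [Finset.sum_eq_single_of_mem _ m_zero_mem_Λ₀ fun q hq hne => by simp [hr q hq hne]] at hsum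
    simp [c0_m_zero, hr1] at hsum
  · exact h.sum_ne_zero_of_tendsto_tendsto hκT hlamT hGP (hdesc hlamT)

lemma exists_mul_polySize_le_norm_L (hN : NonResonance F) (hGP : GenPoincare F) :
    ∃ δ : ℝ, 0 < δ ∧ ∀ k l : ℕ, 1 ≤ k → δ * polySize F k l ≤ ‖L F k l‖ := by
  by_contra! hcon
  choose κ lam hκ hlt using fun n : ℕ => hcon (1 / ((n : ℝ) + 1)) (by positivity)
  refine not_tendsto_L_div_polySize (U := hyperfilter ℕ) hκ lam hN hGP
    (squeeze_zero_norm (fun n => ?_)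
      (tendsto_one_div_add_atTop_nhds_zero_nat.mono_left Nat.hyperfilter_le_atTop))
  have hpos := polySize_pos (F := F) (hκ n) (lam n)
  rw [norm_div, Complex.norm_real, Real.norm_of_nonneg hpos.le, div_le_iff₀ hpos]
  exact (hlt n).le

end LowerBound

/-! ### The recursion for the coefficients of a formal solution -/

section PowCong

variable {R : Type*} [CommRing R] {t : R}

/-- `f` and `g` are divisible by `t ^ n` and congruent modulo `t ^ (k + n - 1)`. This is what is
left of a congruence modulo `t ^ k` after taking products of `n` factors divisible by `t`. The
congruence is multiplied by `t`, which avoids the truncated subtraction. -/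
structure PowCong (t : R) (k n : ℕ) (f g : R) : Prop where
  dvd_left : t ^ n ∣ f
  dvd_right : t ^ n ∣ g
  dvd_sub : t ^ (k + n) ∣ t * (f - g)

namespace PowCong

lemma refl {k n : ℕ} {f : R} (h : t ^ n ∣ f) : PowCong t k n f f := ⟨h, h, by simp⟩

lemma mul {k n n' : ℕ} {f f' g g' : R} (h : PowCong t k n f g) (h' : PowCong t k n' f' g') :
    PowCong t k (n + n') (f * f') (g * g') where
  dvd_left := by rw [pow_add]; exact mul_dvd_mul h.dvd_left h'.dvd_left
  dvd_right := by rw [pow_add]; exact mul_dvd_mul h.dvd_right h'.dvd_right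
  dvd_sub := by
    have hsplit : t * (f * f' - g * g') = f * (t * (f' - g')) + (t * (f - g)) * g' := by ring
    rw [hsplit]
    refine dvd_add ?_ ?_
    · rw [show k + (n + n') = n + (k + n') by ring, pow_add]
      exact mul_dvd_mul h.dvd_left h'.dvd_sub
    · rw [← add_assoc, pow_add]
      exact mul_dvd_mul h.dvd_sub h'.dvd_right

lemma pow {k n : ℕ} {f g : R} (h : PowCong t k n f g) (i : ℕ) :
    PowCong t k (i * n) (f ^ i) (g ^ i) := by
  induction i with
  | zero => simpa using refl (t := t) (k := k) (n := 0) (f := 1) (by simp)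
  | succ i ih => rw [pow_succ, pow_succ, Nat.succ_mul]; exact ih.mul h

lemma prod {k : ℕ} {ι : Type*} (s : Finset ι) {n : ι → ℕ} {f g : ι → R}
    (h : ∀ i ∈ s, PowCong t k (n i) (f i) (g i)) :
    PowCong t k (∑ i ∈ s, n i) (∏ i ∈ s, f i) (∏ i ∈ s, g i) := by
  classical
  induction s using Finset.induction_on with
  | empty => simpa using refl (t := t) (k := k) (n := 0) (f := 1) (by simp)
  | insert i s hi ih =>
    rw [Finset.sum_insert hi, Finset.prod_insert hi, Finset.prod_insert hi]
    exact (h i (by simp)).mul (ih fun j hj => h j (by simp [hj]))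

end PowCong

end PowCong

section Recursion

variable {m : ℕ} {F : (Var m → ℂ) → ℂ}

/-- The variables `t` and `z_{j,α}`. -/
def tzVar : Option (Idx m) → Var m
  | none => vt m
  | some q => vz q

lemma tzVar_injective : Function.Injective (tzVar (m := m)) := by
  rintro (_ | q) (_ | q') h
  · rfl
  · cases h
  · cases h
  · rw [Sum.inr.inj h]

lemma tzVar_ne_vx (o : Option (Idx m)) : tzVar o ≠ vx m := by
  rcases o with _ | q <;> simp [tzVar]

lemma ext_var {e e' : Var m →₀ ℕ} (hx : e (vx m) = e' (vx m))
    (htz : ∀ o, e (tzVar o) = e' (tzVar o)) : e = e' := by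
  ext v
  rcases v with i | q
  · fin_cases i
    exacts [htz none, hx]
  · exact htz (some q)

/-- The total degree of a monomial in the variables `t` and `z`. -/
def tzDeg (e : Var m →₀ ℕ) : ℕ := e (vt m) + ∑ q : Idx m, e (vz q)

lemma tzDeg_eq_sum (e : Var m →₀ ℕ) : tzDeg e = ∑ o, e (tzVar o) := by
  rw [Fintype.sum_option]
  rfl

lemma sum_eq_tzDeg_add (e : Var m →₀ ℕ) : ∑ v, e v = tzDeg e + e (vx m) := by
  rw [Fintype.sum_sum_type, Fin.sum_univ_two, tzDeg]
  ring

lemma coeff_R₂ (e : Var m →₀ ℕ) : MvPowerSeries.coeff e (R₂ F)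
    = if 2 ≤ tzDeg e then MvPowerSeries.coeff e (taylor F) else 0 := rfl

lemma two_le_tzDeg_of_coeff_R₂_ne_zero {e : Var m →₀ ℕ} (he : MvPowerSeries.coeff e (R₂ F) ≠ 0) :
    2 ≤ tzDeg e :=
  by_contra fun h => he (if_neg h)

lemma coeff_taylor_of_tzDeg_eq_zero
    (h0 : ∀ l, MvPowerSeries.coeff (Finsupp.single (vx m) l) (taylor F) = 0) {e : Var m →₀ ℕ}
    (he : tzDeg e = 0) : MvPowerSeries.coeff e (taylor F) = 0 := by
  have htz (o) : e (tzVar o) = 0 :=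
    Finset.sum_eq_zero_iff.1 ((tzDeg_eq_sum e).symm.trans he) o (Finset.mem_univ o)
  have hex : e = Finsupp.single (vx m) (e (vx m)) :=
    ext_var (by simp) fun o => by rw [htz, Finsupp.single_eq_of_ne (tzVar_ne_vx o)]
  rw [hex, h0]

/-- The exponent of the monomial `x^l w`, where `w` is `t` or one of the `z_{j,α}`. -/
def linearExpo (o : Option (Idx m)) (l : ℕ) : Var m →₀ ℕ :=
  Finsupp.single (vx m) l + Finsupp.single (tzVar o) 1

@[simp] lemma linearExpo_apply_vx (o : Option (Idx m)) (l : ℕ) :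
    linearExpo o l (vx m) = l := by
  rw [linearExpo, Finsupp.add_apply, Finsupp.single_eq_same,
    Finsupp.single_eq_of_ne (tzVar_ne_vx o).symm, add_zero]

lemma linearExpo_apply_tzVar (o o' : Option (Idx m)) (l : ℕ) :
    linearExpo o l (tzVar o') = Finsupp.single o 1 o' := by
  rw [linearExpo, Finsupp.add_apply, Finsupp.single_eq_of_ne (tzVar_ne_vx o'), zero_add,
    Finsupp.single_apply_left tzVar_injective]

lemma linearExpo_injective :
    Function.Injective fun y : Option (Idx m) × ℕ => linearExpo y.1 y.2 := by
  rintro ⟨o, l⟩ ⟨o', l'⟩ h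
  have hx := DFunLike.congr_fun h (vx m)
  have htz := DFunLike.congr_fun h (tzVar o)
  simp only [linearExpo_apply_vx, linearExpo_apply_tzVar, Finsupp.single_eq_same] at hx htz
  rw [hx, Finsupp.single_apply_ne_zero.1 (htz.symm.trans_ne one_ne_zero) |>.1]

@[simp] lemma tzDeg_linearExpo (o : Option (Idx m)) (l : ℕ) : tzDeg (linearExpo o l) = 1 := by
  classical
  simp only [tzDeg_eq_sum, linearExpo_apply_tzVar, Finsupp.single_apply, Finset.sum_ite_eq,
    Finset.mem_univ, if_true]

lemma exists_eq_linearExpo_of_tzDeg_eq_one {e : Var m →₀ ℕ} (he : tzDeg e = 1) :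
    ∃ o, e = linearExpo o (e (vx m)) := by
  have hsum : (Finsupp.equivFunOnFinite.symm fun o => e (tzVar o)).sum (fun _ n => n) = 1 := by
    rw [Finsupp.sum_fintype _ _ fun _ => rfl]
    exact (tzDeg_eq_sum e).symm.trans he
  obtain ⟨o, ho⟩ := (Finsupp.sum_eq_one_iff _).1 hsum
  refine ⟨o, ext_var (linearExpo_apply_vx _ _).symm fun o' => ?_⟩
  rw [linearExpo_apply_tzVar, ← ho]
  rfl

/-- The monomial with exponent `e`, evaluated at the jet of `u`. -/
def jetMonomial (u : FPS) (e : Var m →₀ ℕ) : FPS := e.prod fun v n => jet m u v ^ n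

lemma jetMonomial_eq_prod (u : FPS) (e : Var m →₀ ℕ) :
    jetMonomial u e = MvPowerSeries.X 1 ^ e (vx m) * ∏ o, jet m u (tzVar o) ^ e (tzVar o) := by
  rw [jetMonomial, Finsupp.prod_fintype _ _ (by simp), Fintype.prod_sum_type, Fin.prod_univ_two,
    Fintype.prod_option, mul_comm (jet m u (Sum.inl 0) ^ _), mul_assoc]
  rfl

lemma jetMonomial_linearExpo (u : FPS) (o : Option (Idx m)) (l : ℕ) :
    jetMonomial u (linearExpo o l) = MvPowerSeries.X 1 ^ l * jet m u (tzVar o) := by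
  rw [jetMonomial, linearExpo, Finsupp.prod_add_index' (by simp) (by simp [pow_add]),
    Finsupp.prod_single_index (by simp), Finsupp.prod_single_index (by simp), pow_one]
  rfl

section Jets

variable {u v : FPS} {k : ℕ} (hu : ∀ l, coeff₂ u 0 l = 0) (hv : ∀ l, coeff₂ v 0 l = 0)
include hu

lemma X_zero_dvd_jet (o : Option (Idx m)) : MvPowerSeries.X 0 ∣ jet m u (tzVar o) := by
  rcases o with _ | q
  · exact dvd_rfl
  · rw [← pow_one (MvPowerSeries.X 0), X_zero_pow_dvd_iff]
    intro k l hk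
    obtain rfl : k = 0 := Nat.lt_one_iff.1 hk
    rw [tzVar, coeff₂_jet, hu, mul_zero, mul_zero]

lemma hasSubst_jet : MvPowerSeries.HasSubst (jet m u) := by
  have hX (i : Fin 2) : MvPowerSeries.constantCoeff (MvPowerSeries.X i : FPS) = 0 := by simp
  refine MvPowerSeries.hasSubst_of_constantCoeff_zero fun v => ?_
  rcases v with i | q
  · exact hX i
  · obtain ⟨f, hf⟩ := X_zero_dvd_jet (m := m) hu (some q)
    change MvPowerSeries.constantCoeff (jet m u (tzVar (some q))) = 0
    rw [hf, map_mul, hX, zero_mul]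

lemma coeff₂_subst_jet (f : MvPowerSeries (Var m) ℂ) (k l : ℕ) :
    coeff₂ (MvPowerSeries.subst (jet m u) f) k l
      = ∑ᶠ e, MvPowerSeries.coeff e f * coeff₂ (jetMonomial u e) k l := by
  rw [coeff₂, MvPowerSeries.coeff_subst (hasSubst_jet hu)]
  rfl

lemma finite_support_coeff_mul_jetMonomial (f : MvPowerSeries (Var m) ℂ) (k l : ℕ) :
    (Function.support fun e =>
      MvPowerSeries.coeff e f * coeff₂ (jetMonomial u e) k l).Finite :=
  MvPowerSeries.coeff_subst_finite (hasSubst_jet hu) f (expo k l)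

lemma X_zero_pow_tzDeg_dvd_jetMonomial (e : Var m →₀ ℕ) :
    MvPowerSeries.X 0 ^ tzDeg e ∣ jetMonomial u e := by
  rw [jetMonomial_eq_prod, tzDeg_eq_sum, ← Finset.prod_pow_eq_pow_sum]
  exact dvd_mul_of_dvd_right
    (Finset.prod_dvd_prod_of_dvd _ _ fun o _ => pow_dvd_pow_of_dvd (X_zero_dvd_jet hu o) _) _

lemma coeff₂_jetMonomial_eq_zero {e : Var m →₀ ℕ} (hk : k < tzDeg e) (l : ℕ) :
    coeff₂ (jetMonomial u e) k l = 0 :=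
  X_zero_pow_dvd_iff.1 (X_zero_pow_tzDeg_dvd_jetMonomial hu e) k l hk

lemma coeff₂_subst_jet_R₂_zero (l : ℕ) :
    coeff₂ (MvPowerSeries.subst (jet m u) (R₂ F)) 0 l = 0 := by
  rw [coeff₂_subst_jet hu]
  refine finsum_eq_zero_of_forall_eq_zero fun e => ?_
  rw [coeff_R₂]
  split_ifs with he
  · rw [coeff₂_jetMonomial_eq_zero hu (by omega), mul_zero]
  · rw [zero_mul]

variable (h : ∀ k' < k, ∀ l, coeff₂ u k' l = coeff₂ v k' l)
include hv h

lemma powCong_jet (o : Option (Idx m)) :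
    PowCong (MvPowerSeries.X 0) k 1 (jet m u (tzVar o)) (jet m v (tzVar o)) := by
  refine ⟨by simpa using X_zero_dvd_jet hu o, by simpa using X_zero_dvd_jet hv o, ?_⟩
  rw [pow_succ']
  refine mul_dvd_mul_left _ ?_
  rcases o with _ | q
  · simp [tzVar, jet]
  · rw [X_zero_pow_dvd_iff]
    intro k' l hk'
    have hjet : coeff₂ (jet m u (vz q)) k' l = coeff₂ (jet m v (vz q)) k' l := by
      rw [coeff₂_jet, coeff₂_jet, h k' hk']
    rw [tzVar, coeff₂, map_sub, sub_eq_zero]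
    exact hjet

lemma powCong_jetMonomial (e : Var m →₀ ℕ) :
    PowCong (MvPowerSeries.X 0) k (tzDeg e) (jetMonomial u e) (jetMonomial v e) := by
  rw [jetMonomial_eq_prod, jetMonomial_eq_prod, tzDeg_eq_sum, ← zero_add (∑ o, _)]
  refine (PowCong.refl (by simp)).mul (PowCong.prod _ fun o _ => ?_)
  simpa using (powCong_jet hu hv h o).pow (e (tzVar o))

lemma coeff₂_jetMonomial_congr {e : Var m →₀ ℕ} (he : 2 ≤ tzDeg e) (l : ℕ) :
    coeff₂ (jetMonomial u e) k l = coeff₂ (jetMonomial v e) k l := by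
  have hX : (MvPowerSeries.X 0 : FPS) ≠ 0 := fun h0 => by
    simpa [coeff₂] using (coeff₂_X_zero (R := ℂ) 1 0).symm.trans (congrArg (coeff₂ · 1 0) h0)
  have hdvd : (MvPowerSeries.X 0 : FPS) ^ (k + 1) ∣ jetMonomial u e - jetMonomial v e := by
    rw [← mul_dvd_mul_iff_left hX, ← pow_succ']
    exact (pow_dvd_pow _ (by omega)).trans (powCong_jetMonomial hu hv h e).dvd_sub
  have hsub := X_zero_pow_dvd_iff.1 hdvd k l (by omega)
  rwa [coeff₂, map_sub, sub_eq_zero] at hsub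

lemma coeff₂_subst_jet_R₂_congr (l : ℕ) :
    coeff₂ (MvPowerSeries.subst (jet m u) (R₂ F)) k l
      = coeff₂ (MvPowerSeries.subst (jet m v) (R₂ F)) k l := by
  rw [coeff₂_subst_jet hu, coeff₂_subst_jet hv]
  refine finsum_congr fun e => ?_
  rw [coeff_R₂]
  split_ifs with he
  · rw [coeff₂_jetMonomial_congr hu hv h he]
  · rw [zero_mul, zero_mul]

end Jets

lemma coeff_c (q : Idx m) (i : ℕ) : PowerSeries.coeff i (c F q.1)
    = MvPowerSeries.coeff (linearExpo (some q) (i + q.1.2)) (taylor F) := by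
  have hne : q.1 ≠ (m, 0) := fun h => m_zero_notMem_idxSet (h ▸ q.2)
  rw [c, if_neg hne, dif_pos q.2, PowerSeries.coeff_mk, b, PowerSeries.coeff_mk]
  rfl

lemma A3.coeff_linearExpo_of_lt (hA3 : A3 F) (q : Idx m) {μ : ℕ} (hμ : μ < q.1.2) :
    MvPowerSeries.coeff (linearExpo (some q) μ) (taylor F) = 0 := by
  have h := PowerSeries.X_pow_dvd_iff.1 (hA3 q (by omega)) μ hμ
  rwa [b, PowerSeries.coeff_mk] at h

/-- The expansion at `x = 0` of `a(x)`, the coefficient of `t` in `F`. -/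
def aCoeff (F : (Var m → ℂ) → ℂ) (l : ℕ) : ℂ :=
  MvPowerSeries.coeff (linearExpo none l) (taylor F)

/-- The contribution of the term of order `i` of `c_{j,α}`, `q = (j, α)`, to the coefficient of
`t^k x^l` in `c_{j,α}(x) x^α (t ∂_t)^j ∂_x^α u`. -/
def linearTerm (F : (Var m → ℂ) → ℂ) (u : FPS) (q : ℕ × ℕ) (k l i : ℕ) : ℂ :=
  PowerSeries.coeff i (c F q) * ((k : ℂ) ^ q.1 * ((l - i).descFactorial q.2 : ℂ)) *
    coeff₂ u k (l - i)

lemma sum_coeff_linearExpo_none (u : FPS) (k l : ℕ) :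
    ∑ μ ∈ Finset.range (l + 1), MvPowerSeries.coeff (linearExpo none μ) (taylor F) *
        coeff₂ (jetMonomial u (linearExpo (m := m) none μ)) k l
      = if k = 1 then aCoeff F l else 0 := by
  have hmonomial (μ : ℕ) (hμ : μ ≤ l) :
      coeff₂ (jetMonomial u (linearExpo (m := m) none μ)) k l
        = if k = 1 ∧ l - μ = 0 then 1 else 0 := by
    rw [jetMonomial_linearExpo, coeff₂_X_one_pow_mul, if_pos hμ]
    exact coeff₂_X_zero k (l - μ)
  rw [Finset.sum_eq_single_of_mem l (by simp)]
  · rw [hmonomial l le_rfl]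
    simp [aCoeff]
  · intro μ hμ hne
    have hlt : μ < l := lt_of_le_of_ne (Nat.lt_succ_iff.1 (Finset.mem_range.1 hμ)) hne
    rw [hmonomial μ hlt.le, if_neg (by omega), mul_zero]

lemma A3.sum_coeff_linearExpo_some (hA3 : A3 F) (u : FPS) (q : Idx m) (k l : ℕ) :
    ∑ μ ∈ Finset.range (l + 1), MvPowerSeries.coeff (linearExpo (some q) μ) (taylor F) *
        coeff₂ (jetMonomial u (linearExpo (some q) μ)) k l
      = ∑ i ∈ Finset.range (l + 1), linearTerm F u q.1 k l i := by
  have hleft : Finset.Ico q.1.2 (l + 1) ⊆ Finset.range (l + 1) := fun μ hμ =>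
    Finset.mem_range.2 (Finset.mem_Ico.1 hμ).2
  have hright : Finset.range (l + 1 - q.1.2) ⊆ Finset.range (l + 1) :=
    Finset.range_subset_range.2 (Nat.sub_le _ _)
  rw [← Finset.sum_subset hleft, ← Finset.sum_subset hright, Finset.sum_Ico_eq_sum_range]
  · refine Finset.sum_congr rfl fun i hi => ?_
    have hil : q.1.2 + i ≤ l := by have := Finset.mem_range.1 hi; omega
    rw [jetMonomial_linearExpo, coeff₂_X_one_pow_mul, if_pos hil, tzVar, coeff₂_jet, linearTerm,
      coeff_c, add_comm i, show l - i = l - (q.1.2 + i) + q.1.2 by omega,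
      Nat.add_descFactorial_eq_ascFactorial]
    ring
  · intro i hi hi'
    rw [Finset.mem_range] at hi hi'
    rw [linearTerm, Nat.descFactorial_of_lt (by omega)]
    simp
  · intro μ hμ hμ'
    rw [Finset.mem_range] at hμ
    rw [Finset.mem_Ico] at hμ'
    rw [hA3.coeff_linearExpo_of_lt q (by omega), zero_mul]

section Equation

variable (h0 : ∀ l, MvPowerSeries.coeff (Finsupp.single (vx m) l) (taylor F) = 0)
include h0

lemma support_taylor_sub_R₂_subset (u : FPS) (k l : ℕ) :
    (Function.support fun e =>
        MvPowerSeries.coeff e (taylor F - R₂ F) * coeff₂ (jetMonomial u e) k l)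
      ⊆ ((Finset.univ ×ˢ Finset.range (l + 1)).map
        ⟨fun y => linearExpo y.1 y.2, linearExpo_injective⟩ : Finset (Var m →₀ ℕ)) := by
  intro e he
  rw [Function.mem_support, map_sub, coeff_R₂] at he
  have hlt : tzDeg e < 2 := by
    by_contra hge
    exact he (by rw [if_pos (by omega), sub_self, zero_mul])
  rw [if_neg (by omega), sub_zero] at he
  have hne0 : tzDeg e ≠ 0 := fun h => he (by rw [coeff_taylor_of_tzDeg_eq_zero h0 h, zero_mul])
  obtain ⟨o, ho⟩ := exists_eq_linearExpo_of_tzDeg_eq_one (show tzDeg e = 1 by omega)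
  refine Finset.mem_coe.2 (Finset.mem_map.2 ⟨(o, e (vx m)), ?_, ho.symm⟩)
  rw [Finset.mem_product, Finset.mem_range]
  refine ⟨Finset.mem_univ _, ?_⟩
  by_contra hxl
  refine he ?_
  rw [ho, jetMonomial_linearExpo, coeff₂_X_one_pow_mul, if_neg (by omega), mul_zero]

variable (hA3 : A3 F) {u : FPS}
include hA3

lemma coeff₂_subst_jet_taylor (hu : ∀ l, coeff₂ u 0 l = 0) (k l : ℕ) :
    coeff₂ (MvPowerSeries.subst (jet m u) (taylor F)) k l
      = (if k = 1 then aCoeff F l else 0)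
        + ∑ q : Idx m, ∑ i ∈ Finset.range (l + 1), linearTerm F u q.1 k l i
        + coeff₂ (MvPowerSeries.subst (jet m u) (R₂ F)) k l := by
  have hcoeff (o : Option (Idx m)) (μ : ℕ) :
      MvPowerSeries.coeff (linearExpo o μ) (taylor F - R₂ F)
        = MvPowerSeries.coeff (linearExpo o μ) (taylor F) := by
    rw [map_sub, coeff_R₂, tzDeg_linearExpo, if_neg (by norm_num), sub_zero]
  have hlinear : coeff₂ (MvPowerSeries.subst (jet m u) (taylor F - R₂ F)) k l
      = (if k = 1 then aCoeff F l else 0)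
        + ∑ q : Idx m, ∑ i ∈ Finset.range (l + 1), linearTerm F u q.1 k l i := by
    rw [coeff₂_subst_jet hu,
      finsum_eq_sum_of_support_subset _ (support_taylor_sub_R₂_subset h0 u k l), Finset.sum_map,
      Finset.sum_product, Fintype.sum_option]
    simp only [Function.Embedding.coeFn_mk, hcoeff, sum_coeff_linearExpo_none,
      hA3.sum_coeff_linearExpo_some]
  rw [← hlinear, coeff₂, coeff₂, coeff₂, ← map_add, ← MvPowerSeries.subst_add (hasSubst_jet hu),
    sub_add_cancel]

end Equation

/-- The part of the equation for the coefficient of `t^k x^l` that involves earlier coefficients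
only. -/
def recRhs (F : (Var m → ℂ) → ℂ) (u : FPS) (k l : ℕ) : ℂ :=
  (if k = 1 then aCoeff F l else 0)
    + ∑ q : Idx m, ∑ i ∈ Finset.range l, linearTerm F u q.1 k l (i + 1)
    + coeff₂ (MvPowerSeries.subst (jet m u) (R₂ F)) k l

lemma L_mul_coeff₂ (u : FPS) (k l : ℕ) :
    L F k l * coeff₂ u k l
      = (k : ℂ) ^ m * coeff₂ u k l - ∑ q : Idx m, linearTerm F u q.1 k l 0 := by
  rw [L, ← Finset.sum_coe_sort, sub_mul, Finset.sum_mul]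
  congr 1
  refine Finset.sum_congr rfl fun q _ => ?_
  rw [prod_range_natCast_sub_eq_descFactorial, c0, linearTerm,
    PowerSeries.coeff_zero_eq_constantCoeff_apply, Nat.sub_zero]
  ring

lemma recRhs_congr {u v : FPS} {k l : ℕ} (hu : ∀ l, coeff₂ u 0 l = 0)
    (hv : ∀ l, coeff₂ v 0 l = 0)
    (h : ∀ k' l', k' < k ∨ k' = k ∧ l' < l → coeff₂ u k' l' = coeff₂ v k' l') :
    recRhs F u k l = recRhs F v k l := by
  rw [recRhs, recRhs, coeff₂_subst_jet_R₂_congr hu hv fun k' hk' l' => h k' l' (Or.inl hk')]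
  congr 2
  refine Finset.sum_congr rfl fun q _ => Finset.sum_congr rfl fun i hi => ?_
  have hil := Finset.mem_range.1 hi
  rw [linearTerm, linearTerm, h k _ (Or.inr ⟨rfl, by omega⟩)]

section Solution

variable (h0 : ∀ l, MvPowerSeries.coeff (Finsupp.single (vx m) l) (taylor F) = 0)
  (hA3 : A3 F)
include h0 hA3

lemma coeff₂_equation_iff {u : FPS} (hu : ∀ l, coeff₂ u 0 l = 0) (k l : ℕ) :
    coeff₂ (tDt^[m] u) k l = coeff₂ (MvPowerSeries.subst (jet m u) (taylor F)) k l ↔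
      L F k l * coeff₂ u k l = recRhs F u k l := by
  rw [coeff₂_tDt_iterate, coeff₂_subst_jet_taylor h0 hA3 hu, L_mul_coeff₂, recRhs]
  simp only [Finset.sum_range_succ', Finset.sum_add_distrib]
  constructor <;> intro h <;> linear_combination h

lemma isFormalSolution_iff (u : FPS) :
    IsFormalSolution F u ↔ (∀ l, coeff₂ u 0 l = 0) ∧
      ∀ k l : ℕ, 1 ≤ k → L F k l * coeff₂ u k l = recRhs F u k l := by
  have hinitial : (∀ l : ℕ, MvPowerSeries.coeff (Finsupp.single 1 l) u = 0) ↔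
      ∀ l, coeff₂ u 0 l = 0 := by
    simp [coeff₂, expo]
  rw [IsFormalSolution, hinitial]
  refine and_congr_right fun hu =>
    ⟨fun h k l _ => (coeff₂_equation_iff h0 hA3 hu k l).1 (by rw [h]),
      fun h => ext_coeff₂ fun k l => (coeff₂_equation_iff h0 hA3 hu k l).2 ?_⟩
  rcases Nat.eq_zero_or_pos k with rfl | hk
  · simp [recRhs, linearTerm, coeff₂_subst_jet_R₂_zero hu, hu]
  · exact h k l hk

end Solution

lemma existsUnique_of_wellFounded {ι α : Type*} [Inhabited α] {r : ι → ι → Prop}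
    (hr : WellFounded r) (Φ : (ι → α) → ι → α)
    (hΦ : ∀ a a' i, (∀ j, r j i → a j = a' j) → Φ a i = Φ a' i) : ∃! a, ∀ i, a i = Φ a i := by
  classical
  refine existsUnique_of_exists_of_unique
    ⟨hr.fix fun i rec => Φ (fun j => if h : r j i then rec j h else default) i, fun i => ?_⟩
    fun a a' ha ha' => funext fun i => ?_
  · rw [hr.fix_eq]
    exact hΦ _ _ _ fun j hj => dif_pos hj
  · induction i using hr.induction with
    | _ i ih => rw [ha, ha', hΦ a a' i ih]

lemma existsUnique_formalSolution
    (h0 : ∀ l, MvPowerSeries.coeff (Finsupp.single (vx m) l) (taylor F) = 0) (hA3 : A3 F)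
    (hN : NonResonance F) : ∃! u, IsFormalSolution F u := by
  let series (a : ℕ × ℕ → ℂ) : FPS := mk₂ fun k l => if k = 0 then 0 else a (k, l)
  let Φ (a : ℕ × ℕ → ℂ) (y : ℕ × ℕ) : ℂ :=
    if y.1 = 0 then 0 else recRhs F (series a) y.1 y.2 / L F y.1 y.2
  have hseries (a) (l : ℕ) : coeff₂ (series a) 0 l = 0 := by simp [series]
  have hsol_of_fixed (a) (ha : ∀ y, a y = Φ a y) : IsFormalSolution F (series a) := by
    refine (isFormalSolution_iff h0 hA3 _).2 ⟨hseries a, fun k l hk => ?_⟩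
    have hk' : k ≠ 0 := by omega
    have hcoeff : coeff₂ (series a) k l = a (k, l) := by simp [series, hk']
    have hΦ : Φ a (k, l) = recRhs F (series a) k l / L F k l := if_neg hk'
    rw [hcoeff, ha, hΦ, mul_div_cancel₀ _ (hN k l hk)]
  have hfixed_of_sol (u) (hu : IsFormalSolution F u) :
      series (fun y => coeff₂ u y.1 y.2) = u ∧
        ∀ y : ℕ × ℕ, coeff₂ u y.1 y.2 = Φ (fun y => coeff₂ u y.1 y.2) y := by
    obtain ⟨hu0, hrec⟩ := (isFormalSolution_iff h0 hA3 u).1 hu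
    have hself : series (fun y => coeff₂ u y.1 y.2) = u := ext_coeff₂ fun k l => by
      rcases eq_or_ne k 0 with rfl | hk <;> simp [series, *]
    refine ⟨hself, fun ⟨k, l⟩ => ?_⟩
    rcases Nat.eq_zero_or_pos k with rfl | hk
    · simp [Φ, hu0]
    · simp only [Φ, hself, hk.ne', if_false]
      rw [eq_div_iff (hN k l hk), mul_comm, hrec k l hk]
  have hΦ (a a') (y : ℕ × ℕ) (h : ∀ y', Prod.Lex (· < ·) (· < ·) y' y → a y' = a' y') :
      Φ a y = Φ a' y := by
    have hrhs : recRhs F (series a) y.1 y.2 = recRhs F (series a') y.1 y.2 :=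
      recRhs_congr (hseries a) (hseries a') fun k' l' h' => by
        simp [series, h (k', l') (Prod.lex_def.2 h')]
    simp only [Φ, hrhs]
  obtain ⟨a, ha, huniq⟩ := existsUnique_of_wellFounded
    (WellFounded.prod_lex wellFounded_lt wellFounded_lt) Φ hΦ
  refine ⟨series a, hsol_of_fixed a ha, fun v hv => ?_⟩
  rw [← (hfixed_of_sol v hv).1, huniq _ (hfixed_of_sol v hv).2]

end Recursion

/-! ### Numerical estimates -/

lemma multichoose_mono {a a' l l' : ℕ} (ha : a ≤ a') (hl : l ≤ l') (ha' : 1 ≤ a') :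
    Nat.multichoose a l ≤ Nat.multichoose a' l' := by
  have mono_left : Monotone fun a => Nat.multichoose a l := by
    refine monotone_nat_of_le_succ fun a => ?_
    rcases l with _ | l
    · simp
    · simp only [Nat.multichoose_succ_succ, Nat.le_add_right]
  have mono_right : Monotone fun l => Nat.multichoose a' l := by
    refine monotone_nat_of_le_succ fun l => ?_
    obtain ⟨b, rfl⟩ := Nat.exists_eq_add_of_le' ha'
    simp only [Nat.multichoose_succ_succ, Nat.le_add_left]
  exact (mono_left ha).trans (mono_right hl)

lemma factorial_mul_multichoose {a : ℕ} (ha : 1 ≤ a) (l : ℕ) :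
    l ! * Nat.multichoose a l = a.ascFactorial l := by
  obtain ⟨b, rfl⟩ := Nat.exists_eq_add_of_le' ha
  rw [Nat.multichoose_eq, Nat.ascFactorial_eq_factorial_mul_choose]
  congr 2
  omega

lemma coeff_invOneSubPow (R : Type*) [CommRing R] (a l : ℕ) :
    PowerSeries.coeff l (PowerSeries.invOneSubPow R a : PowerSeries R) = Nat.multichoose a l := by
  rcases a with _ | a
  · rcases l with _ | l <;> simp [PowerSeries.invOneSubPow_zero, PowerSeries.coeff_one]
  · rw [PowerSeries.invOneSubPow_val_succ_eq_mk_add_choose, PowerSeries.coeff_mk,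
      Nat.multichoose_eq, show a + 1 + l - 1 = a + l by omega, Nat.choose_symm_add]

lemma sum_multichoose_mul (R : Type*) [CommRing R] (a a' l : ℕ) :
    ∑ y ∈ antidiagonal l, (Nat.multichoose a y.1 * Nat.multichoose a' y.2 : R)
      = Nat.multichoose (a + a') l := by
  rw [← coeff_invOneSubPow, PowerSeries.invOneSubPow_add, Units.val_mul, PowerSeries.coeff_mul]
  simp only [coeff_invOneSubPow]

lemma pow_mul_ascFactorial_le {a a' s l μ : ℕ} (ha : a ≤ a') (hμ : μ ≤ l)
    (hs : s ≤ a' + (l - μ)) : s ^ μ * a.ascFactorial (l - μ) ≤ a'.ascFactorial l := by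
  calc s ^ μ * a.ascFactorial (l - μ)
      ≤ (a' + (l - μ)).ascFactorial μ * a'.ascFactorial (l - μ) :=
        Nat.mul_le_mul ((Nat.pow_le_pow_left hs μ).trans (Nat.pow_succ_le_ascFactorial _ _))
          (Nat.ascFactorial_le _ ha)
    _ = a'.ascFactorial l := by
        rw [mul_comm, Nat.ascFactorial_mul_ascFactorial, Nat.sub_add_cancel hμ]

lemma ascFactorial_add_le {a a' s α : ℕ} (l : ℕ) (ha : 1 ≤ a) (ha' : a + α ≤ a')
    (hs : a + α ≤ s + 1) : a.ascFactorial (l + α) ≤ s ^ α * a'.ascFactorial l := by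
  rw [add_comm l, ← Nat.ascFactorial_mul_ascFactorial]
  refine Nat.mul_le_mul ?_ (Nat.ascFactorial_le _ ha')
  obtain ⟨b, rfl⟩ := Nat.exists_eq_add_of_le' ha
  exact (Nat.ascFactorial_le_pow_add b α).trans (Nat.pow_le_pow_left (by omega) α)

lemma ascFactorial_mul_multichoose_le {a a' s α : ℕ} (l : ℕ) (ha : 1 ≤ a) (ha' : a + α ≤ a')
    (hs : a + α ≤ s + 1) :
    (l + 1).ascFactorial α * Nat.multichoose a (l + α) ≤ s ^ α * Nat.multichoose a' l := by
  refine Nat.le_of_mul_le_mul_left ?_ l.factorial_pos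
  calc l ! * ((l + 1).ascFactorial α * Nat.multichoose a (l + α))
      = a.ascFactorial (l + α) := by
        rw [← mul_assoc, Nat.factorial_mul_ascFactorial, factorial_mul_multichoose ha]
    _ ≤ s ^ α * a'.ascFactorial l := ascFactorial_add_le l ha ha' hs
    _ = l ! * (s ^ α * Nat.multichoose a' l) := by
        rw [← factorial_mul_multichoose (by omega : 1 ≤ a')]; ring

/-- The factor of the majorants that depends on the exponent `l` of `x`: the coefficient of `x ^ l`
in `(1 - B x) ^ (-a)`, with a Gevrey factor of order `τ`. -/
def xWeight (τ B : ℝ) (a l : ℕ) : ℝ :=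
  B ^ l * (a.ascFactorial l : ℝ) ^ τ * Nat.multichoose a l

section xWeight

variable {τ B : ℝ}

lemma xWeight_nonneg (hB : 0 ≤ B) (a l : ℕ) : 0 ≤ xWeight τ B a l := by
  unfold xWeight; positivity

lemma sum_xWeight_mul_le (hτ : 0 ≤ τ) (hB : 0 ≤ B) (a a' l : ℕ) :
    ∑ y ∈ antidiagonal l, xWeight τ B a y.1 * xWeight τ B a' y.2 ≤ xWeight τ B (a + a') l := by
  have hterm : ∀ y ∈ antidiagonal l, xWeight τ B a y.1 * xWeight τ B a' y.2
      ≤ B ^ l * ((a + a').ascFactorial l : ℝ) ^ τ *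
        (Nat.multichoose a y.1 * Nat.multichoose a' y.2) := by
    intro y hy
    rw [mem_antidiagonal] at hy
    have hasc : (a.ascFactorial y.1 : ℝ) ^ τ * (a'.ascFactorial y.2 : ℝ) ^ τ
        ≤ ((a + a').ascFactorial l : ℝ) ^ τ := by
      rw [← Real.mul_rpow (by positivity) (by positivity)]
      refine Real.rpow_le_rpow (by positivity) ?_ hτ
      rw [← hy, ← Nat.ascFactorial_mul_ascFactorial]
      exact_mod_cast Nat.mul_le_mul (Nat.ascFactorial_le _ (by omega))
        (Nat.ascFactorial_le _ (by omega))
    calc xWeight τ B a y.1 * xWeight τ B a' y.2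
        = B ^ (y.1 + y.2) * ((a.ascFactorial y.1 : ℝ) ^ τ * (a'.ascFactorial y.2 : ℝ) ^ τ) *
          (Nat.multichoose a y.1 * Nat.multichoose a' y.2) := by unfold xWeight; ring
      _ ≤ _ := by rw [hy]; gcongr
  refine (Finset.sum_le_sum hterm).trans_eq ?_
  rw [← Finset.mul_sum, sum_multichoose_mul, xWeight]

lemma rpow_mul_xWeight_le (hτ : 0 ≤ τ) (hB : 0 ≤ B) {a a' s l μ : ℕ} (ha : a ≤ a') (ha' : 1 ≤ a')
    (hμ : μ ≤ l) (hs : s ≤ a' + (l - μ)) :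
    (s : ℝ) ^ (τ * μ) * (xWeight τ B a (l - μ) * B ^ μ) ≤ xWeight τ B a' l := by
  have hasc : (s : ℝ) ^ (τ * μ) * (a.ascFactorial (l - μ) : ℝ) ^ τ
      ≤ (a'.ascFactorial l : ℝ) ^ τ := by
    rw [mul_comm τ, Real.rpow_mul (by positivity), Real.rpow_natCast,
      ← Real.mul_rpow (by positivity) (by positivity)]
    refine Real.rpow_le_rpow (by positivity) ?_ hτ
    exact_mod_cast pow_mul_ascFactorial_le ha hμ hs
  have hmultichoose : (Nat.multichoose a (l - μ) : ℝ) ≤ Nat.multichoose a' l := by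
    exact_mod_cast multichoose_mono ha (Nat.sub_le _ _) ha'
  calc (s : ℝ) ^ (τ * μ) * (xWeight τ B a (l - μ) * B ^ μ)
      = B ^ (l - μ + μ) * ((s : ℝ) ^ (τ * μ) * (a.ascFactorial (l - μ) : ℝ) ^ τ) *
        Nat.multichoose a (l - μ) := by rw [pow_add]; unfold xWeight; ring
    _ ≤ _ := by rw [Nat.sub_add_cancel hμ, xWeight]; gcongr

lemma ascFactorial_mul_xWeight_le (hτ : 0 ≤ τ) (hB : 0 ≤ B) {a a' s α : ℕ} (l : ℕ) (ha : 1 ≤ a)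
    (ha' : a + α ≤ a') (hs : a + α ≤ s + 1) :
    (l + 1).ascFactorial α * xWeight τ B a (l + α)
      ≤ B ^ α * (s : ℝ) ^ (α * (1 + τ)) * xWeight τ B a' l := by
  have hmultichoose : ((l + 1).ascFactorial α * Nat.multichoose a (l + α) : ℝ)
      ≤ s ^ α * Nat.multichoose a' l := by
    exact_mod_cast ascFactorial_mul_multichoose_le l ha ha' hs
  have hasc : (a.ascFactorial (l + α) : ℝ) ^ τ
      ≤ ((s : ℝ) ^ α) ^ τ * (a'.ascFactorial l : ℝ) ^ τ := by
    rw [← Real.mul_rpow (by positivity) (by positivity)]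
    refine Real.rpow_le_rpow (by positivity) ?_ hτ
    exact_mod_cast ascFactorial_add_le l ha ha' hs
  have hs_pow : (s : ℝ) ^ (α * (1 + τ)) = (s : ℝ) ^ α * ((s : ℝ) ^ α) ^ τ := by
    rw [Real.rpow_mul (by positivity), Real.rpow_natCast,
      Real.rpow_one_add' (by positivity) (by linarith)]
  calc (l + 1).ascFactorial α * xWeight τ B a (l + α)
      = B ^ (l + α) * (a.ascFactorial (l + α) : ℝ) ^ τ *
        ((l + 1).ascFactorial α * Nat.multichoose a (l + α)) := by unfold xWeight; ring
    _ ≤ B ^ (l + α) * (((s : ℝ) ^ α) ^ τ * (a'.ascFactorial l : ℝ) ^ τ) *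
        (s ^ α * Nat.multichoose a' l) := by gcongr
    _ = _ := by rw [hs_pow, pow_add]; unfold xWeight; ring

end xWeight

lemma rpow_neg_mul_rpow_neg_le {γ : ℝ} (hγ : 2 ≤ γ) (a a' : ℕ) :
    (a : ℝ) ^ (-γ) * (a' : ℝ) ^ (-γ)
      ≤ 2 ^ γ * (((a : ℝ) ^ 2)⁻¹ + ((a' : ℝ) ^ 2)⁻¹) * ((a + a' : ℕ) : ℝ) ^ (-γ) := by
  wlog haa : a ≤ a' generalizing a a'
  · rw [add_comm a, mul_comm, add_comm ((a : ℝ) ^ 2)⁻¹]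
    exact this a' a (by omega)
  rcases Nat.eq_zero_or_pos a with rfl | ha
  · rw [Nat.cast_zero, Real.zero_rpow (by linarith), zero_mul]
    positivity
  have ha0 : (0 : ℝ) < a := by exact_mod_cast ha
  have ha'0 : (0 : ℝ) < a' := by exact_mod_cast ha.trans_le haa
  have hsq : (a : ℝ) ^ (-γ) ≤ ((a : ℝ) ^ 2)⁻¹ := by
    rw [← Real.rpow_natCast, ← Real.rpow_neg ha0.le]
    exact Real.rpow_le_rpow_of_exponent_le (by exact_mod_cast ha) (by push_cast; linarith)
  have hdouble : (a' : ℝ) ^ (-γ) ≤ 2 ^ γ * ((a + a' : ℕ) : ℝ) ^ (-γ) := by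
    have hle : ((a + a' : ℕ) : ℝ) ≤ 2 * a' := by exact_mod_cast (by omega : a + a' ≤ 2 * a')
    calc (a' : ℝ) ^ (-γ) = 2 ^ γ * (2 * a' : ℝ) ^ (-γ) := by
          rw [Real.mul_rpow (by norm_num) ha'0.le, ← mul_assoc, ← Real.rpow_add (by norm_num),
            add_neg_cancel, Real.rpow_zero, one_mul]
      _ ≤ 2 ^ γ * ((a + a' : ℕ) : ℝ) ^ (-γ) := by
          gcongr ?_ * ?_
          exact Real.rpow_le_rpow_of_nonpos (by push_cast; positivity) hle (by linarith)
  calc (a : ℝ) ^ (-γ) * (a' : ℝ) ^ (-γ)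
      ≤ (((a : ℝ) ^ 2)⁻¹ + ((a' : ℝ) ^ 2)⁻¹) * (2 ^ γ * ((a + a' : ℕ) : ℝ) ^ (-γ)) := by
        gcongr
        exact hsq.trans (le_add_of_nonneg_right (by positivity))
    _ = _ := by ring

lemma sum_range_inv_sq_le (n : ℕ) : ∑ i ∈ Finset.range n, ((i : ℝ) ^ 2)⁻¹ ≤ 2 := by
  have hIoo : ∑ i ∈ Finset.Ioo 0 n, ((i : ℝ) ^ 2)⁻¹ = ∑ i ∈ Finset.range n, ((i : ℝ) ^ 2)⁻¹ := by
    refine Finset.sum_subset (fun i hi => Finset.mem_range.2 (Finset.mem_Ioo.1 hi).2)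
      fun i hi hi' => ?_
    obtain rfl : i = 0 := by
      rw [Finset.mem_range] at hi
      rw [Finset.mem_Ioo] at hi'
      omega
    simp
  simpa [hIoo] using sum_Ioo_inv_sq_le (α := ℝ) 0 n

lemma sum_rpow_neg_mul_le {γ : ℝ} (hγ : 2 ≤ γ) (k : ℕ) :
    ∑ y ∈ antidiagonal k, (y.1 : ℝ) ^ (-γ) * (y.2 : ℝ) ^ (-γ) ≤ 4 * 2 ^ γ * (k : ℝ) ^ (-γ) := by
  have hfst : ∑ y ∈ antidiagonal k, ((y.1 : ℝ) ^ 2)⁻¹ ≤ 2 := by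
    rw [Finset.Nat.sum_antidiagonal_eq_sum_range_succ_mk]
    exact sum_range_inv_sq_le _
  have hsnd : ∑ y ∈ antidiagonal k, ((y.2 : ℝ) ^ 2)⁻¹ ≤ 2 := by
    rw [← Finset.Nat.sum_antidiagonal_swap]
    exact hfst
  calc ∑ y ∈ antidiagonal k, (y.1 : ℝ) ^ (-γ) * (y.2 : ℝ) ^ (-γ)
      ≤ ∑ y ∈ antidiagonal k,
          2 ^ γ * (((y.1 : ℝ) ^ 2)⁻¹ + ((y.2 : ℝ) ^ 2)⁻¹) * (k : ℝ) ^ (-γ) := by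
        refine Finset.sum_le_sum fun y hy => ?_
        rw [← mem_antidiagonal.1 hy]
        exact rpow_neg_mul_rpow_neg_le hγ y.1 y.2
    _ = 2 ^ γ * (∑ y ∈ antidiagonal k, ((y.1 : ℝ) ^ 2)⁻¹ + ∑ y ∈ antidiagonal k, ((y.2 : ℝ) ^ 2)⁻¹)
          * (k : ℝ) ^ (-γ) := by
        rw [← Finset.sum_add_distrib, Finset.mul_sum, Finset.sum_mul]
    _ ≤ 2 ^ γ * (2 + 2) * (k : ℝ) ^ (-γ) := by gcongr
    _ = _ := by ring

lemma pow_self_le_three_pow_mul_factorial (n : ℕ) : n ^ n ≤ 3 ^ n * n ! := by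
  have hexp : (n : ℝ) ^ n / n ! ≤ 3 ^ n :=
    calc (n : ℝ) ^ n / n ! ≤ Real.exp n := Real.pow_div_factorial_le_exp _ (by positivity) _
      _ = Real.exp 1 ^ n := (Real.exp_one_pow n).symm
      _ ≤ 3 ^ n := by gcongr; exact Real.exp_one_lt_three.le
  exact_mod_cast (div_le_iff₀ (by positivity)).1 hexp

lemma pow_mul_factorial_le_pow_mul_descFactorial {n k : ℕ} (h : n ≤ k) :
    k ^ n * n ! ≤ n ^ n * k.descFactorial n := by
  have hfactor : ∀ i ∈ Finset.range n, k * (n - i) ≤ n * (k - i) := fun i _ => by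
    rw [Nat.mul_sub, Nat.mul_sub, mul_comm k n]
    exact Nat.sub_le_sub_left (Nat.mul_le_mul_right i h) _
  simpa only [Finset.prod_mul_distrib, Finset.prod_const, Finset.card_range,
    ← Nat.descFactorial_eq_prod_range, Nat.descFactorial_self] using Finset.prod_le_prod' hfactor

lemma pow_mul_factorial_sub_le_three_pow_mul_factorial {n k : ℕ} (h : n ≤ k) :
    k ^ n * (k - n)! ≤ 3 ^ n * k ! := by
  refine Nat.le_of_mul_le_mul_left ?_ n.factorial_pos
  calc n ! * (k ^ n * (k - n)!) = k ^ n * n ! * (k - n)! := by ring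
    _ ≤ n ^ n * k.descFactorial n * (k - n)! := by
        gcongr ?_ * _; exact pow_mul_factorial_le_pow_mul_descFactorial h
    _ ≤ 3 ^ n * n ! * k.descFactorial n * (k - n)! := by
        gcongr; exact pow_self_le_three_pow_mul_factorial n
    _ = n ! * (3 ^ n * k !) := by rw [← Nat.factorial_mul_descFactorial h]; ring

lemma pow_pred_mul_factorial_sub_le {n k : ℕ} (hn : 1 ≤ n) (h : n ≤ k) :
    k ^ (n - 1) * (k - n)! ≤ 3 ^ n * (k - 1)! := by
  have hk : 0 < k := by omega
  refine Nat.le_of_mul_le_mul_left ?_ hk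
  calc k * (k ^ (n - 1) * (k - n)!) = k ^ n * (k - n)! := by
        rw [← mul_assoc, ← pow_succ', Nat.sub_add_cancel hn]
    _ ≤ 3 ^ n * k ! := pow_mul_factorial_sub_le_three_pow_mul_factorial h
    _ = k * (3 ^ n * (k - 1)!) := by rw [← Nat.mul_factorial_pred hk.ne']; ring

/-! ### Majorants of products -/

/-- The majorant of the coefficients of the formal solution. -/
def solWeight (m : ℕ) (τ ς A B : ℝ) (k l : ℕ) : ℝ :=
  A ^ (2 * k - 1) * ((k - 1)! : ℝ) ^ ς * (k : ℝ) ^ (-(m + τ * m + 2)) *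
    xWeight τ B ((2 * m + 1) * (k - 1) + 1) l

/-- The majorant of the coefficients of a product of `n` components of the jet. Each component is
divisible by `t`, so that the coefficients with `k < n` vanish. -/
def prodWeight (m : ℕ) (τ ς A B γ : ℝ) (n k l : ℕ) : ℝ :=
  if n ≤ k then A ^ (2 * k - n) * ((k - n)! : ℝ) ^ ς * (k : ℝ) ^ (-γ) *
    xWeight τ B ((2 * m + 1) * (k - n) + n * (m + 1)) l else 0

/-- The constant by which the derivatives in `jet m u` enlarge the majorant of `u`. -/
def jetConst (m : ℕ) (τ B : ℝ) : ℝ := B ^ m * ((2 * m + 1 : ℕ) : ℝ) ^ (m * (1 + τ))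

/-- The constant, to be raised to the power `tzDeg e`, in the estimate of `jetMonomial u e`. -/
def monomialConst (m : ℕ) (τ ς B : ℝ) : ℝ := 4 * 2 ^ (m + τ * m + 2) * jetConst m τ B * 3 ^ ς

section Majorant

variable {m : ℕ} {τ ς A B γ : ℝ}

lemma solWeight_nonneg (hA : 0 ≤ A) (hB : 0 ≤ B) (k l : ℕ) : 0 ≤ solWeight m τ ς A B k l := by
  have := xWeight_nonneg (τ := τ) hB ((2 * m + 1) * (k - 1) + 1) l
  unfold solWeight
  positivity

lemma prodWeight_nonneg (hA : 0 ≤ A) (hB : 0 ≤ B) (γ : ℝ) (n k l : ℕ) :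
    0 ≤ prodWeight m τ ς A B γ n k l := by
  have := xWeight_nonneg (τ := τ) hB ((2 * m + 1) * (k - n) + n * (m + 1)) l
  unfold prodWeight
  split_ifs <;> positivity

lemma prodWeight_eq_mul_rpow (γ : ℝ) (n k l : ℕ) :
    prodWeight m τ ς A B γ n k l = prodWeight m τ ς A B 0 n k l * (k : ℝ) ^ (-γ) := by
  unfold prodWeight
  split_ifs
  · rw [neg_zero, Real.rpow_zero]; ring
  · rw [zero_mul]

lemma rpow_factorial_mul_rpow_factorial_le (hς : 0 ≤ ς) (i j : ℕ) :
    (i ! : ℝ) ^ ς * (j ! : ℝ) ^ ς ≤ ((i + j)! : ℝ) ^ ς := by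
  rw [← Real.mul_rpow (by positivity) (by positivity)]
  refine Real.rpow_le_rpow (by positivity) ?_ hς
  exact_mod_cast Nat.le_of_dvd (Nat.factorial_pos _)
    (Nat.factorial_mul_factorial_dvd_factorial_add i j)

lemma sum_prodWeight_mul_prodWeight_le (hτ : 0 ≤ τ) (hς : 0 ≤ ς) (hA : 0 ≤ A) (hB : 0 ≤ B)
    (n n' a a' l : ℕ) :
    ∑ w ∈ antidiagonal l, prodWeight m τ ς A B 0 n a w.1 * prodWeight m τ ς A B 0 n' a' w.2
      ≤ prodWeight m τ ς A B 0 (n + n') (a + a') l := by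
  by_cases h : n ≤ a ∧ n' ≤ a'
  swap
  · have hzero (w : ℕ × ℕ) :
        prodWeight m τ ς A B 0 n a w.1 * prodWeight m τ ς A B 0 n' a' w.2 = 0 := by
      rcases not_and_or.1 h with hn | hn' <;> simp [prodWeight, *]
    simp only [hzero, Finset.sum_const_zero]
    exact prodWeight_nonneg hA hB _ _ _ _
  obtain ⟨i, rfl⟩ := Nat.exists_eq_add_of_le h.1
  obtain ⟨j, rfl⟩ := Nat.exists_eq_add_of_le h.2
  simp only [prodWeight, neg_zero, Real.rpow_zero, mul_one, Nat.le_add_right, if_true,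
    Nat.add_sub_cancel_left, show n + i + (n' + j) - (n + n') = i + j by omega,
    show n + n' ≤ n + i + (n' + j) by omega]
  calc _ = A ^ (2 * (n + i) - n) * A ^ (2 * (n' + j) - n') * ((i ! : ℝ) ^ ς * (j ! : ℝ) ^ ς) *
        ∑ w ∈ antidiagonal l, xWeight τ B ((2 * m + 1) * i + n * (m + 1)) w.1 *
          xWeight τ B ((2 * m + 1) * j + n' * (m + 1)) w.2 := by
        rw [Finset.mul_sum]
        exact Finset.sum_congr rfl fun w _ => by ring
    _ ≤ A ^ (2 * (n + i) - n) * A ^ (2 * (n' + j) - n') * ((i + j)! : ℝ) ^ ς *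
        xWeight τ B ((2 * m + 1) * i + n * (m + 1) + ((2 * m + 1) * j + n' * (m + 1))) l := by
        gcongr
        · exact Finset.sum_nonneg fun w _ =>
            mul_nonneg (xWeight_nonneg hB _ _) (xWeight_nonneg hB _ _)
        · exact rpow_factorial_mul_rpow_factorial_le hς i j
        · exact sum_xWeight_mul_le hτ hB _ _ _
    _ = _ := by
        have hexp : 2 * (n + i) - n + (2 * (n' + j) - n') = 2 * (n + i + (n' + j)) - (n + n') := by
          omega
        have harg : (2 * m + 1) * i + n * (m + 1) + ((2 * m + 1) * j + n' * (m + 1)) =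
            (2 * m + 1) * (i + j) + (n + n') * (m + 1) := by ring
        rw [← pow_add, hexp, harg]

lemma sum_sum_prodWeight_mul_le (hτ : 0 ≤ τ) (hς : 0 ≤ ς) (hA : 0 ≤ A) (hB : 0 ≤ B) (hγ : 2 ≤ γ)
    (n n' k l : ℕ) :
    ∑ y ∈ antidiagonal k, ∑ w ∈ antidiagonal l,
      prodWeight m τ ς A B γ n y.1 w.1 * prodWeight m τ ς A B γ n' y.2 w.2
        ≤ 4 * 2 ^ γ * prodWeight m τ ς A B γ (n + n') k l := by
  calc _ ≤ ∑ y ∈ antidiagonal k,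
        prodWeight m τ ς A B 0 (n + n') k l * ((y.1 : ℝ) ^ (-γ) * (y.2 : ℝ) ^ (-γ)) := by
        refine Finset.sum_le_sum fun y hy => ?_
        simp only [prodWeight_eq_mul_rpow γ, mul_mul_mul_comm _ ((y.1 : ℝ) ^ (-γ)),
          ← Finset.sum_mul]
        rw [← mem_antidiagonal.1 hy]
        gcongr
        exact sum_prodWeight_mul_prodWeight_le hτ hς hA hB _ _ _ _ _
    _ ≤ prodWeight m τ ς A B 0 (n + n') k l * (4 * 2 ^ γ * (k : ℝ) ^ (-γ)) := by
        rw [← Finset.mul_sum]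
        exact mul_le_mul_of_nonneg_left (sum_rpow_neg_mul_le hγ k) (prodWeight_nonneg hA hB _ _ _ _)
    _ = _ := by rw [prodWeight_eq_mul_rpow γ]; ring

/-- `f` is bounded like a product of `n` series, each with the majorant `M * prodWeight … 1`. The
empty product has to be singled out, as no power of `k` bounds the coefficients of `1`. -/
def ProdBound (m : ℕ) (τ ς A B γ M : ℝ) (n : ℕ) (f : FPS) : Prop :=
  if n = 0 then f = 1 else
    ∀ k l, ‖coeff₂ f k l‖ ≤ (4 * 2 ^ γ) ^ (n - 1) * M ^ n * prodWeight m τ ς A B γ n k l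

section ProdBound

variable {M : ℝ}

lemma ProdBound.mul (hτ : 0 ≤ τ) (hς : 0 ≤ ς) (hA : 0 ≤ A) (hB : 0 ≤ B) (hM : 0 ≤ M) (hγ : 2 ≤ γ)
    {n n' : ℕ} {f g : FPS} (hf : ProdBound m τ ς A B γ M n f) (hg : ProdBound m τ ς A B γ M n' g) :
    ProdBound m τ ς A B γ M (n + n') (f * g) := by
  rcases Nat.eq_zero_or_pos n with rfl | hn
  · rw [ProdBound, if_pos rfl] at hf
    rwa [hf, zero_add, one_mul]
  rcases Nat.eq_zero_or_pos n' with rfl | hn'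
  · rw [ProdBound, if_pos rfl] at hg
    rwa [hg, add_zero, mul_one]
  rw [ProdBound, if_neg hn.ne'] at hf
  rw [ProdBound, if_neg hn'.ne'] at hg
  rw [ProdBound, if_neg (by omega)]
  intro k l
  rw [coeff₂_mul]
  calc _ ≤ ∑ y ∈ antidiagonal k, ∑ w ∈ antidiagonal l,
        ((4 * 2 ^ γ) ^ (n - 1) * M ^ n * prodWeight m τ ς A B γ n y.1 w.1) *
          ((4 * 2 ^ γ) ^ (n' - 1) * M ^ n' * prodWeight m τ ς A B γ n' y.2 w.2) := by
        refine norm_sum_le_of_le _ fun y _ => norm_sum_le_of_le _ fun w _ => ?_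
        rw [norm_mul]
        exact mul_le_mul (hf _ _) (hg _ _) (norm_nonneg _)
          (mul_nonneg (by positivity) (prodWeight_nonneg hA hB _ _ _ _))
    _ = (4 * 2 ^ γ) ^ (n - 1) * (4 * 2 ^ γ) ^ (n' - 1) * M ^ (n + n') *
        ∑ y ∈ antidiagonal k, ∑ w ∈ antidiagonal l,
          prodWeight m τ ς A B γ n y.1 w.1 * prodWeight m τ ς A B γ n' y.2 w.2 := by
        simp only [Finset.mul_sum]
        exact Finset.sum_congr rfl fun y _ => Finset.sum_congr rfl fun w _ => by ring
    _ ≤ (4 * 2 ^ γ) ^ (n - 1) * (4 * 2 ^ γ) ^ (n' - 1) * M ^ (n + n') *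
        (4 * 2 ^ γ * prodWeight m τ ς A B γ (n + n') k l) := by
        gcongr
        exact sum_sum_prodWeight_mul_le hτ hς hA hB hγ n n' k l
    _ = _ := by
        rw [show n + n' - 1 = (n - 1) + (n' - 1) + 1 by omega]; ring

lemma ProdBound.pow (hτ : 0 ≤ τ) (hς : 0 ≤ ς) (hA : 0 ≤ A) (hB : 0 ≤ B) (hM : 0 ≤ M) (hγ : 2 ≤ γ)
    {f : FPS} (i : ℕ) (hf : i ≠ 0 → ProdBound m τ ς A B γ M 1 f) :
    ProdBound m τ ς A B γ M i (f ^ i) := by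
  induction i with
  | zero => simp [ProdBound]
  | succ i ih =>
    rw [pow_succ]
    exact (ih fun _ => hf i.succ_ne_zero).mul hτ hς hA hB hM hγ (hf i.succ_ne_zero)

lemma ProdBound.prod (hτ : 0 ≤ τ) (hς : 0 ≤ ς) (hA : 0 ≤ A) (hB : 0 ≤ B) (hM : 0 ≤ M) (hγ : 2 ≤ γ)
    {ι : Type*} (s : Finset ι) (n : ι → ℕ) (f : ι → FPS)
    (hf : ∀ i ∈ s, ProdBound m τ ς A B γ M (n i) (f i)) :
    ProdBound m τ ς A B γ M (∑ i ∈ s, n i) (∏ i ∈ s, f i) := by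
  classical
  induction s using Finset.induction_on with
  | empty => simp [ProdBound]
  | insert i s hi ih =>
    rw [Finset.sum_insert hi, Finset.prod_insert hi]
    exact (hf i (Finset.mem_insert_self i s)).mul hτ hς hA hB hM hγ
      (ih fun j hj => hf j (Finset.mem_insert_of_mem hj))

end ProdBound

lemma one_le_jetConst (hτ : 0 ≤ τ) (hB : 1 ≤ B) : 1 ≤ jetConst m τ B :=
  one_le_mul_of_one_le_of_one_le (one_le_pow₀ hB)
    (Real.one_le_rpow (by exact_mod_cast (by omega : 1 ≤ 2 * m + 1)) (by positivity))

lemma ascFactorial_mul_xWeight_le_jetConst_mul (hτ : 0 ≤ τ) (hB : 1 ≤ B) {α k : ℕ} (hα : α ≤ m)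
    (hk : 1 ≤ k) (l : ℕ) :
    (l + 1).ascFactorial α * xWeight τ B ((2 * m + 1) * (k - 1) + 1) (l + α)
      ≤ jetConst m τ B * (k : ℝ) ^ (α * (1 + τ)) *
        xWeight τ B ((2 * m + 1) * (k - 1) + 1 * (m + 1)) l := by
  have hB0 : 0 ≤ B := by linarith
  have hxw := xWeight_nonneg (τ := τ) hB0 ((2 * m + 1) * (k - 1) + 1 * (m + 1)) l
  have hs : (2 * m + 1) * (k - 1) + 1 + α ≤ (2 * m + 1) * k + 1 := by
    obtain ⟨k, rfl⟩ := Nat.exists_eq_add_of_le' hk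
    rw [Nat.add_sub_cancel, mul_add]
    omega
  refine (ascFactorial_mul_xWeight_le hτ hB0 l (by omega)
    (by omega : _ ≤ (2 * m + 1) * (k - 1) + 1 * (m + 1)) hs).trans ?_
  rw [jetConst, mul_assoc (B ^ m), Nat.cast_mul, Real.mul_rpow (by positivity) (by positivity)]
  gcongr
  exact_mod_cast (by omega : 1 ≤ 2 * m + 1)

variable {u : FPS}

lemma norm_coeff₂_jet_le (hτ : 0 ≤ τ) (hA : 0 ≤ A) (hB : 1 ≤ B) (hu : ∀ l, coeff₂ u 0 l = 0)
    (hW : ∀ k l, 1 ≤ k → ‖coeff₂ u k l‖ ≤ solWeight m τ ς A B k l) {β : ℝ} (q : Idx m)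
    (hq : (q.1.1 : ℝ) + q.1.2 + τ * q.1.2 ≤ β) (k l : ℕ) :
    ‖coeff₂ (jet m u (vz q)) k l‖
      ≤ jetConst m τ B * prodWeight m τ ς A B (m + τ * m + 2 - β) 1 k l := by
  rw [coeff₂_jet]
  rcases Nat.eq_zero_or_pos k with rfl | hk
  · rw [hu]
    simp [prodWeight]
  generalize q.1.1 = j, hα : q.1.2 = α at hq
  have hαm : α ≤ m := by have := (mem_idxSet.1 q.2).1; omega
  have hk0 : (0 : ℝ) < k := by exact_mod_cast hk
  have hk1 : (1 : ℝ) ≤ k := by exact_mod_cast hk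
  have hB0 : 0 ≤ B := by linarith
  have hxw := xWeight_nonneg (τ := τ) hB0 ((2 * m + 1) * (k - 1) + 1 * (m + 1)) l
  have hjet : 0 ≤ jetConst m τ B := zero_le_one.trans (one_le_jetConst hτ hB)
  have hpow : (k : ℝ) ^ j * (k : ℝ) ^ (α * (1 + τ)) * (k : ℝ) ^ (-(m + τ * m + 2))
      ≤ (k : ℝ) ^ (-(m + τ * m + 2 - β)) := by
    rw [← Real.rpow_natCast, ← Real.rpow_add hk0, ← Real.rpow_add hk0]
    exact Real.rpow_le_rpow_of_exponent_le hk1 (by linarith)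
  rw [prodWeight, if_pos (show 1 ≤ k from hk), norm_mul, norm_pow, norm_mul, Complex.norm_natCast,
    Complex.norm_natCast]
  calc (k : ℝ) ^ j * ((l + 1).ascFactorial α * ‖coeff₂ u k (l + α)‖)
      ≤ (k : ℝ) ^ j * ((l + 1).ascFactorial α * solWeight m τ ς A B k (l + α)) := by
        gcongr
        exact hW k _ hk
    _ = A ^ (2 * k - 1) * ((k - 1)! : ℝ) ^ ς * ((k : ℝ) ^ j * (k : ℝ) ^ (-(m + τ * m + 2))) *
        ((l + 1).ascFactorial α * xWeight τ B ((2 * m + 1) * (k - 1) + 1) (l + α)) := by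
        unfold solWeight; ring
    _ ≤ A ^ (2 * k - 1) * ((k - 1)! : ℝ) ^ ς * ((k : ℝ) ^ j * (k : ℝ) ^ (-(m + τ * m + 2))) *
        (jetConst m τ B * (k : ℝ) ^ (α * (1 + τ)) *
          xWeight τ B ((2 * m + 1) * (k - 1) + 1 * (m + 1)) l) := by
        exact mul_le_mul_of_nonneg_left
          (ascFactorial_mul_xWeight_le_jetConst_mul hτ hB hαm hk l) (by positivity)
    _ = jetConst m τ B * (A ^ (2 * k - 1) * ((k - 1)! : ℝ) ^ ς *
        ((k : ℝ) ^ j * (k : ℝ) ^ (α * (1 + τ)) * (k : ℝ) ^ (-(m + τ * m + 2))) *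
          xWeight τ B ((2 * m + 1) * (k - 1) + 1 * (m + 1)) l) := by ring
    _ ≤ _ := by gcongr

lemma norm_coeff₂_X_zero_le (hA : 1 ≤ A) (hB : 0 ≤ B) (γ : ℝ) (k l : ℕ) :
    ‖(coeff₂ (MvPowerSeries.X 0) k l : ℂ)‖ ≤ prodWeight m τ ς A B γ 1 k l := by
  rw [coeff₂_X_zero]
  split_ifs with h
  · obtain ⟨rfl, rfl⟩ := h
    simpa [prodWeight, xWeight] using hA
  · rw [norm_zero]
    exact prodWeight_nonneg (by linarith) hB _ _ _ _

lemma prodBound_prod_jet (hτ : 0 ≤ τ) (hς : 0 ≤ ς) (hA : 1 ≤ A) (hB : 1 ≤ B)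
    (hu : ∀ l, coeff₂ u 0 l = 0) (hW : ∀ k l, 1 ≤ k → ‖coeff₂ u k l‖ ≤ solWeight m τ ς A B k l)
    {β : ℝ} (hβ : β ≤ m + τ * m) {e : Var m →₀ ℕ}
    (he : ∀ q : Idx m, e (vz q) ≠ 0 → (q.1.1 : ℝ) + q.1.2 + τ * q.1.2 ≤ β) :
    ProdBound m τ ς A B (m + τ * m + 2 - β) (jetConst m τ B) (tzDeg e)
      (∏ o, jet m u (tzVar o) ^ e (tzVar o)) := by
  have hA0 : 0 ≤ A := by linarith
  have hB0 : 0 ≤ B := by linarith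
  have hM := one_le_jetConst (m := m) hτ hB
  have hM0 : 0 ≤ jetConst m τ B := by linarith
  have hγ : 2 ≤ m + τ * m + 2 - β := by linarith
  rw [tzDeg_eq_sum]
  refine ProdBound.prod hτ hς hA0 hB0 hM0 hγ _ _ _ fun o _ =>
    ProdBound.pow hτ hς hA0 hB0 hM0 hγ _ fun ho => ?_
  simp only [ProdBound, one_ne_zero, if_false, Nat.sub_self, pow_zero, one_mul, pow_one]
  intro k l
  rcases o with _ | q
  · exact (norm_coeff₂_X_zero_le hA hB0 _ k l).trans
      (le_mul_of_one_le_left (prodWeight_nonneg hA0 hB0 _ _ _ _) hM)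
  · exact norm_coeff₂_jet_le hτ hA0 hB hu hW q (he q ho) k l

lemma rpow_factorial_sub_le (hς : 0 ≤ ς) {n k : ℕ} (hn : 1 ≤ n) (hnk : n ≤ k) :
    ((k - n)! : ℝ) ^ ς
      ≤ ((3 : ℝ) ^ ς) ^ n * ((k - 1)! : ℝ) ^ ς * (k : ℝ) ^ (-(ς * ((n : ℝ) - 1))) := by
  have hk0 : (0 : ℝ) < k := by exact_mod_cast hn.trans hnk
  have hle : (k : ℝ) ^ (n - 1) * (k - n)! ≤ 3 ^ n * (k - 1)! := by
    exact_mod_cast pow_pred_mul_factorial_sub_le hn hnk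
  have hk_pow : ((k : ℝ) ^ (n - 1)) ^ ς = (k : ℝ) ^ (ς * ((n : ℝ) - 1)) := by
    rw [← Real.rpow_natCast, ← Real.rpow_mul hk0.le, Nat.cast_sub hn, Nat.cast_one, mul_comm]
  have h := Real.rpow_le_rpow (by positivity) hle hς
  rw [Real.mul_rpow (by positivity) (by positivity), Real.mul_rpow (by positivity) (by positivity),
    hk_pow, ← Real.rpow_pow_comm (by norm_num)] at h
  rw [Real.rpow_neg hk0.le, ← div_eq_mul_inv, le_div_iff₀ (by positivity)]
  linarith

lemma xWeight_sub_le (hτ : 0 ≤ τ) (hB : 0 < B) {n k l μ : ℕ} (hn : 2 ≤ n) (hnk : n ≤ k)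
    (hμ : μ ≤ l) :
    xWeight τ B ((2 * m + 1) * (k - n) + n * (m + 1)) (l - μ)
      ≤ (1 / B) ^ μ * (k : ℝ) ^ (-(τ * μ)) * xWeight τ B ((2 * m + 1) * (k - 1) + 1) l := by
  obtain ⟨i, rfl⟩ := Nat.exists_eq_add_of_le hnk
  obtain ⟨n, rfl⟩ := Nat.exists_eq_add_of_le' hn
  have hbase : (2 * m + 1) * (n + 2 + i - (n + 2)) + (n + 2) * (m + 1)
      ≤ (2 * m + 1) * (n + 2 + i - 1) + 1 := by
    rw [Nat.add_sub_cancel_left, show n + 2 + i - 1 = n + 1 + i by omega]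
    nlinarith [Nat.zero_le (m * n)]
  have hk_le : n + 2 + i ≤ (2 * m + 1) * (n + 2 + i - 1) + 1 + (l - μ) := by
    have := Nat.le_mul_of_pos_left (n + 2 + i - 1) (by omega : 0 < 2 * m + 1)
    omega
  have h := rpow_mul_xWeight_le hτ hB.le hbase (by omega) hμ hk_le
  rw [Real.rpow_neg (by positivity), one_div, inv_pow, ← mul_inv, inv_mul_eq_div,
    le_div_iff₀ (by positivity)]
  linarith

lemma prodWeight_le_solWeight (hτ : 0 ≤ τ) (hς : 0 ≤ ς) (hA : 0 < A) (hB : 0 < B) {β : ℝ}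
    {n k l μ : ℕ} (hn : 2 ≤ n) (hk : 1 ≤ k) (hμ : μ ≤ l)
    (hβ : β ≤ m + τ * μ + ς * ((n : ℝ) - 1)) :
    prodWeight m τ ς A B (m + τ * m + 2 - β) n k (l - μ)
      ≤ ((3 : ℝ) ^ ς) ^ n * (1 / A) ^ (n - 1) * (1 / B) ^ μ *
        ((k : ℝ) ^ m * solWeight m τ ς A B k l) := by
  have hk0 : (0 : ℝ) < k := by exact_mod_cast hk
  have hk1 : (1 : ℝ) ≤ k := by exact_mod_cast hk
  have hsol := solWeight_nonneg (m := m) (τ := τ) (ς := ς) hA.le hB.le k l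
  by_cases hnk : n ≤ k
  swap
  · rw [prodWeight, if_neg hnk]
    positivity
  rw [prodWeight, if_pos hnk]
  have hA_pow : A ^ (2 * k - n) = (1 / A) ^ (n - 1) * A ^ (2 * k - 1) := by
    rw [show 2 * k - 1 = (n - 1) + (2 * k - n) by omega, pow_add, ← mul_assoc, ← mul_pow,
      one_div_mul_cancel hA.ne', one_pow, one_mul]
  have hk_pow : (k : ℝ) ^ (-(m + τ * m + 2 - β)) * (k : ℝ) ^ (-(ς * ((n : ℝ) - 1))) *
      (k : ℝ) ^ (-(τ * μ)) ≤ (k : ℝ) ^ m * (k : ℝ) ^ (-(m + τ * m + 2)) := by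
    rw [← Real.rpow_natCast, ← Real.rpow_add hk0, ← Real.rpow_add hk0, ← Real.rpow_add hk0]
    exact Real.rpow_le_rpow_of_exponent_le hk1 (by linarith)
  have hxw := xWeight_nonneg (τ := τ) hB.le ((2 * m + 1) * (k - 1) + 1) l
  have hxw' := xWeight_nonneg (τ := τ) hB.le ((2 * m + 1) * (k - n) + n * (m + 1)) (l - μ)
  calc _ ≤ (1 / A) ^ (n - 1) * A ^ (2 * k - 1) *
        (((3 : ℝ) ^ ς) ^ n * ((k - 1)! : ℝ) ^ ς * (k : ℝ) ^ (-(ς * ((n : ℝ) - 1)))) *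
        (k : ℝ) ^ (-(m + τ * m + 2 - β)) *
        ((1 / B) ^ μ * (k : ℝ) ^ (-(τ * μ)) * xWeight τ B ((2 * m + 1) * (k - 1) + 1) l) := by
        rw [hA_pow]
        gcongr
        · exact rpow_factorial_sub_le hς (by omega) hnk
        · exact xWeight_sub_le hτ hB hn hnk hμ
    _ = ((3 : ℝ) ^ ς) ^ n * (1 / A) ^ (n - 1) * (1 / B) ^ μ * (A ^ (2 * k - 1) *
        ((k - 1)! : ℝ) ^ ς * xWeight τ B ((2 * m + 1) * (k - 1) + 1) l) *
        ((k : ℝ) ^ (-(m + τ * m + 2 - β)) * (k : ℝ) ^ (-(ς * ((n : ℝ) - 1))) *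
          (k : ℝ) ^ (-(τ * μ))) := by ring
    _ ≤ ((3 : ℝ) ^ ς) ^ n * (1 / A) ^ (n - 1) * (1 / B) ^ μ * (A ^ (2 * k - 1) *
        ((k - 1)! : ℝ) ^ ς * xWeight τ B ((2 * m + 1) * (k - 1) + 1) l) *
        ((k : ℝ) ^ m * (k : ℝ) ^ (-(m + τ * m + 2))) := by gcongr
    _ = _ := by unfold solWeight; ring

lemma monomialConst_nonneg (hB : 0 ≤ B) : 0 ≤ monomialConst m τ ς B := by
  unfold monomialConst jetConst; positivity

lemma four_mul_two_rpow_sub_pow_pred_le {x y : ℝ} (hx : 0 ≤ x) (hy : 0 ≤ y) (n : ℕ) :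
    (4 * 2 ^ (x - y) : ℝ) ^ (n - 1) ≤ (4 * 2 ^ x) ^ n :=
  calc (4 * 2 ^ (x - y) : ℝ) ^ (n - 1) ≤ (4 * 2 ^ x) ^ (n - 1) := by
        gcongr
        · norm_num
        · linarith
    _ ≤ (4 * 2 ^ x) ^ n := pow_le_pow_right₀ (one_le_mul_of_one_le_of_one_le (by norm_num)
        (Real.one_le_rpow (by norm_num) hx)) n.pred_le

lemma norm_coeff₂_jetMonomial_le (hτ : 0 ≤ τ) (hς : 0 ≤ ς) (hA : 1 ≤ A) (hB : 1 ≤ B)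
    (hu : ∀ l, coeff₂ u 0 l = 0) (hW : ∀ k l, 1 ≤ k → ‖coeff₂ u k l‖ ≤ solWeight m τ ς A B k l)
    {e : Var m →₀ ℕ} (he : 2 ≤ tzDeg e)
    (hes : ∀ q : Idx m, e (vz q) ≠ 0 →
      (q.1.1 : ℝ) + q.1.2 + τ * (q.1.2 - e (vx m)) - m ≤ ς * ((tzDeg e : ℝ) - 1))
    {k : ℕ} (hk : 1 ≤ k) (l : ℕ) :
    ‖coeff₂ (jetMonomial u e) k l‖ ≤ monomialConst m τ ς B ^ tzDeg e * (1 / A) ^ (tzDeg e - 1) *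
      (1 / B) ^ e (vx m) * ((k : ℝ) ^ m * solWeight m τ ς A B k l) := by
  have hA0 : 0 < A := by linarith
  have hB0 : 0 < B := by linarith
  have hmono := monomialConst_nonneg (m := m) (τ := τ) (ς := ς) hB0.le
  have hsol := solWeight_nonneg (m := m) (τ := τ) (ς := ς) hA0.le hB0.le k l
  have hjet : 0 ≤ jetConst m τ B := zero_le_one.trans (one_le_jetConst hτ hB)
  generalize hn : tzDeg e = n at *
  generalize hμ : e (vx m) = μ at *
  have hn1 : (1 : ℝ) ≤ n := by exact_mod_cast (by omega : 1 ≤ n)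
  obtain ⟨β, hβ⟩ : ∃ β, β = min (m + τ * m) (m + τ * μ + ς * ((n : ℝ) - 1)) := ⟨_, rfl⟩
  have hβ0 : 0 ≤ β := by
    rw [hβ]
    exact le_min (by positivity) (add_nonneg (by positivity) (mul_nonneg hς (by linarith)))
  have hprod := prodBound_prod_jet hτ hς hA hB hu hW (hβ.trans_le (min_le_left _ _)) (e := e) <| by
    intro q hq
    have hqm : (q.1.1 : ℝ) + q.1.2 ≤ m := by exact_mod_cast (mem_idxSet.1 q.2).1
    have hαm : τ * q.1.2 ≤ τ * m := by
      have := (mem_idxSet.1 q.2).1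
      gcongr
      omega
    rw [hβ]
    exact le_min (by linarith) (by linarith [hes q hq])
  rw [hn, ProdBound, if_neg (by omega)] at hprod
  rw [jetMonomial_eq_prod, hμ, coeff₂_X_one_pow_mul]
  split_ifs with hle
  swap
  · rw [norm_zero]; positivity
  calc _ ≤ (4 * 2 ^ (m + τ * m + 2 - β)) ^ (n - 1) * jetConst m τ B ^ n *
        prodWeight m τ ς A B (m + τ * m + 2 - β) n k (l - μ) := hprod k (l - μ)
    _ ≤ (4 * 2 ^ (m + τ * m + 2)) ^ n * jetConst m τ B ^ n * (((3 : ℝ) ^ ς) ^ n *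
        (1 / A) ^ (n - 1) * (1 / B) ^ μ * ((k : ℝ) ^ m * solWeight m τ ς A B k l)) := by
        gcongr
        · exact prodWeight_nonneg hA0.le hB0.le _ _ _ _
        · exact four_mul_two_rpow_sub_pow_pred_le (by positivity) hβ0 n
        · exact prodWeight_le_solWeight hτ hς hA0 hB0 he hk hle (hβ.trans_le (min_le_right _ _))
    _ = _ := by
        rw [monomialConst, mul_pow _ ((3 : ℝ) ^ ς), mul_pow _ (jetConst m τ B)]
        ring

end Majorant

/-! ### The majorant of the formal solution -/

lemma sum_half_pow_le {ι : Type*} [Fintype ι] (s : Finset (ι →₀ ℕ)) :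
    ∑ e ∈ s, (1 / 2 : ℝ) ^ (∑ v, e v) ≤ 2 ^ Fintype.card ι := by
  classical
  let N := s.sup fun e => ∑ v, e v
  have hlt : ∀ e ∈ s, ∀ v, e v < N + 1 := fun e he v => Nat.lt_succ_of_le <|
    (Finset.single_le_sum (f := fun v => e v) (fun _ _ => Nat.zero_le _) (Finset.mem_univ v)).trans
      (Finset.le_sup (f := fun e : ι →₀ ℕ => ∑ v, e v) he)
  calc ∑ e ∈ s, (1 / 2 : ℝ) ^ (∑ v, e v)
      = ∑ f ∈ s.image (fun e : ι →₀ ℕ => (⇑e : ι → ℕ)), (1 / 2 : ℝ) ^ (∑ v, f v) := by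
        rw [Finset.sum_image fun e _ e' _ h => DFunLike.coe_injective h]
    _ ≤ ∑ f ∈ Fintype.piFinset fun _ : ι => Finset.range (N + 1), (1 / 2 : ℝ) ^ (∑ v, f v) := by
        refine Finset.sum_le_sum_of_subset_of_nonneg ?_ fun _ _ _ => by positivity
        intro f hf
        obtain ⟨e, he, rfl⟩ := Finset.mem_image.1 hf
        exact Fintype.mem_piFinset.2 fun v => Finset.mem_range.2 (hlt e he v)
    _ = ∏ _v : ι, ∑ i ∈ Finset.range (N + 1), (1 / 2 : ℝ) ^ i := by
        rw [Finset.prod_univ_sum]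
        exact Finset.sum_congr rfl fun f _ => (Finset.prod_pow_eq_pow_sum _ _ _).symm
    _ ≤ ∏ _v : ι, (2 : ℝ) :=
        Finset.prod_le_prod (fun _ _ => by positivity) fun _ _ => sum_geometric_two_le _
    _ = 2 ^ Fintype.card ι := by simp

lemma sum_pow_succ_le {x : ℝ} (hx0 : 0 ≤ x) (hx : x ≤ 1 / 2) (l : ℕ) :
    ∑ i ∈ Finset.range l, x ^ (i + 1) ≤ 2 * x := by
  calc ∑ i ∈ Finset.range l, x ^ (i + 1) ≤ ∑ i ∈ Finset.range l, x * (1 / 2) ^ i := by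
        refine Finset.sum_le_sum fun i _ => ?_
        rw [pow_succ']
        gcongr
    _ = x * ∑ i ∈ Finset.range l, (1 / 2 : ℝ) ^ i := by rw [Finset.mul_sum]
    _ ≤ x * 2 := by gcongr; exact sum_geometric_two_le l
    _ = 2 * x := by ring

lemma pow_mul_pow_sub_one_le {A N Q : ℝ} (hN : 1 ≤ N) (hQ : 1 ≤ Q) (hA : 4 * N * Q ^ 2 ≤ A)
    {n : ℕ} (hn : 2 ≤ n) : Q ^ n * (1 / A) ^ (n - 1) ≤ 1 / N * (1 / 2) ^ n := by
  have hA0 : 0 < A := lt_of_lt_of_le (by positivity) hA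
  have hN0 : 0 < N := by linarith
  have hQpow : Q ^ n ≤ (Q ^ 2) ^ (n - 1) := by
    rw [← pow_mul]
    exact pow_le_pow_right₀ hQ (by omega)
  have hbase : Q ^ 2 * (1 / A) ≤ 1 / N * (1 / 4) := by
    rw [mul_one_div, div_mul_div_comm, div_le_div_iff₀ hA0 (by positivity)]
    linarith
  have hNpow : (1 / N) ^ (n - 1) ≤ 1 / N :=
    pow_le_of_le_one (by positivity) (by rwa [div_le_one hN0]) (by omega)
  have hquarter : (1 / 4 : ℝ) ^ (n - 1) ≤ (1 / 2) ^ n := by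
    rw [show (1 / 4 : ℝ) = (1 / 2) ^ 2 by norm_num, ← pow_mul]
    exact pow_le_pow_of_le_one (by norm_num) (by norm_num) (by omega)
  calc Q ^ n * (1 / A) ^ (n - 1) ≤ (Q ^ 2) ^ (n - 1) * (1 / A) ^ (n - 1) := by gcongr
    _ = (Q ^ 2 * (1 / A)) ^ (n - 1) := by rw [mul_pow]
    _ ≤ (1 / N * (1 / 4)) ^ (n - 1) := by gcongr
    _ = (1 / N) ^ (n - 1) * (1 / 4) ^ (n - 1) := by rw [mul_pow]
    _ ≤ 1 / N * (1 / 2) ^ n := by gcongr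

section Estimate

variable {m : ℕ} {F : (Var m → ℂ) → ℂ} {τ ς A B C N a : ℝ} {u : FPS}

lemma one_le_monomialConst (hτ : 0 ≤ τ) (hς : 0 ≤ ς) (hB : 1 ≤ B) :
    1 ≤ monomialConst m τ ς B := by
  have htwo : (1 : ℝ) ≤ 2 ^ (m + τ * m + 2) := Real.one_le_rpow (by norm_num) (by positivity)
  exact one_le_mul_of_one_le_of_one_le
    (one_le_mul_of_one_le_of_one_le (by linarith) (one_le_jetConst hτ hB))
    (Real.one_le_rpow (by norm_num) hς)

lemma norm_coeff_mul_coeff₂_jetMonomial_le (hτ : 0 ≤ τ) (hς : 0 ≤ ς) (hC : 0 ≤ C) (ha : 1 ≤ a)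
    (hF : ∀ e, ‖MvPowerSeries.coeff e (taylor F)‖ ≤ C * a ^ (∑ v, e v)) (haB : 2 * a ≤ B)
    (hN : 1 ≤ N) (hA1 : 1 ≤ A) (hA : 4 * N * (a * monomialConst m τ ς B) ^ 2 ≤ A)
    (hu : ∀ l, coeff₂ u 0 l = 0) (hW : ∀ k l, 1 ≤ k → ‖coeff₂ u k l‖ ≤ solWeight m τ ς A B k l)
    {e : Var m →₀ ℕ} (he : 2 ≤ tzDeg e)
    (hes : ∀ q : Idx m, e (vz q) ≠ 0 →
      (q.1.1 : ℝ) + q.1.2 + τ * (q.1.2 - e (vx m)) - m ≤ ς * ((tzDeg e : ℝ) - 1))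
    {k : ℕ} (hk : 1 ≤ k) (l : ℕ) :
    ‖MvPowerSeries.coeff e (taylor F) * coeff₂ (jetMonomial u e) k l‖
      ≤ C / N * ((k : ℝ) ^ m * solWeight m τ ς A B k l) * (1 / 2) ^ (∑ v, e v) := by
  have hA0 : 0 < A := by linarith
  have hB0 : 0 < B := by linarith
  have hB1 : 1 ≤ B := by linarith
  have hW0 : 0 ≤ (k : ℝ) ^ m * solWeight m τ ς A B k l :=
    mul_nonneg (by positivity) (solWeight_nonneg hA0.le hB0.le k l)
  have htz := pow_mul_pow_sub_one_le hN
    (one_le_mul_of_one_le_of_one_le ha (one_le_monomialConst hτ hς hB1)) hA he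
  have hx : (a * (1 / B)) ^ e (vx m) ≤ (1 / 2) ^ e (vx m) := by
    have : a * (1 / B) ≤ 1 / 2 := by
      rw [mul_one_div, div_le_div_iff₀ hB0 (by norm_num)]
      linarith
    gcongr
  rw [norm_mul]
  calc _ ≤ (C * a ^ (∑ v, e v)) * (monomialConst m τ ς B ^ tzDeg e * (1 / A) ^ (tzDeg e - 1) *
        (1 / B) ^ e (vx m) * ((k : ℝ) ^ m * solWeight m τ ς A B k l)) :=
        mul_le_mul (hF e) (norm_coeff₂_jetMonomial_le hτ hς hA1 hB1 hu hW he hes hk l)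
          (norm_nonneg _) (by positivity)
    _ = C * ((k : ℝ) ^ m * solWeight m τ ς A B k l) *
        ((a * monomialConst m τ ς B) ^ tzDeg e * (1 / A) ^ (tzDeg e - 1)) *
        (a * (1 / B)) ^ e (vx m) := by
        rw [sum_eq_tzDeg_add, pow_add, mul_pow, mul_pow]
        ring
    _ ≤ C * ((k : ℝ) ^ m * solWeight m τ ς A B k l) * (1 / N * (1 / 2) ^ tzDeg e) *
        (1 / 2) ^ e (vx m) := by gcongr
    _ = _ := by
        rw [sum_eq_tzDeg_add, pow_add]
        ring

lemma norm_coeff₂_subst_R₂_le (hτ : 0 ≤ τ) (hς : 0 ≤ ς) (hC : 0 ≤ C) (ha : 1 ≤ a)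
    (hF : ∀ e, ‖MvPowerSeries.coeff e (taylor F)‖ ≤ C * a ^ (∑ v, e v))
    (hR : ∀ e, MvPowerSeries.coeff e (R₂ F) ≠ 0 → ∀ q : Idx m, e (vz q) ≠ 0 →
      (q.1.1 : ℝ) + q.1.2 + τ * (q.1.2 - e (vx m)) - m ≤ ς * ((tzDeg e : ℝ) - 1))
    (haB : 2 * a ≤ B) (hN : 1 ≤ N) (hA1 : 1 ≤ A)
    (hA : 4 * N * (a * monomialConst m τ ς B) ^ 2 ≤ A)
    (hu : ∀ l, coeff₂ u 0 l = 0) (hW : ∀ k l, 1 ≤ k → ‖coeff₂ u k l‖ ≤ solWeight m τ ς A B k l)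
    {k : ℕ} (hk : 1 ≤ k) (l : ℕ) :
    ‖coeff₂ (MvPowerSeries.subst (jet m u) (R₂ F)) k l‖
      ≤ C * 2 ^ Fintype.card (Var m) / N * ((k : ℝ) ^ m * solWeight m τ ς A B k l) := by
  have hW0 : 0 ≤ (k : ℝ) ^ m * solWeight m τ ς A B k l :=
    mul_nonneg (by positivity) (solWeight_nonneg (by linarith) (by linarith) k l)
  rw [coeff₂_subst_jet hu, finsum_eq_sum_of_support_toFinset_subset _
    (finite_support_coeff_mul_jetMonomial hu _ k l) (subset_refl _)]
  let s := (finite_support_coeff_mul_jetMonomial hu (R₂ F) k l).toFinset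
  calc _ ≤ ∑ e ∈ s, C / N * ((k : ℝ) ^ m * solWeight m τ ς A B k l) * (1 / 2) ^ (∑ v, e v) := by
        refine (norm_sum_le _ _).trans (Finset.sum_le_sum fun e _ => ?_)
        by_cases hc : MvPowerSeries.coeff e (R₂ F) = 0
        · rw [hc, zero_mul, norm_zero]
          positivity
        have he := two_le_tzDeg_of_coeff_R₂_ne_zero hc
        rw [coeff_R₂, if_pos he]
        exact norm_coeff_mul_coeff₂_jetMonomial_le hτ hς hC ha hF haB hN hA1 hA hu hW he
          (hR e hc) hk l
    _ = C / N * ((k : ℝ) ^ m * solWeight m τ ς A B k l) * ∑ e ∈ s, (1 / 2) ^ (∑ v, e v) := by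
        rw [Finset.mul_sum]
    _ ≤ C / N * ((k : ℝ) ^ m * solWeight m τ ς A B k l) * 2 ^ Fintype.card (Var m) := by
        gcongr
        exact sum_half_pow_le s
    _ = _ := by ring

lemma term_le_polySize_mul_rpow_of_coeff_ne_zero (hτ : 0 ≤ τ)
    (hσ : ∀ q ∈ Λ₁ F, d F q ≤ τ * p F q) (q : Idx m) {i : ℕ}
    (hi : PowerSeries.coeff i (c F q.1) ≠ 0) {k : ℕ} (hk : 1 ≤ k) (l : ℕ) :
    (k : ℝ) ^ q.1.1 * ((l : ℝ) + 1) ^ q.1.2 ≤ polySize F k l * ((l : ℝ) + 1) ^ (τ * i) := by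
  classical
  have hl : (1 : ℝ) ≤ (l : ℝ) + 1 := by simp
  have hpoly := (polySize_pos (F := F) hk l).le
  by_cases h0 : c0 F q.1 = 0
  · have hq : q.1 ∈ Λ₁ F := Finset.mem_filter.2 ⟨q.2, h0, fun h => hi (by rw [h, map_zero])⟩
    have hp : (p F q.1 : ℝ) ≤ i := by
      exact_mod_cast ENat.toNat_le_of_le_natCast (PowerSeries.order_le i hi)
    refine (term_le_polySize_mul_rpow (F := F) hk l (mem_idxSet.1 q.2).2.le).trans ?_
    refine mul_le_mul_of_nonneg_left (Real.rpow_le_rpow_of_exponent_le hl ?_) hpoly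
    exact (hσ _ hq).trans (mul_le_mul_of_nonneg_left hp hτ)
  · have hq : q.1 ∈ Λ₀ F := Finset.mem_insert_of_mem (Finset.mem_filter.2 ⟨q.2, h0⟩)
    exact (term_le_polySize k l hq).trans
      (le_mul_of_one_le_right hpoly (Real.one_le_rpow hl (by positivity)))

lemma rpow_mul_solWeight_sub_le (hτ : 0 ≤ τ) (hA : 0 ≤ A) (hB : 0 < B) (k : ℕ) {i l : ℕ}
    (hil : i ≤ l) :
    (((l - i : ℕ) : ℝ) + 1) ^ (τ * i) * solWeight m τ ς A B k (l - i)
      ≤ solWeight m τ ς A B k l * (1 / B) ^ i := by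
  have hx := rpow_mul_xWeight_le hτ hB.le (a := (2 * m + 1) * (k - 1) + 1) (s := l - i + 1) le_rfl
    (by omega) hil (by omega)
  rw [one_div, inv_pow, ← div_eq_mul_inv, le_div_iff₀ (by positivity), solWeight, solWeight]
  push_cast at hx
  calc _ = A ^ (2 * k - 1) * ((k - 1)! : ℝ) ^ ς * (k : ℝ) ^ (-(m + τ * m + 2)) *
        ((((l - i : ℕ) : ℝ) + 1) ^ (τ * i) *
          (xWeight τ B ((2 * m + 1) * (k - 1) + 1) (l - i) * B ^ i)) := by ring
    _ ≤ _ := by gcongr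

lemma norm_coeff_c_le (hC : 0 ≤ C) (ha : 1 ≤ a)
    (hF : ∀ e, ‖MvPowerSeries.coeff e (taylor F)‖ ≤ C * a ^ (∑ v, e v)) (q : Idx m) (i : ℕ) :
    ‖PowerSeries.coeff i (c F q.1)‖ ≤ C * a ^ (m + 1) * a ^ i := by
  have hα : q.1.2 ≤ m := by
    have := (mem_idxSet.1 q.2).1
    omega
  rw [coeff_c, mul_assoc, ← pow_add]
  refine (hF _).trans (mul_le_mul_of_nonneg_left (pow_le_pow_right₀ ha ?_) hC)
  rw [sum_eq_tzDeg_add, tzDeg_linearExpo, linearExpo_apply_vx]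
  omega

lemma norm_linearTerm_le (hτ : 0 ≤ τ) (hA : 0 ≤ A) (hB : 0 < B) (hC : 0 ≤ C) (ha : 1 ≤ a)
    (hF : ∀ e, ‖MvPowerSeries.coeff e (taylor F)‖ ≤ C * a ^ (∑ v, e v))
    (hσ : ∀ q ∈ Λ₁ F, d F q ≤ τ * p F q) (q : Idx m) {i k l : ℕ} (hk : 1 ≤ k) (hil : i ≤ l)
    (hW : ‖coeff₂ u k (l - i)‖ ≤ solWeight m τ ς A B k (l - i)) :
    ‖linearTerm F u q.1 k l i‖
      ≤ C * a ^ (m + 1) * (polySize F k l * solWeight m τ ς A B k l) * (a / B) ^ i := by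
  have hpoly := (polySize_pos (F := F) hk l).le
  have hsol (l') := solWeight_nonneg (m := m) (τ := τ) (ς := ς) hA hB.le k l'
  by_cases hi : PowerSeries.coeff i (c F q.1) = 0
  · rw [linearTerm, hi, zero_mul, zero_mul, norm_zero]
    exact mul_nonneg (mul_nonneg (by positivity) (mul_nonneg hpoly (hsol l))) (by positivity)
  have hterm : (k : ℝ) ^ q.1.1 * ((l - i).descFactorial q.1.2 : ℝ)
      ≤ polySize F k l * (((l - i : ℕ) : ℝ) + 1) ^ (τ * i) := by
    calc _ ≤ (k : ℝ) ^ q.1.1 * (((l - i : ℕ) : ℝ) + 1) ^ q.1.2 := by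
          gcongr
          exact_mod_cast (Nat.descFactorial_le_pow _ _).trans
            (Nat.pow_le_pow_left (Nat.le_succ (l - i)) q.1.2)
      _ ≤ polySize F k (l - i) * (((l - i : ℕ) : ℝ) + 1) ^ (τ * i) :=
          term_le_polySize_mul_rpow_of_coeff_ne_zero hτ hσ q hi hk (l - i)
      _ ≤ _ := by
          gcongr
          exact polySize_mono k (Nat.sub_le _ _)
  rw [linearTerm, norm_mul, norm_mul, norm_mul, norm_pow, Complex.norm_natCast,
    Complex.norm_natCast]
  calc _ ≤ C * a ^ (m + 1) * a ^ i * (polySize F k l * (((l - i : ℕ) : ℝ) + 1) ^ (τ * i)) *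
        solWeight m τ ς A B k (l - i) := by
        gcongr
        exact norm_coeff_c_le hC ha hF q i
    _ = C * a ^ (m + 1) * a ^ i * polySize F k l *
        ((((l - i : ℕ) : ℝ) + 1) ^ (τ * i) * solWeight m τ ς A B k (l - i)) := by ring
    _ ≤ C * a ^ (m + 1) * a ^ i * polySize F k l * (solWeight m τ ς A B k l * (1 / B) ^ i) := by
        gcongr C * a ^ (m + 1) * a ^ i * polySize F k l * ?_
        exact rpow_mul_solWeight_sub_le hτ hA hB k hil
    _ = _ := by
        rw [div_eq_mul_one_div a B, mul_pow]
        ring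

lemma norm_sum_linearTerm_le (hτ : 0 ≤ τ) (hA : 0 ≤ A) (hC : 0 ≤ C) (ha : 1 ≤ a)
    (haB : 2 * a ≤ B) (hF : ∀ e, ‖MvPowerSeries.coeff e (taylor F)‖ ≤ C * a ^ (∑ v, e v))
    (hσ : ∀ q ∈ Λ₁ F, d F q ≤ τ * p F q) {k l : ℕ} (hk : 1 ≤ k)
    (hW : ∀ l' < l, ‖coeff₂ u k l'‖ ≤ solWeight m τ ς A B k l') :
    ‖∑ q : Idx m, ∑ i ∈ Finset.range l, linearTerm F u q.1 k l (i + 1)‖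
      ≤ Fintype.card (Idx m) * (C * a ^ (m + 1) * (2 * (a / B))) *
        (polySize F k l * solWeight m τ ς A B k l) := by
  have hB : 0 < B := by linarith
  let D := C * a ^ (m + 1) * (polySize F k l * solWeight m τ ς A B k l)
  have hD : 0 ≤ D := mul_nonneg (by positivity)
    (mul_nonneg (polySize_pos hk l).le (solWeight_nonneg hA hB.le k l))
  have hq (q : Idx m) : ‖∑ i ∈ Finset.range l, linearTerm F u q.1 k l (i + 1)‖
      ≤ D * (2 * (a / B)) := by
    calc _ ≤ ∑ i ∈ Finset.range l, D * (a / B) ^ (i + 1) := by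
          refine (norm_sum_le _ _).trans (Finset.sum_le_sum fun i hi => ?_)
          have hi : i < l := Finset.mem_range.1 hi
          exact norm_linearTerm_le hτ hA hB hC ha hF hσ q hk (by omega) (hW _ (by omega))
      _ = D * ∑ i ∈ Finset.range l, (a / B) ^ (i + 1) := by rw [Finset.mul_sum]
      _ ≤ D * (2 * (a / B)) := by
          gcongr
          refine sum_pow_succ_le (by positivity) ?_ l
          rw [div_le_div_iff₀ hB (by norm_num)]
          linarith
  calc _ ≤ ∑ _q : Idx m, D * (2 * (a / B)) :=
        (norm_sum_le _ _).trans (Finset.sum_le_sum fun q _ => hq q)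
    _ = _ := by
        rw [Finset.sum_const, Finset.card_univ, nsmul_eq_mul]
        ring

lemma mul_pow_le_solWeight_one (hτ : 0 ≤ τ) (hA : 0 ≤ A) (hB : 0 ≤ B) (l : ℕ) :
    A * B ^ l ≤ solWeight m τ ς A B 1 l := by
  have hfact : (1 : ℝ) ≤ (l ! : ℝ) ^ τ :=
    Real.one_le_rpow (by exact_mod_cast Nat.factorial_pos l) hτ
  simp only [solWeight, xWeight, Nat.sub_self, mul_zero, zero_add, Nat.multichoose_one,
    Nat.factorial_zero, Nat.cast_one, Real.one_rpow, mul_one]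
  norm_num
  exact mul_le_mul_of_nonneg_left (le_mul_of_one_le_right (by positivity) hfact) hA

lemma norm_aCoeff_le {ε : ℝ} (hτ : 0 ≤ τ) (hA : 0 ≤ A) (hε : 0 ≤ ε) (ha : 0 ≤ a) (haB : a ≤ B)
    (hF : ∀ e, ‖MvPowerSeries.coeff e (taylor F)‖ ≤ C * a ^ (∑ v, e v))
    (hCa : C * a ≤ ε * A) (l : ℕ) :
    ‖aCoeff F l‖ ≤ ε * (polySize F 1 l * solWeight m τ ς A B 1 l) := by
  have hcoeff : ‖aCoeff F l‖ ≤ C * a ^ (l + 1) := by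
    refine (hF _).trans_eq ?_
    rw [sum_eq_tzDeg_add, tzDeg_linearExpo, linearExpo_apply_vx, add_comm]
  have hpoly : (1 : ℝ) ≤ polySize F 1 l := by simpa using pow_le_polySize (F := F) 1 l
  have hB : 0 ≤ B := ha.trans haB
  calc ‖aCoeff F l‖ ≤ C * a ^ (l + 1) := hcoeff
    _ = C * a * a ^ l := by ring
    _ ≤ ε * A * B ^ l := by gcongr
    _ = ε * (1 * (A * B ^ l)) := by ring
    _ ≤ _ := by
        gcongr
        exact mul_pow_le_solWeight_one hτ hA hB l

lemma norm_recRhs_le {ε : ℝ} (hτ : 0 ≤ τ) (hς : 0 ≤ ς) (hC : 0 ≤ C) (ha : 1 ≤ a)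
    (hF : ∀ e, ‖MvPowerSeries.coeff e (taylor F)‖ ≤ C * a ^ (∑ v, e v))
    (hR : ∀ e, MvPowerSeries.coeff e (R₂ F) ≠ 0 → ∀ q : Idx m, e (vz q) ≠ 0 →
      (q.1.1 : ℝ) + q.1.2 + τ * (q.1.2 - e (vx m)) - m ≤ ς * ((tzDeg e : ℝ) - 1))
    (hσ : ∀ q ∈ Λ₁ F, d F q ≤ τ * p F q)
    (hε : 0 ≤ ε) (haB : 2 * a ≤ B)
    (hBε : Fintype.card (Idx m) * (C * a ^ (m + 1) * (2 * (a / B))) ≤ ε)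
    (hN : 1 ≤ N) (hNε : C * 2 ^ Fintype.card (Var m) / N ≤ ε) (hA1 : 1 ≤ A)
    (hA : 4 * N * (a * monomialConst m τ ς B) ^ 2 ≤ A) (hAε : C * a ≤ ε * A)
    (hu : ∀ l, coeff₂ u 0 l = 0) {k l : ℕ} (hk : 1 ≤ k)
    (hWk : ∀ k' < k, ∀ l', 1 ≤ k' → ‖coeff₂ u k' l'‖ ≤ solWeight m τ ς A B k' l')
    (hWl : ∀ l' < l, ‖coeff₂ u k l'‖ ≤ solWeight m τ ς A B k l') :
    ‖recRhs F u k l‖ ≤ 3 * ε * (polySize F k l * solWeight m τ ς A B k l) := by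
  have hA0 : 0 ≤ A := by linarith
  have hB0 : 0 ≤ B := by linarith
  have hsol (k' l') := solWeight_nonneg (m := m) (τ := τ) (ς := ς) hA0 hB0 k' l'
  have hsize := mul_nonneg (polySize_pos (F := F) hk l).le (hsol k l)
  have hinhom : ‖(if k = 1 then aCoeff F l else 0 : ℂ)‖
      ≤ ε * (polySize F k l * solWeight m τ ς A B k l) := by
    split_ifs with h
    · subst h
      exact norm_aCoeff_le hτ hA0 hε (by linarith) (by linarith) hF hAε l
    · rw [norm_zero]
      positivity
  have hlin := (norm_sum_linearTerm_le hτ hA0 hC ha haB hF hσ hk hWl).trans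
    (mul_le_mul_of_nonneg_right hBε hsize)
  -- `R₂` has order two in `(t, z)`, so only the part of `u` of degree `< k` in `t` enters.
  let v : FPS := mk₂ fun k' l' => if k' < k then coeff₂ u k' l' else 0
  have hv0 (l) : coeff₂ v 0 l = 0 := by simp [v, hu]
  have hvW (k' l') (hk' : 1 ≤ k') : ‖coeff₂ v k' l'‖ ≤ solWeight m τ ς A B k' l' := by
    rw [coeff₂_mk₂]
    split_ifs with h
    · exact hWk k' h l' hk'
    · exact norm_zero.trans_le (hsol _ _)
  have hnonlin : ‖coeff₂ (MvPowerSeries.subst (jet m u) (R₂ F)) k l‖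
      ≤ ε * (polySize F k l * solWeight m τ ς A B k l) := by
    rw [coeff₂_subst_jet_R₂_congr hu hv0 fun k' hk' l' => by simp [v, hk']]
    refine (norm_coeff₂_subst_R₂_le hτ hς hC ha hF hR haB hN hA1 hA hv0 hvW hk l).trans
      (mul_le_mul hNε ?_ (mul_nonneg (by positivity) (hsol k l)) hε)
    exact mul_le_mul_of_nonneg_right (pow_le_polySize k l) (hsol k l)
  rw [recRhs]
  linarith [norm_add₃_le (a := (if k = 1 then aCoeff F l else 0 : ℂ))
    (b := ∑ q : Idx m, ∑ i ∈ Finset.range l, linearTerm F u q.1 k l (i + 1))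
    (c := coeff₂ (MvPowerSeries.subst (jet m u) (R₂ F)) k l)]

open Filter in
lemma exists_norm_coeff₂_le_solWeight (hτ : 0 ≤ τ) (hς : 0 ≤ ς) (hC : 0 ≤ C) (ha : 1 ≤ a)
    (hF : ∀ e, ‖MvPowerSeries.coeff e (taylor F)‖ ≤ C * a ^ (∑ v, e v))
    (hR : ∀ e, MvPowerSeries.coeff e (R₂ F) ≠ 0 → ∀ q : Idx m, e (vz q) ≠ 0 →
      (q.1.1 : ℝ) + q.1.2 + τ * (q.1.2 - e (vx m)) - m ≤ ς * ((tzDeg e : ℝ) - 1))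
    (hσ : ∀ q ∈ Λ₁ F, d F q ≤ τ * p F q) {δ : ℝ} (hδ : 0 < δ)
    (hL : ∀ k l : ℕ, 1 ≤ k → δ * polySize F k l ≤ ‖L F k l‖)
    (hu : ∀ l, coeff₂ u 0 l = 0)
    (heq : ∀ k l : ℕ, 1 ≤ k → L F k l * coeff₂ u k l = recRhs F u k l) :
    ∃ A B : ℝ, 1 ≤ A ∧ 1 ≤ B ∧ ∀ k l, 1 ≤ k → ‖coeff₂ u k l‖ ≤ solWeight m τ ς A B k l := by
  have hε : 0 < δ / 3 := by positivity
  have hlim (x y : ℝ) : ∀ᶠ z : ℝ in atTop, x * (y / z) ≤ δ / 3 := by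
    have h := (tendsto_const_nhds (x := y).div_atTop tendsto_id).const_mul x
    rw [mul_zero] at h
    exact h.eventually (ge_mem_nhds hε)
  obtain ⟨B, haB, hBε⟩ := ((eventually_ge_atTop (2 * a)).and
    (hlim (Fintype.card (Idx m) * (C * a ^ (m + 1) * 2)) a)).exists
  obtain ⟨N, hN, hNε⟩ := ((eventually_ge_atTop 1).and
    (hlim 1 (C * 2 ^ Fintype.card (Var m)))).exists
  obtain ⟨A, hA1, hA, hAε⟩ := ((eventually_ge_atTop 1).and
    ((eventually_ge_atTop (4 * N * (a * monomialConst m τ ς B) ^ 2)).and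
      (eventually_ge_atTop (C * a / (δ / 3))))).exists
  refine ⟨A, B, hA1, by linarith, fun k => ?_⟩
  induction k using Nat.strong_induction_on with
  | _ k ihk =>
  intro l
  induction l using Nat.strong_induction_on with
  | _ l ihl =>
  intro hk
  have hpoly := polySize_pos (F := F) hk l
  have hrhs := norm_recRhs_le hτ hς hC ha hF hR hσ hε.le haB (by linarith) hN (by linarith) hA1 hA
    (by rwa [div_le_iff₀' hε] at hAε) hu hk ihk fun l' hl' => ihl l' hl' hk
  refine le_of_mul_le_mul_left ?_ (mul_pos hδ hpoly)
  calc δ * polySize F k l * ‖coeff₂ u k l‖ ≤ ‖L F k l‖ * ‖coeff₂ u k l‖ := by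
        gcongr
        exact hL k l hk
    _ = ‖recRhs F u k l‖ := by rw [← norm_mul, heq k l hk]
    _ ≤ 3 * (δ / 3) * (polySize F k l * solWeight m τ ς A B k l) := hrhs
    _ = _ := by ring

end Estimate

/-! ### Convergence and Gevrey growth -/

lemma eventually_mul_norm_lt {E X : Type*} [SeminormedAddCommGroup E] [TopologicalSpace X]
    {g : X → E} {x : X} (hg : ContinuousAt g x) (hx : g x = 0) (a : ℝ) {ε : ℝ} (hε : 0 < ε) :
    ∀ᶠ y in 𝓝 x, a * ‖g y‖ < ε :=
  (hg.norm.const_mul a).eventually_lt_const (by simpa [hx])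

lemma isConvergent_of_norm_coeff₂_le {f : FPS} {a b : ℝ} (ha : 0 ≤ a) (hb : 0 ≤ b)
    (h : ∀ k l, ‖coeff₂ f k l‖ ≤ a ^ k * b ^ l) : IsConvergent f := by
  have hsmall {g : ℂ × ℂ → ℂ} (hg : ContinuousAt g 0) (hg0 : g 0 = 0) (c : ℝ) :
      ∀ᶠ w in 𝓝 0, c * ‖g w‖ < 1 / 2 := eventually_mul_norm_lt hg hg0 c one_half_pos
  filter_upwards [hsmall continuousAt_fst rfl a, hsmall continuousAt_snd rfl b] with w hw₁ hw₂
  have hgeom : Summable fun y : ℕ × ℕ => (1 / 2 : ℝ) ^ y.1 * (1 / 2 : ℝ) ^ y.2 :=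
    summable_geometric_two.mul_of_nonneg summable_geometric_two
      (fun _ => by positivity) fun _ => by positivity
  refine expoEquiv.summable_iff.1 (Summable.of_norm_bounded hgeom fun y => ?_)
  simp only [Function.comp_apply, expoEquiv, Equiv.coe_fn_mk, expo_apply_zero, expo_apply_one,
    norm_mul, norm_pow]
  calc ‖coeff₂ f y.1 y.2‖ * ‖w.1‖ ^ y.1 * ‖w.2‖ ^ y.2
      ≤ a ^ y.1 * b ^ y.2 * ‖w.1‖ ^ y.1 * ‖w.2‖ ^ y.2 := by gcongr; exact h y.1 y.2
    _ = (a * ‖w.1‖) ^ y.1 * (b * ‖w.2‖) ^ y.2 := by rw [mul_pow, mul_pow]; ring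
    _ ≤ _ := by gcongr

lemma coeff₂_borel (s σ : ℝ) (f : FPS) (k l : ℕ) : coeff₂ (borel s σ f) k l
    = coeff₂ f k l / (((k ! : ℝ) ^ (s - 1) * (l ! : ℝ) ^ (σ - 1) : ℝ) : ℂ) := by
  simp only [coeff₂, borel, MvPowerSeries.coeff_apply, expo_apply_zero, expo_apply_one]

lemma mem_gevrey_of_norm_coeff₂_le {f : FPS} {a b s σ τ ς : ℝ} (ha : 0 ≤ a) (hb : 0 ≤ b)
    (hς : ς ≤ s - 1) (hτ : τ ≤ σ - 1)
    (h : ∀ k l, ‖coeff₂ f k l‖ ≤ a ^ k * b ^ l * ((k ! : ℝ) ^ ς * (l ! : ℝ) ^ τ)) :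
    f ∈ Gevrey s σ := by
  refine isConvergent_of_norm_coeff₂_le ha hb fun k l => ?_
  have hk : (1 : ℝ) ≤ k ! := by exact_mod_cast k.factorial_pos
  have hl : (1 : ℝ) ≤ l ! := by exact_mod_cast l.factorial_pos
  have hpos : 0 < (k ! : ℝ) ^ (s - 1) * (l ! : ℝ) ^ (σ - 1) := by positivity
  rw [coeff₂_borel, norm_div, Complex.norm_real, Real.norm_of_nonneg hpos.le, div_le_iff₀ hpos]
  refine (h k l).trans ?_
  gcongr

lemma multichoose_le_two_pow (a l : ℕ) : Nat.multichoose a l ≤ 2 ^ (a + l) := by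
  rw [Nat.multichoose_eq]
  exact (Nat.choose_le_two_pow _ _).trans (Nat.pow_le_pow_right two_pos (Nat.sub_le _ _))

lemma xWeight_le {τ B : ℝ} (hτ : 0 ≤ τ) (hB : 0 ≤ B) {a : ℕ} (ha : 1 ≤ a) (l : ℕ) :
    xWeight τ B a l ≤ B ^ l * (l ! : ℝ) ^ τ * ((2 : ℝ) ^ (1 + τ)) ^ (a + l) := by
  have hmc : (Nat.multichoose a l : ℝ) ^ (1 + τ) ≤ ((2 : ℝ) ^ (1 + τ)) ^ (a + l) := by
    rw [Real.rpow_pow_comm two_pos.le]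
    exact Real.rpow_le_rpow (by positivity) (by exact_mod_cast multichoose_le_two_pow a l)
      (by positivity)
  calc xWeight τ B a l
      = B ^ l * (l ! : ℝ) ^ τ * (Nat.multichoose a l : ℝ) ^ (1 + τ) := by
        rw [xWeight, ← factorial_mul_multichoose ha, Nat.cast_mul,
          Real.mul_rpow (by positivity) (by positivity),
          Real.rpow_one_add' (by positivity) (by positivity)]
        ring
    _ ≤ _ := by gcongr

lemma solWeight_le {m : ℕ} {τ ς A B : ℝ} (hτ : 0 ≤ τ) (hς : 0 ≤ ς) (hA : 1 ≤ A) (hB : 0 ≤ B)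
    {k : ℕ} (hk : 1 ≤ k) (l : ℕ) :
    solWeight m τ ς A B k l ≤ (A ^ 2 * ((2 : ℝ) ^ (1 + τ)) ^ (2 * m + 1)) ^ k *
      (B * (2 : ℝ) ^ (1 + τ)) ^ l * ((k ! : ℝ) ^ ς * (l ! : ℝ) ^ τ) := by
  have hApow : A ^ (2 * k - 1) ≤ (A ^ 2) ^ k := by
    rw [← pow_mul]
    exact pow_le_pow_right₀ hA (Nat.sub_le _ _)
  have hfact : ((k - 1)! : ℝ) ^ ς ≤ (k ! : ℝ) ^ ς := by
    gcongr
    exact Nat.sub_le _ _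
  have hkpow : (k : ℝ) ^ (-(m + τ * m + 2)) ≤ 1 :=
    Real.rpow_le_one_of_one_le_of_nonpos (by exact_mod_cast hk)
      (neg_nonpos.2 (by positivity))
  have htwo : ((2 : ℝ) ^ (1 + τ)) ^ ((2 * m + 1) * (k - 1) + 1 + l)
      ≤ ((2 : ℝ) ^ (1 + τ)) ^ ((2 * m + 1) * k + l) := by
    refine pow_le_pow_right₀ (Real.one_le_rpow one_le_two (by positivity)) ?_
    obtain ⟨k, rfl⟩ := Nat.exists_eq_add_of_le' hk
    rw [Nat.add_sub_cancel, mul_add]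
    omega
  calc solWeight m τ ς A B k l
      ≤ (A ^ 2) ^ k * (k ! : ℝ) ^ ς * 1 *
        (B ^ l * (l ! : ℝ) ^ τ * ((2 : ℝ) ^ (1 + τ)) ^ ((2 * m + 1) * k + l)) := by
        rw [solWeight]
        gcongr
        · exact xWeight_nonneg hB _ _
        refine (xWeight_le hτ hB (Nat.le_add_left _ _) l).trans ?_
        gcongr
    _ = _ := by rw [pow_add, pow_mul, mul_pow, mul_pow]; ring

lemma exists_norm_coeff₂_le {m : ℕ} {F : (Var m → ℂ) → ℂ} {u : FPS} {τ ς : ℝ}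
    (hF : AnalyticAt ℂ F 0)
    (h0 : ∀ l, MvPowerSeries.coeff (Finsupp.single (vx m) l) (taylor F) = 0) (hA3 : A3 F)
    (hN : NonResonance F) (hGP : GenPoincare F) (hu : IsFormalSolution F u)
    (hτ : 0 ≤ τ) (hς : 0 ≤ ς)
    (hR : ∀ e, MvPowerSeries.coeff e (R₂ F) ≠ 0 → ∀ q : Idx m, e (vz q) ≠ 0 →
      (q.1.1 : ℝ) + q.1.2 + τ * (q.1.2 - e (vx m)) - m ≤ ς * ((tzDeg e : ℝ) - 1))
    (hσ : ∀ q ∈ Λ₁ F, d F q ≤ τ * p F q) :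
    ∃ a b : ℝ, 0 ≤ a ∧ 0 ≤ b ∧
      ∀ k l, ‖coeff₂ u k l‖ ≤ a ^ k * b ^ l * ((k ! : ℝ) ^ ς * (l ! : ℝ) ^ τ) := by
  obtain ⟨C, a, hC, ha, htaylor⟩ := exists_norm_coeff_taylor_le hF
  obtain ⟨δ, hδ, hL⟩ := exists_mul_polySize_le_norm_L hN hGP
  obtain ⟨hu0, heq⟩ := (isFormalSolution_iff h0 hA3 u).1 hu
  obtain ⟨A, B, hA, hB, hW⟩ :=
    exists_norm_coeff₂_le_solWeight hτ hς hC.le ha htaylor hR hσ hδ hL hu0 heq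
  refine ⟨A ^ 2 * ((2 : ℝ) ^ (1 + τ)) ^ (2 * m + 1), B * (2 : ℝ) ^ (1 + τ), by positivity,
    by positivity, fun k l => ?_⟩
  rcases Nat.eq_zero_or_pos k with rfl | hk
  · rw [hu0, norm_zero]
    positivity
  · exact (hW k l hk).trans (solWeight_le hτ hς hA (by linarith) hk l)

section Indices

variable {m : ℕ} {F : (Var m → ℂ) → ℂ}

lemma one_le_σ₀ : 1 ≤ σ₀ F := (Finset.le_fold_max _).2 (Or.inl le_rfl)

lemma one_le_s₀ : 1 ≤ s₀ F :=
  le_add_of_nonneg_right ((Finset.le_fold_max _).2 (Or.inl le_rfl))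

lemma p_ne_zero {q : ℕ × ℕ} (hq : q ∈ Λ₁ F) : p F q ≠ 0 := by
  classical
  obtain ⟨-, h0, hne⟩ := Finset.mem_filter.1 hq
  rw [p, Ne, ENat.toNat_eq_zero, not_or]
  exact ⟨PowerSeries.order_ne_zero_iff_constCoeff_eq_zero.2 h0,
    fun h => hne (PowerSeries.order_eq_top.1 h)⟩

lemma d_le_of_mem_Λ₁ {q : ℕ × ℕ} (hq : q ∈ Λ₁ F) : d F q ≤ (σ₀ F - 1) * p F q := by
  have hp : (0 : ℝ) < p F q := by exact_mod_cast Nat.pos_of_ne_zero (p_ne_zero hq)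
  have hσ : ((p F q : ℝ) + d F q) / (p F q : ℝ) ≤ σ₀ F :=
    (Finset.le_fold_max _).2 (Or.inr ⟨q, hq, le_rfl⟩)
  rw [div_le_iff₀ hp] at hσ
  linarith

lemma coeff_iterate_pderiv_ne_zero_iff {ι K : Type*} [Field K] [CharZero K] (i : ι)
    (f : MvPowerSeries ι K) (μ : ℕ) (e : ι →₀ ℕ) :
    MvPowerSeries.coeff e ((MvPowerSeries.pderiv K i)^[μ] f) ≠ 0 ↔
      MvPowerSeries.coeff (e + Finsupp.single i μ) f ≠ 0 := by
  induction μ generalizing e with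
  | zero => simp
  | succ μ ih =>
    have h : ((e i : K) + 1) ≠ 0 := Nat.cast_add_one_ne_zero _
    rw [Function.iterate_succ_apply', MvPowerSeries.coeff_pderiv, mul_ne_zero_iff,
      and_iff_left h, ih, add_assoc, ← Finsupp.single_add, add_comm 1 μ]

lemma coeff_atXZero_pderiv_ne_zero_iff (f : MvPowerSeries (Var m) ℂ) (μ : ℕ) (q : Idx m)
    {e : Var m →₀ ℕ} (he : e (vx m) = 0) :
    MvPowerSeries.coeff e (atXZero (MvPowerSeries.pderiv ℂ (vz q)
        ((MvPowerSeries.pderiv ℂ (vx m))^[μ] f))) ≠ 0 ↔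
      MvPowerSeries.coeff (e + Finsupp.single (vz q) 1 + Finsupp.single (vx m) μ) f ≠ 0 := by
  have h : ((e (vz q) : ℂ) + 1) ≠ 0 := Nat.cast_add_one_ne_zero _
  have hatX (g : MvPowerSeries (Var m) ℂ) :
      MvPowerSeries.coeff e (atXZero g) = MvPowerSeries.coeff e g := if_pos he
  rw [hatX, MvPowerSeries.coeff_pderiv, mul_ne_zero_iff, and_iff_left h,
    coeff_iterate_pderiv_ne_zero_iff]

lemma Lval_ne_zero (μ : ℕ) (q : Idx m) : Lval F μ q ≠ 0 := by
  rw [Lval, MvPowerSeries.order_ne_zero_iff_constCoeff_eq_zero,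
    ← MvPowerSeries.coeff_zero_eq_constantCoeff_apply]
  by_contra h
  rw [← ne_eq, coeff_atXZero_pderiv_ne_zero_iff _ _ _ (by simp)] at h
  have hdeg := two_le_tzDeg_of_coeff_R₂_ne_zero h
  simp [tzDeg, Finsupp.single_apply] at hdeg

lemma Lval_le {e : Var m →₀ ℕ} (he : MvPowerSeries.coeff e (R₂ F) ≠ 0) {q : Idx m}
    (hq : e (vz q) ≠ 0) : Lval F (e (vx m)) q ≤ ((tzDeg e - 1 : ℕ) : ℕ∞) := by
  classical
  let e' := (e - Finsupp.single (vz q) 1).erase (vx m)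
  have hsum : e' + Finsupp.single (vz q) 1 + Finsupp.single (vx m) (e (vx m)) = e := by
    ext v
    rcases eq_or_ne v (vx m) with rfl | hv
    · simp [e']
    rcases eq_or_ne v (vz q) with rfl | hv'
    · simp [e', Nat.sub_add_cancel (Nat.one_le_iff_ne_zero.2 hq)]
    · simp [e', hv, hv']
  have hx : e' (vx m) = 0 := Finsupp.erase_same
  have hdeg : e'.degree = tzDeg e - 1 := by
    rw [Finsupp.degree_eq_sum, sum_eq_tzDeg_add, hx, ← hsum]
    simp [tzDeg, Finsupp.single_apply, Finset.sum_add_distrib]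
  rw [← hdeg, Lval]
  refine MvPowerSeries.order_le ?_
  rwa [coeff_atXZero_pderiv_ne_zero_iff _ _ _ hx, hsum]

lemma s₀Quot_le {μ : ℕ} (hμ : μ < m) (q : Idx m) : s₀Quot F μ q ≤ s₀ F - 1 := by
  rw [s₀, add_sub_cancel_left]
  exact (Finset.le_fold_max _).2 (Or.inr ⟨(μ, q), by simpa using hμ, le_rfl⟩)

lemma le_s₀_mul_of_lt {e : Var m →₀ ℕ} (he : MvPowerSeries.coeff e (R₂ F) ≠ 0) {q : Idx m}
    (hq : e (vz q) ≠ 0) (hμ : e (vx m) < m) :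
    (q.1.1 : ℝ) + e (vx m) + σ₀ F * (q.1.2 - e (vx m)) - m
      ≤ (s₀ F - 1) * ((tzDeg e : ℝ) - 1) := by
  have hle := Lval_le he hq
  have htop : Lval F (e (vx m)) q ≠ ⊤ := ne_top_of_le_ne_top (ENat.natCast_ne_top _) hle
  have hpos : (0 : ℝ) < (Lval F (e (vx m)) q).toNat := by
    have : (Lval F (e (vx m)) q).toNat ≠ 0 :=
      (ENat.toNat_eq_zero.not.2 (not_or.2 ⟨Lval_ne_zero _ _, htop⟩))
    exact_mod_cast Nat.pos_of_ne_zero this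
  have hleR : ((Lval F (e (vx m)) q).toNat : ℝ) ≤ (tzDeg e : ℝ) - 1 := by
    have htz := two_le_tzDeg_of_coeff_R₂_ne_zero he
    rw [← Nat.cast_pred (by omega)]
    exact_mod_cast ENat.toNat_le_of_le_natCast hle
  have hquot := s₀Quot_le (F := F) hμ q
  rw [s₀Quot, if_neg htop, div_le_iff₀ hpos] at hquot
  exact hquot.trans (mul_le_mul_of_nonneg_left hleR (sub_nonneg.2 one_le_s₀))

lemma le_s₀_mul {e : Var m →₀ ℕ} (he : MvPowerSeries.coeff e (R₂ F) ≠ 0) {q : Idx m}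
    (hq : e (vz q) ≠ 0) :
    (q.1.1 : ℝ) + q.1.2 + (σ₀ F - 1) * (q.1.2 - e (vx m)) - m
      ≤ (s₀ F - 1) * ((tzDeg e : ℝ) - 1) := by
  have hjα := (mem_idxSet.1 q.2).1
  rcases lt_or_ge (e (vx m)) m with hμ | hμ
  · linarith [le_s₀_mul_of_lt he hq hμ]
  · have hdeg : (2 : ℝ) ≤ tzDeg e := by exact_mod_cast two_le_tzDeg_of_coeff_R₂_ne_zero he
    have hαμ : (q.1.2 : ℝ) ≤ e (vx m) := by exact_mod_cast (by omega : q.1.2 ≤ e (vx m))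
    have hjαR : (q.1.1 : ℝ) + q.1.2 ≤ m := by exact_mod_cast hjα
    have hleft := mul_nonpos_of_nonneg_of_nonpos (sub_nonneg.2 (one_le_σ₀ (F := F)))
      (sub_nonpos.2 hαμ)
    have hright : 0 ≤ (s₀ F - 1) * ((tzDeg e : ℝ) - 1) :=
      mul_nonneg (sub_nonneg.2 one_le_s₀) (by linarith)
    linarith

end Indices

end Maillet

end

theorem theorem2p5 (m : ℕ) (hm : 1 ≤ m) (F : (Maillet.Var m → ℂ) → ℂ)
    (r : Maillet.Var m → ℝ) (hr : ∀ v, 0 < r v)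
    (hA1 : Maillet.A1 F r) (hA2 : Maillet.A2 F r) (hA3 : Maillet.A3 F)
    (hN : Maillet.NonResonance F) (hGP : Maillet.GenPoincare F) :
    ∃ u : Maillet.FPS,
      (Maillet.IsFormalSolution F u ∧ ∀ v, Maillet.IsFormalSolution F v → v = u) ∧
      (Maillet.σ₀ F = 1 → Maillet.IsConvergent u) ∧
      (1 < Maillet.σ₀ F →
        ∀ s σ : ℝ, Maillet.s₀ F ≤ s → Maillet.σ₀ F ≤ σ → u ∈ Maillet.Gevrey s σ) := by
  have h0 := hA2.coeff_taylor_vx hA1 hr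
  obtain ⟨u, hu, huniq⟩ := Maillet.existsUnique_formalSolution h0 hA3 hN
  have hgrowth {τ ς : ℝ} := Maillet.exists_norm_coeff₂_le (τ := τ) (ς := ς) (hA1.analyticAt hr)
    h0 hA3 hN hGP hu
  refine ⟨u, ⟨hu, huniq⟩, fun hσ₀ => ?_, fun _ s σ hs hσ => ?_⟩
  · obtain ⟨a, b, ha, hb, h⟩ := hgrowth (τ := 0) (ς := 0) le_rfl le_rfl
      (fun e _ q _ => by
        have hq : (q.1.1 : ℝ) + q.1.2 ≤ m := by exact_mod_cast (Maillet.mem_idxSet.1 q.2).1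
        linarith)
      (fun q hq => by simpa [hσ₀] using Maillet.d_le_of_mem_Λ₁ hq)
    exact Maillet.isConvergent_of_norm_coeff₂_le ha hb fun k l => by simpa using h k l
  · obtain ⟨a, b, ha, hb, h⟩ := hgrowth (sub_nonneg.2 Maillet.one_le_σ₀)
      (sub_nonneg.2 Maillet.one_le_s₀) (fun _ he _ hq => Maillet.le_s₀_mul he hq)
      (fun _ hq => Maillet.d_le_of_mem_Λ₁ hq)
    exact Maillet.mem_gevrey_of_norm_coeff₂_le ha hb (by linarith) (by linarith) h
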